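/- **Setting.** Fix integers $q\ge 1$, $N\ge 1$ and a real $\gamma>0$. A partition of length $n$ is an increasing tuple $\mu\in\mathbb N_0^n$, $\mu_1\le\dots\le\mu_n$; $m(\mu,k)$ is the number of entries equal to $k$ and $M(\mu)!=\prod_k m(\mu,k)!$. We write $\mu\preceq\nu$ if $\mu,\nu$ are partitions of the same length and the same integer with $\sum_{j\ge i}\mu_j\le\sum_{j\ge i}\nu_j$ for all $i$. For a root $(N,b)$, i.e. a partition $b$ of length $N$, put $\lambda^{(q)}_N(b)=(b_1,q+b_2,\dots,q(N-1)+b_N)$. Compositions are $(b^{(1)},b^{(2)})=(b^{(1)}_1,\dots,b^{(1)}_{N_1},\,b^{(1)}_{N_1}+b^{(2)}_1,\dots,b^{(1)}_{N_1}+b^{(2)}_{N_2})$, and for $\mu^{(j)}\preceq\lambda^{(q)}_{N_j}(b^{(j)})$, $\mu^{(1)}\cup\mu^{(2)}=(\mu^{(1)},\,qN_1+b^{(1)}_{N_1}+\mu^{(2)}_1,\dots,qN_1+b^{(1)}_{N_1}+\mu^{(2)}_{N_2})$. A partition $\mu\preceq\lambda^{(q)}_N(b)$ has a renewal point at $N_1\in\{1,\dots,N-1\}$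 if $\mu=\mu^{(1)}\cup\mu^{(2)}$ and $b=(b^{(1)},b^{(2)})$ for some partitions $b^{(1)}\in\mathbb N_0^{N_1}$, $b^{(2)}\in\mathbb N_0^{N-N_1}$, $\mu^{(1)}\preceq\lambda^{(q)}_{N_1}(b^{(1)})$, $\mu^{(2)}\preceq\lambda^{(q)}_{N-N_1}(b^{(2)})$; it is irreducible if it has no renewal point. *Coefficients.* On the bosonic Fock space with vacuum $|0\rangle$ and $[a_n,a_m^*]=n\delta_{nm}$, $n,m\ge1$, let $D_0^\pm=1$, $D_\ell^\pm=0$ for $\ell<0$, and for $\ell>0$ $$D^+_\ell=\sum_{k=1}^\ell\frac{(-\sqrt q)^k}{k!}\sum_{j_1+\dots+j_k=\ell}\prod_s\frac{a_{j_s}}{j_s},\qquad D^-_\ell=\sum_{k=1}^\ell\frac{\sqrt q^{\,k}}{k!}\sum_{j_1+\dots+j_k=\ell}\prod_s\frac{a^*_{j_s}}{j_s}\qquad (j_s\ge1),$$ and $W_m=\sum_{\ell\in\mathbb Z}D^-_{m+\ell}D^+_\ell$. Put $$w_b(\lambda)=\frac1{M(b)!}\sum_{\tau\in S_N}\langle0|W_{\lambda_N-q(N-1)-b_{\tau(N)}}\cdots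 W_{\lambda_2-q-b_{\tau(2)}}W_{\lambda_1-b_{\tau(1)}}|0\rangle,$$ $\Delta_b(\lambda)=\sum_j\big[(q(j-1)+b_j)^2-\lambda_j^2\big]$ and $h_b(\lambda)=e^{-\gamma^2\Delta_b(\lambda)/2}\,w_b(\lambda)/\sqrt{M(\lambda)!}$. *Wavefunctions.* Functions of $N$ variables on the cylinder are measured in $L^2$ over $(\mathbb R\times[0,2\pi/\gamma))^N$ with weight $e^{-\sum_j x_j^2}$, $z_j=x_j+iy_j$. The orbitals are $\varphi_k(z)=\sqrt{\gamma/(2\pi^{3/2})}\,e^{-\gamma^2k^2/2}e^{\gamma kz}$, $k\in\mathbb N_0$, and $\Phi_\lambda(z)=\frac1{\sqrt{M(\lambda)!\,N!}}\sum_{\sigma\in S_N}\mathrm{sgn}(\sigma)^q\prod_j\varphi_{\lambda_j}(z_{\sigma(j)})$. Let $$\Psi_{b,N}(z)=\kappa_{b,N}\,m_b(e^{\gamma z_1},\dots,e^{\gamma z_N})\prod_{j<k}(e^{\gamma z_j}-e^{\gamma z_k})^q,\qquad \widehat\Psi_{b,N}=\sum_{\lambda\preceq\lambda^{(q)}_N(b),\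 \lambda\text{ irreducible}}h_b(\lambda)\,\Phi_\lambda ,$$ with $m_b(x)=\frac1{M(b)!}\sum_{\sigma\in S_N}\prod_jx_{\sigma(j)}^{b_j}$ and $\kappa_{b,N}^{-1}=(-1)^{qN(N-1)/2}\sqrt{N!}\,\big(2\pi^{3/2}/\gamma\big)^{N/2}\exp\big(\frac{\gamma^2}2\sum_j[q(j-1)+b_j]^2\big)$. If $f$ is a function of $n$ variables belonging to a root $(n,b^{(1)})$ and $g$ is a function of $m$ variables, then $f\odot g=f\otimes_qT_sg$ with $s=qn+b^{(1)}_n$, where $T_s$ is the linear shift of every particle by $s$ orbitals, $(T_sg)(z)=\prod_je^{\gamma sz_j-\gamma^2s^2/2}\,g(z_1-\gamma s,\dots,z_m-\gamma s)$, so that $T_s\Phi_\lambda=\Phi_{\lambda+(s,\dots,s)}$, and $\otimes_q$ is the $q$-symmetrized product $(f\otimes_qg)(z)=\frac1{\sqrt{n!\,m!\,(n+m)!}}\sum_{\sigma\in S_{n+m}}\mathrm{sgn}(\sigma)^qf(z_{\sigma(1)},\dots,z_{\sigma(n)})\,g(z_{\sigma(n+1)},\dots,z_{\sigma(n+m)})$.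 This bilinear product satisfies $\Phi_{\lambda^{(1)}}\odot\Phi_{\lambda^{(2)}}=\Phi_{\lambda^{(1)}\cup\lambda^{(2)}}$ for $\lambda^{(1)}\preceq\lambda^{(q)}_{n}(b^{(1)})$. **Theorem.** For every root $(N,b)$ and every $\gamma>0$, $$\Psi_{b,N}=\sum_{r=1}^N\ \sum_{\substack{N_1,\dots,N_r\ge1\\N_1+\dots+N_r=N}}\widehat\Psi_{b^{(1)},N_1}\odot\widehat\Psi_{b^{(2)},N_2}\odot\cdots\odot\widehat\Psi_{b^{(r)},N_r},\qquad b=(b^{(1)},\dots,b^{(r)}),\ b^{(j)}\in\mathbb N_0^{N_j},$$ and the terms on the right side are square integrable and mutually orthogonal. With $$C_q(\gamma)=\gamma^2-2(4q+1)-2q^{-1}\ln\!\big(1-e^{-(4q+1)}\big)-\pi\sqrt{2/3},$$ if $\gamma^2\ge2(4q+1)$, then $\widehat\Psi_{b,N}$ satisfies $$\|\widehat\Psi_{b,N}\|^2\le\exp\!\big(-(q(N-1)+b_N-b_1)\,C_q(\gamma)\big).$$ If $C_q(\gamma)\ge0$, then this bound holds as well and its right side is at most $\exp(-q(N-1)C_q(\gamma))$.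 Finally, $C_q(\gamma)>0$ for all sufficiently large $\gamma$. -/

import Mathlib

open scoped BigOperators Nat ComplexConjugate

noncomputable section

namespace QHall

/-! ### Partitions, dominance order, concatenation -/

/-- The last entry `b_n` of a tuple (and `0` for the empty tuple). -/
def lastEntry {n : ℕ} (b : Fin n → ℕ) : ℕ :=
  if h : 0 < n then b ⟨n - 1, Nat.sub_lt h Nat.one_pos⟩ else 0

/-- Occupation number `m(μ, k)`. -/
def occ {N : ℕ} (μ : Fin N → ℕ) (k : ℕ) : ℕ :=
  (Finset.univ.filter fun j => μ j = k).card

/-- `M(μ)! = ∏_k m(μ, k)!`; orbitals that do not occur in `μ` contribute `0! = 1`. -/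
def occFactorial {N : ℕ} (μ : Fin N → ℕ) : ℕ :=
  ∏ k ∈ Finset.univ.image μ, (occ μ k)!

/-- The root partition `(b_1, q + b_2, …, q (N - 1) + b_N)`. -/
def rootPartition (q : ℕ) {N : ℕ} (b : Fin N → ℕ) : Fin N → ℕ :=
  fun j => q * (j : ℕ) + b j

/-- `μ ⪯ ν`: both are partitions (increasing tuples) of the same integer and `ν` dominates `μ`. -/
def Dominated {N : ℕ} (μ ν : Fin N → ℕ) : Prop :=
  Monotone μ ∧ Monotone ν ∧ ∑ j, μ j = ∑ j, ν j ∧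
    ∀ i, ∑ j ∈ Finset.Ici i, μ j ≤ ∑ j ∈ Finset.Ici i, ν j

/-- Composition `(b₁, b₂)` of two partitions. -/
def concat {n m : ℕ} (b₁ : Fin n → ℕ) (b₂ : Fin m → ℕ) : Fin (n + m) → ℕ :=
  Fin.append b₁ fun j => lastEntry b₁ + b₂ j

/-- Number of orbitals `q n + b_n` covered by the tiles of a root of length `n`. -/
def rootLength (q : ℕ) {n : ℕ} (b : Fin n → ℕ) : ℕ := q * n + lastEntry b

/-- Concatenation `μ₁ ∪ μ₂`, where `μ₁` is dominated by the root partition of `b₁`. -/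
def union (q : ℕ) {n m : ℕ} (b₁ μ₁ : Fin n → ℕ) (μ₂ : Fin m → ℕ) : Fin (n + m) → ℕ :=
  Fin.append μ₁ fun j => rootLength q b₁ + μ₂ j

/-- `μ ⪯ rootPartition q b` has a renewal point at `n`, where `1 ≤ n ≤ N - 1`. -/
def HasRenewalAt (q : ℕ) {N : ℕ} (b μ : Fin N → ℕ) (n : ℕ) : Prop :=
  1 ≤ n ∧ ∃ (m : ℕ) (h : n + m = N), 1 ≤ m ∧
    ∃ (b₁ μ₁ : Fin n → ℕ) (b₂ μ₂ : Fin m → ℕ),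
      Monotone b₁ ∧ Monotone b₂ ∧
      Dominated μ₁ (rootPartition q b₁) ∧ Dominated μ₂ (rootPartition q b₂) ∧
      (∀ j, μ (Fin.cast h j) = union q b₁ μ₁ μ₂ j) ∧
      (∀ j, b (Fin.cast h j) = concat b₁ b₂ j)

/-- Irreducibility: there is no renewal point. -/
def Irred (q : ℕ) {N : ℕ} (b μ : Fin N → ℕ) : Prop := ∀ n, ¬ HasRenewalAt q b μ n

open scoped Classical in
/-- The irreducible partitions dominated by the root partition of `b`. -/
def irredPartitions (q : ℕ) {N : ℕ} (b : Fin N → ℕ) : Finset (Fin N → ℕ) :=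
  (Finset.Nat.antidiagonalTuple N (∑ j, rootPartition q b j)).filter fun μ =>
    Dominated μ (rootPartition q b) ∧ Irred q b μ

theorem mem_irredPartitions (q : ℕ) {N : ℕ} (b μ : Fin N → ℕ) :
    μ ∈ irredPartitions q b ↔ Dominated μ (rootPartition q b) ∧ Irred q b μ := by
  simp only [irredPartitions, Finset.mem_filter, Finset.Nat.mem_antidiagonalTuple]
  exact ⟨fun h => h.2, fun h => ⟨h.1.2.2.1, h⟩⟩

/-! ### The bosonic Fock space of the chiral theory and the expansion coefficients -/

/-- The dense domain `𝓗₀` of the virtual Fock space: the monomial `∏ X_j ^ n_j` stands for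
`∏ (a_j^*) ^ n_j |0⟩`, with modes `j = 1, 2, …`. -/
abbrev Fock : Type := MvPolynomial ℕ+ ℂ

/-- The scalar product for which `[a_n, a_m^*] = n δ_{n m}`, `a_n^*` is the adjoint of `a_n`, and
the vacuum is normalized: the monomials are orthogonal and the norm-square of
`∏ (a_j^*) ^ n_j |0⟩` is `∏ j ^ n_j n_j!`. -/
def fockInner (v w : Fock) : ℂ :=
  ∑ m ∈ v.support, conj (v.coeff m) * w.coeff m *
    ∏ j ∈ m.support, (((j : ℕ) : ℂ) ^ m j * ((m j)! : ℂ))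

/-- The vacuum `|0⟩`. -/
def vacuum : Fock := 1

/-- The creation operator `a_j^*`. -/
def create (j : ℕ+) : Module.End ℂ Fock := LinearMap.mulLeft ℂ (MvPolynomial.X j : Fock)

/-- The annihilation operator `a_j`. -/
def annihilate (j : ℕ+) : Module.End ℂ Fock :=
  ((j : ℕ) : ℂ) • ((MvPolynomial.pderiv j : Derivation ℂ Fock Fock) : Fock →ₗ[ℂ] Fock)

/-- The canonical commutation relations. -/
theorem annihilate_create (n m : ℕ+) (v : Fock) :
    annihilate n (create m v) - create m (annihilate n v) =
      if n = m then ((n : ℕ) : ℂ) • v else 0 := by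
  classical
  simp only [annihilate, create, LinearMap.smul_apply, LinearMap.mulLeft_apply,
    Derivation.coeFn_coe, Derivation.leibniz, MvPolynomial.pderiv_X, smul_eq_mul]
  rcases eq_or_ne n m with h | h
  · subst h
    simp
  · simp [h, Ne.symm h]

/-- The parts `(j_1, …, j_k)` of an ordered composition `j_1 + ⋯ + j_k = l`. -/
def parts {l : ℕ} (c : Composition l) (s : Fin c.length) : ℕ+ :=
  ⟨c.blocksFun s, c.one_le_blocksFun s⟩

/-- `D_l^+`. For `l = 0` the only composition is the empty one and the value is the identity. -/
def Dplus (q : ℕ) (l : ℤ) : Module.End ℂ Fock :=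
  if 0 ≤ l then
    ∑ c : Composition l.toNat,
      (((Real.sqrt q : ℝ) : ℂ) ^ c.length / (c.length ! : ℂ) * (-1) ^ c.length *
        ∏ s, (1 / (((parts c s : ℕ+) : ℕ) : ℂ))) •
        (List.ofFn fun t => annihilate (parts c t)).prod
  else 0

/-- `D_l^-`. -/
def Dminus (q : ℕ) (l : ℤ) : Module.End ℂ Fock :=
  if 0 ≤ l then
    ∑ c : Composition l.toNat,
      (((Real.sqrt q : ℝ) : ℂ) ^ c.length / (c.length ! : ℂ) *
        ∏ s, (1 / (((parts c s : ℕ+) : ℕ) : ℂ))) •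
        (List.ofFn fun t => create (parts c t)).prod
  else 0

/-- `W_m = ∑_{l ∈ ℤ} D_{m+l}^- D_l^+` on `𝓗₀`, where on each vector only finitely many terms are
non-zero (`Wop_support_finite` below). -/
def Wop (q : ℕ) (m : ℤ) (v : Fock) : Fock :=
  ∑ᶠ l : ℤ, Dminus q (m + l) (Dplus q l v)

theorem annihilate_weight {B s : ℕ} (j : ℕ+) {v : Fock}
    (hv : ∀ m, v.coeff m ≠ 0 → Finsupp.weight (fun i : ℕ+ => (i : ℕ)) m + s ≤ B) (m : ℕ+ →₀ ℕ)
    (hm : (annihilate j v).coeff m ≠ 0) :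
    Finsupp.weight (fun i : ℕ+ => (i : ℕ)) m + (s + j) ≤ B := by
  have h : v.coeff (m + Finsupp.single j 1) ≠ 0 := by
    intro h
    apply hm
    simp [annihilate, MvPolynomial.coeff_smul, MvPolynomial.coeff_pderiv, h]
  have := hv _ h
  rw [map_add, Finsupp.weight_single] at this
  simp only [smul_eq_mul, one_mul] at this
  omega

theorem annihilate_prod_weight {B : ℕ} (k : ℕ) (p : Fin k → ℕ+) {v : Fock}
    (hv : ∀ m, v.coeff m ≠ 0 → Finsupp.weight (fun i : ℕ+ => (i : ℕ)) m ≤ B) (m : ℕ+ →₀ ℕ)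
    (hm : ((List.ofFn fun t => annihilate (p t)).prod v).coeff m ≠ 0) :
    Finsupp.weight (fun i : ℕ+ => (i : ℕ)) m + ∑ t, (p t : ℕ) ≤ B := by
  induction k generalizing m with
  | zero => simpa using hv m (by simpa using hm)
  | succ k ih =>
    rw [List.ofFn_succ, List.prod_cons, Module.End.mul_apply] at hm
    have := annihilate_weight (p 0) (ih fun t => p t.succ) m hm
    rw [Fin.sum_univ_succ]
    omega

/-- On each vector of `𝓗₀` all but finitely many of the terms that define `W_m` vanish. -/
theorem Wop_support_finite (q : ℕ) (m : ℤ) (v : Fock) :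
    (Function.support fun l : ℤ => Dminus q (m + l) (Dplus q l v)).Finite := by
  set B := v.support.sup (Finsupp.weight fun i : ℕ+ => (i : ℕ)) with hB
  have hv : ∀ m, v.coeff m ≠ 0 → Finsupp.weight (fun i : ℕ+ => (i : ℕ)) m ≤ B := fun m hm =>
    Finset.le_sup (f := Finsupp.weight fun i : ℕ+ => (i : ℕ)) (MvPolynomial.mem_support_iff.2 hm)
  refine (Set.finite_Icc (0 : ℤ) B).subset fun l hl => ?_
  by_contra hcon
  apply hl
  have h0 : Dplus q l v = 0 := by
    unfold Dplus
    split_ifs with hpos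
    · rw [LinearMap.sum_apply]
      refine Finset.sum_eq_zero fun c _ => ?_
      rw [LinearMap.smul_apply]
      convert smul_zero _
      ext m'
      by_contra hm
      have := annihilate_prod_weight c.length (parts c) hv m' (by simpa using hm)
      have hs : ∑ t, ((parts c t : ℕ+) : ℕ) = l.toNat := c.sum_blocksFun
      simp only [Set.mem_Icc, not_and, not_le] at hcon
      have := hcon hpos
      omega
    · rfl
  simp only [h0, map_zero]

/-- `𝕎(k)|0⟩ = W_{k_N - q(N-1)} ⋯ W_{k_2 - q} W_{k_1}|0⟩`. -/
def WW (q : ℕ) {N : ℕ} (k : Fin N → ℤ) : Fock :=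
  Fin.foldl N (fun v j => Wop q (k j - q * ((j : ℕ) : ℤ)) v) vacuum

/-- `w_b(μ) = (1 / M(b)!) ∑_τ ⟨0| 𝕎(μ, b_τ) |0⟩`. -/
def wCoeff (q : ℕ) {N : ℕ} (b μ : Fin N → ℕ) : ℂ :=
  1 / (occFactorial b : ℂ) *
    ∑ τ : Equiv.Perm (Fin N),
      fockInner vacuum (WW q fun j => (μ j : ℤ) - (b (τ j) : ℤ))

/-- `Δ_b(μ) = ∑_j [(q (j - 1) + b_j)² - μ_j²]`. -/
def Delta (q : ℕ) {N : ℕ} (b μ : Fin N → ℕ) : ℝ :=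
  ∑ j, ((rootPartition q b j : ℝ) ^ 2 - (μ j : ℝ) ^ 2)

/-- `h_b(μ) = exp(-γ² Δ_b(μ) / 2) w_b(μ) / √(M(μ)!)`. -/
def hCoeff (q : ℕ) (γ : ℝ) {N : ℕ} (b μ : Fin N → ℕ) : ℂ :=
  ((Real.exp (-(γ ^ 2 / 2) * Delta q b μ) : ℝ) : ℂ) * wCoeff q b μ /
    ((Real.sqrt (occFactorial μ) : ℝ) : ℂ)

/-! ### Wavefunctions on the cylinder -/

/-- The one-particle measure `exp(-x²) dx dy` on `ℝ × [0, 2π/γ)`. -/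
def cylMeasure₁ (γ : ℝ) : MeasureTheory.Measure ℂ :=
  (MeasureTheory.volume.restrict {z : ℂ | 0 ≤ z.im ∧ z.im < 2 * Real.pi / γ}).withDensity
    fun z => ENNReal.ofReal (Real.exp (-z.re ^ 2))

/-- The `N`-particle measure; its `L²` scalar product is that of the `N`-particle space. -/
def cylMeasure (γ : ℝ) (N : ℕ) : MeasureTheory.Measure (Fin N → ℂ) :=
  MeasureTheory.Measure.pi fun _ => cylMeasure₁ γ

/-- The scalar product `⟨f, g⟩`, antilinear in the first argument. -/
def scalarProd (γ : ℝ) {N : ℕ} (f g : (Fin N → ℂ) → ℂ) : ℂ :=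
  ∫ z, conj (f z) * g z ∂(cylMeasure γ N)

/-- The norm-square `‖f‖²`. -/
def normSq (γ : ℝ) {N : ℕ} (f : (Fin N → ℂ) → ℂ) : ℝ :=
  ∫ z, ‖f z‖ ^ 2 ∂(cylMeasure γ N)

/-- The cylinder orbital `φ_k`. -/
def orbital (γ : ℝ) (k : ℕ) (z : ℂ) : ℂ :=
  ((Real.sqrt (γ / (2 * Real.pi ^ (3 / 2 : ℝ))) : ℝ) : ℂ) *
    ((Real.exp (-γ ^ 2 * (k : ℝ) ^ 2 / 2) : ℝ) : ℂ) * Complex.exp (γ * z * k)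

/-- `sgn(σ)^q`. -/
def sgnPow (q : ℕ) {N : ℕ} (σ : Equiv.Perm (Fin N)) : ℂ :=
  (((Equiv.Perm.sign σ : ℤˣ) : ℤ) : ℂ) ^ q

/-- The Slater determinant (`q` odd) or permanent (`q` even) `Φ_μ`. -/
def Phi (q : ℕ) (γ : ℝ) {N : ℕ} (μ : Fin N → ℕ) (z : Fin N → ℂ) : ℂ :=
  1 / ((Real.sqrt ((occFactorial μ : ℝ) * (N ! : ℝ)) : ℝ) : ℂ) *
    ∑ σ : Equiv.Perm (Fin N), sgnPow q σ * ∏ j, orbital γ (μ j) (z (σ j))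

/-- The monomial symmetric polynomial `m_b`. -/
def monSym {N : ℕ} (b : Fin N → ℕ) (x : Fin N → ℂ) : ℂ :=
  1 / (occFactorial b : ℂ) * ∑ σ : Equiv.Perm (Fin N), ∏ j, x (σ j) ^ b j

/-- The normalization constant `κ_{b,N}`. -/
def kappa (q : ℕ) (γ : ℝ) {N : ℕ} (b : Fin N → ℕ) : ℝ :=
  ((-1) ^ (q * (N * (N - 1) / 2)) * Real.sqrt (N ! : ℝ) *
    Real.sqrt (2 * Real.pi ^ (3 / 2 : ℝ) / γ) ^ N *
    Real.exp (γ ^ 2 / 2 * ∑ j, (rootPartition q b j : ℝ) ^ 2))⁻¹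

/-- The fractional quantum Hall wavefunction `Ψ_{b,N}` on the cylinder. -/
def Psi (q : ℕ) (γ : ℝ) {N : ℕ} (b : Fin N → ℕ) (z : Fin N → ℂ) : ℂ :=
  (kappa q γ b : ℂ) * monSym b (fun j => Complex.exp (γ * z j)) *
    ∏ j, ∏ k ∈ Finset.Ioi j, (Complex.exp (γ * z j) - Complex.exp (γ * z k)) ^ q

/-- The irreducible part `Ψ̂_{b,N}`. -/
def PsiHat (q : ℕ) (γ : ℝ) {N : ℕ} (b : Fin N → ℕ) (z : Fin N → ℂ) : ℂ :=
  ∑ μ ∈ irredPartitions q b, hCoeff q γ b μ * Phi q γ μ z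

/-! ### The product `⊙` and segmentations -/

/-- The linear operator which moves every particle `s` orbitals to the right (a magnetic
translation); `shift_Phi` below shows that it maps `Φ_μ` to `Φ_{μ + s}`. -/
def shift (γ : ℝ) (s : ℕ) {N : ℕ} (f : (Fin N → ℂ) → ℂ) (z : Fin N → ℂ) : ℂ :=
  (∏ j, Complex.exp (γ * s * z j - γ ^ 2 * s ^ 2 / 2)) * f (fun j => z j - γ * s)

theorem shift_Phi (q : ℕ) {γ : ℝ} (s : ℕ) {N : ℕ} (μ : Fin N → ℕ) :
    shift γ s (Phi q γ μ) = Phi q γ (fun j => μ j + s) := by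
  have hocc : occFactorial (fun j => μ j + s) = occFactorial μ := by
    classical
    have himg : Finset.univ.image (fun j => μ j + s) = (Finset.univ.image μ).image (· + s) := by
      rw [Finset.image_image]
      rfl
    unfold occFactorial
    rw [himg, Finset.prod_image (fun a _ c _ h => by simpa using h)]
    simp [occ]
  have horb : ∀ (k : ℕ) (w : ℂ), Complex.exp (γ * s * w - γ ^ 2 * s ^ 2 / 2) *
      orbital γ k (w - γ * s) = orbital γ (k + s) w := by
    intro k w
    have h3 : ∀ x y u v t A : ℂ, x + y + u = v + t → Complex.exp x *
        (A * Complex.exp y * Complex.exp u) = A * Complex.exp v * Complex.exp t := by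
      intro x y u v t A h
      have h' : Complex.exp x * Complex.exp y * Complex.exp u =
          Complex.exp v * Complex.exp t := by
        rw [← Complex.exp_add, ← Complex.exp_add, ← Complex.exp_add, h]
      linear_combination A * h'
    simp only [orbital, Complex.ofReal_exp]
    apply h3
    push_cast
    ring
  funext z
  unfold shift Phi
  rw [hocc, mul_left_comm, Finset.mul_sum]
  congr 1
  refine Finset.sum_congr rfl fun σ _ => ?_
  rw [mul_left_comm]
  congr 1
  rw [← Equiv.prod_comp σ (fun j => Complex.exp (γ * s * z j - γ ^ 2 * s ^ 2 / 2)),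
    ← Finset.prod_mul_distrib]
  exact Finset.prod_congr rfl fun j _ => horb _ _

/-- The `q`-symmetrized tensor product, antisymmetrized for odd and symmetrized for even `q`, in
the occupation-number normalization. -/
def qTensor (q : ℕ) {n m : ℕ} (f : (Fin n → ℂ) → ℂ) (g : (Fin m → ℂ) → ℂ)
    (z : Fin (n + m) → ℂ) : ℂ :=
  1 / ((Real.sqrt ((n ! : ℝ) * (m ! : ℝ) * ((n + m)! : ℝ)) : ℝ) : ℂ) *
    ∑ σ : Equiv.Perm (Fin (n + m)), sgnPow q σ *
      (f (fun j => z (σ (Fin.castAdd m j))) * g (fun j => z (σ (Fin.natAdd n j))))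

theorem occFactorial_append {n m : ℕ} (μ : Fin n → ℕ) (ν : Fin m → ℕ)
    (h : ∀ i j, μ i ≠ ν j) :
    occFactorial (Fin.append μ ν) = occFactorial μ * occFactorial ν := by
  classical
  have himg : Finset.univ.image (Fin.append μ ν) =
      Finset.univ.image μ ∪ Finset.univ.image ν := by
    ext k
    simp only [Finset.mem_image, Finset.mem_univ, true_and, Finset.mem_union]
    constructor
    · rintro ⟨j, rfl⟩
      refine Fin.addCases (fun i => Or.inl ⟨i, ?_⟩) (fun i => Or.inr ⟨i, ?_⟩) j <;> simp
    · rintro (⟨i, rfl⟩ | ⟨i, rfl⟩)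
      · exact ⟨Fin.castAdd m i, by simp⟩
      · exact ⟨Fin.natAdd n i, by simp⟩
  have hocc : ∀ k, occ (Fin.append μ ν) k = occ μ k + occ ν k := by
    intro k
    simp only [occ, Finset.card_filter, Fin.sum_univ_add, Fin.append_left, Fin.append_right]
  have h0 : ∀ {l : ℕ} (ρ : Fin l → ℕ) (k : ℕ), (∀ i, ρ i ≠ k) → occ ρ k = 0 := by
    intro l ρ k hk
    simp [occ, hk]
  unfold occFactorial
  rw [himg, Finset.prod_union]
  · congr 1
    · refine Finset.prod_congr rfl fun k hk => ?_
      obtain ⟨i, -, rfl⟩ := Finset.mem_image.1 hk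
      rw [hocc, h0 ν _ fun j => (h i j).symm, add_zero]
    · refine Finset.prod_congr rfl fun k hk => ?_
      obtain ⟨i, -, rfl⟩ := Finset.mem_image.1 hk
      rw [hocc, h0 μ _ fun j => h j i, zero_add]
  · rw [Finset.disjoint_left]
    intro k hk hk'
    obtain ⟨i, -, rfl⟩ := Finset.mem_image.1 hk
    obtain ⟨j, -, hj⟩ := Finset.mem_image.1 hk'
    exact h i j hj.symm

theorem qTensor_Phi (q : ℕ) (γ : ℝ) {n m : ℕ} (μ : Fin n → ℕ) (ν : Fin m → ℕ)
    (h : ∀ i j, μ i ≠ ν j) :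
    qTensor q (Phi q γ μ) (Phi q γ ν) = Phi q γ (Fin.append μ ν) := by
  funext z
  let ρ : Equiv.Perm (Fin n) → Equiv.Perm (Fin m) → Equiv.Perm (Fin (n + m)) := fun α β =>
    finSumFinEquiv.permCongr (Equiv.sumCongr α β)
  have hρl : ∀ α β j, ρ α β (Fin.castAdd m j) = Fin.castAdd m (α j) := by
    intro α β j
    simp [ρ, Equiv.permCongr_apply]
  have hρr : ∀ α β j, ρ α β (Fin.natAdd n j) = Fin.natAdd n (β j) := by
    intro α β j
    simp [ρ, Equiv.permCongr_apply]
  have hsgn : ∀ α β, sgnPow q (ρ α β) = sgnPow q α * sgnPow q β := by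
    intro α β
    have : Equiv.Perm.sign (ρ α β) = Equiv.Perm.sign α * Equiv.Perm.sign β := by
      simp only [ρ, Equiv.Perm.sign_permCongr]
      exact Equiv.Perm.sign_sumCongr α β
    simp [sgnPow, this, mul_pow]
  have hmul : ∀ σ τ : Equiv.Perm (Fin (n + m)), sgnPow q (σ * τ) = sgnPow q σ * sgnPow q τ := by
    intro σ τ
    simp [sgnPow, mul_pow]
  set S : ℂ := ∑ σ : Equiv.Perm (Fin (n + m)),
    sgnPow q σ * ∏ j, orbital γ (Fin.append μ ν j) (z (σ j)) with hS
  have hterm : ∀ α β, ∑ σ : Equiv.Perm (Fin (n + m)), sgnPow q σ *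
      ((sgnPow q α * ∏ j, orbital γ (μ j) (z (σ (Fin.castAdd m (α j))))) *
        (sgnPow q β * ∏ j, orbital γ (ν j) (z (σ (Fin.natAdd n (β j)))))) = S := by
    intro α β
    refine Eq.trans ?_ (Equiv.sum_comp (Equiv.mulRight (ρ α β)) _)
    refine Finset.sum_congr rfl fun σ _ => ?_
    rw [Equiv.coe_mulRight, hmul, hsgn, Fin.prod_univ_add]
    simp only [Equiv.Perm.mul_apply, hρl, hρr, Fin.append_left, Fin.append_right]
    ring
  have hsum : ∑ σ : Equiv.Perm (Fin (n + m)), sgnPow q σ *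
      ((∑ α : Equiv.Perm (Fin n),
          sgnPow q α * ∏ j, orbital γ (μ j) (z (σ (Fin.castAdd m (α j))))) *
        (∑ β : Equiv.Perm (Fin m),
          sgnPow q β * ∏ j, orbital γ (ν j) (z (σ (Fin.natAdd n (β j)))))) =
      (n ! : ℂ) * (m ! : ℂ) * S := by
    have hexp : ∀ (c : ℂ) (f : Equiv.Perm (Fin n) → ℂ) (g : Equiv.Perm (Fin m) → ℂ),
        c * ((∑ α, f α) * ∑ β, g β) = ∑ α, ∑ β, c * (f α * g β) := by
      intro c f g
      rw [Finset.sum_mul_sum, Finset.mul_sum]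
      exact Finset.sum_congr rfl fun α _ => Finset.mul_sum _ _ _
    rw [Finset.sum_congr rfl fun σ _ => hexp _ _ _, Finset.sum_comm]
    have : ∀ α : Equiv.Perm (Fin n), (∑ σ : Equiv.Perm (Fin (n + m)),
        ∑ β : Equiv.Perm (Fin m), sgnPow q σ *
          ((sgnPow q α * ∏ j, orbital γ (μ j) (z (σ (Fin.castAdd m (α j))))) *
            (sgnPow q β * ∏ j, orbital γ (ν j) (z (σ (Fin.natAdd n (β j))))))) =
        (m ! : ℂ) * S := by
      intro α
      rw [Finset.sum_comm, Finset.sum_congr rfl fun β _ => hterm α β]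
      simp [Fintype.card_perm]
    rw [Finset.sum_congr rfl fun α _ => this α]
    simp [Fintype.card_perm, mul_assoc]
  have hS' : qTensor q (Phi q γ μ) (Phi q γ ν) z =
      1 / ((Real.sqrt ((n ! : ℝ) * (m ! : ℝ) * ((n + m)! : ℝ)) : ℝ) : ℂ) *
        (1 / ((Real.sqrt ((occFactorial μ : ℝ) * (n ! : ℝ)) : ℝ) : ℂ)) *
        (1 / ((Real.sqrt ((occFactorial ν : ℝ) * (m ! : ℝ)) : ℝ) : ℂ)) *
        ((n ! : ℂ) * (m ! : ℂ) * S) := by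
    rw [← hsum]
    simp only [qTensor, Phi, Finset.mul_sum]
    refine Finset.sum_congr rfl fun σ _ => ?_
    simp only [← Finset.mul_sum]
    ring
  rw [hS']
  unfold Phi
  rw [← hS, occFactorial_append μ ν h, ← mul_assoc]
  congr 1
  have hn : (0 : ℝ) < (n ! : ℝ) := by positivity
  have hm : (0 : ℝ) < (m ! : ℝ) := by positivity
  have hnm : (0 : ℝ) < ((n + m)! : ℝ) := by positivity
  have hpos : ∀ {l : ℕ} (κ : Fin l → ℕ), (0 : ℝ) < (occFactorial κ : ℝ) := by
    intro l κ
    exact_mod_cast Finset.prod_pos fun k _ => Nat.factorial_pos _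
  have key : 1 / Real.sqrt ((n ! : ℝ) * (m ! : ℝ) * ((n + m)! : ℝ)) *
      (1 / Real.sqrt ((occFactorial μ : ℝ) * (n ! : ℝ))) *
      (1 / Real.sqrt ((occFactorial ν : ℝ) * (m ! : ℝ))) * ((n ! : ℝ) * (m ! : ℝ)) =
      1 / Real.sqrt (((occFactorial μ * occFactorial ν : ℕ) : ℝ) * ((n + m)! : ℝ)) := by
    have hμ := hpos μ
    have hν := hpos ν
    have e1 := Real.mul_self_sqrt hn.le
    have e2 := Real.mul_self_sqrt hm.le
    push_cast
    rw [Real.sqrt_mul (by positivity), Real.sqrt_mul hn.le, Real.sqrt_mul hμ.le,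
      Real.sqrt_mul hν.le, Real.sqrt_mul (by positivity), Real.sqrt_mul hμ.le]
    have p1 := Real.sqrt_pos.2 hn
    have p2 := Real.sqrt_pos.2 hm
    have p3 := Real.sqrt_pos.2 hnm
    have p4 := Real.sqrt_pos.2 hμ
    have p5 := Real.sqrt_pos.2 hν
    field_simp
    rw [sq, sq, e1, e2]
  exact_mod_cast congrArg (fun x : ℝ => (x : ℂ)) key

/-- `f ⊙ g`, where `f` belongs to a segment with root `(n, b₁)`: the second factor is shifted to
the end of the first segment, and the two are multiplied by the `q`-symmetrized product. It is
bilinear, and `Φ_{μ₁} ⊙ Φ_{μ₂} = Φ_{μ₁ ∪ μ₂}` (`odot_Phi` below). -/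
def odot (q : ℕ) (γ : ℝ) {n m : ℕ} (b₁ : Fin n → ℕ) (f : (Fin n → ℂ) → ℂ)
    (g : (Fin m → ℂ) → ℂ) : (Fin (n + m) → ℂ) → ℂ :=
  qTensor q f (shift γ (rootLength q b₁) g)

theorem odot_Phi {q : ℕ} (hq : 1 ≤ q) (γ : ℝ) {n m : ℕ} {b₁ μ₁ : Fin n → ℕ} (μ₂ : Fin m → ℕ)
    (h : Dominated μ₁ (rootPartition q b₁)) :
    odot q γ b₁ (Phi q γ μ₁) (Phi q γ μ₂) = Phi q γ (union q b₁ μ₁ μ₂) := by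
  unfold odot union
  rw [shift_Phi, qTensor_Phi]
  · simp only [add_comm]
  · intro i j
    have hn : 0 < n := i.pos
    have h1 := h.2.2.2 ⟨n - 1, Nat.sub_lt hn Nat.one_pos⟩
    have hI : Finset.Ici (⟨n - 1, Nat.sub_lt hn Nat.one_pos⟩ : Fin n) =
        {⟨n - 1, Nat.sub_lt hn Nat.one_pos⟩} := by
      ext k
      simp only [Finset.mem_Ici, Finset.mem_singleton, Fin.le_def, Fin.ext_iff]
      omega
    rw [hI, Finset.sum_singleton, Finset.sum_singleton] at h1
    have h2 : μ₁ i ≤ μ₁ ⟨n - 1, Nat.sub_lt hn Nat.one_pos⟩ := h.1 (by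
      rw [Fin.le_def]
      simp only
      omega)
    have h3 : q * (n - 1) < q * n := Nat.mul_lt_mul_of_pos_left (by omega) hq
    simp only [rootPartition, rootLength, lastEntry, dif_pos hn] at h1 ⊢
    omega

/-- First part of the decomposition `b = (b₁, b₂)`. -/
def headPart {n m : ℕ} (b : Fin (n + m) → ℕ) : Fin n → ℕ := fun j => b (Fin.castAdd m j)

/-- Second part of the decomposition `b = (b₁, b₂)`. -/
def tailPart {n m : ℕ} (b : Fin (n + m) → ℕ) : Fin m → ℕ :=
  fun j => b (Fin.natAdd n j) - lastEntry (headPart (n := n) (m := m) b)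

theorem concat_headPart_tailPart {n m : ℕ} (b : Fin (n + m) → ℕ) (hb : Monotone b) :
    concat (headPart b) (tailPart b) = b := by
  funext j
  refine Fin.addCases (fun i => ?_) (fun i => ?_) j
  · simp [concat, headPart]
  · simp only [concat, Fin.append_right, tailPart]
    refine Nat.add_sub_cancel' ?_
    unfold lastEntry
    split_ifs with h
    · refine hb ?_
      rw [Fin.le_def]
      simp
      omega
    · exact Nat.zero_le _

/-- For lengths `L = [N_1, …, N_r]` and `b = (b⁽¹⁾, …, b⁽ʳ⁾)`, the product
`Ψ̂_{b⁽¹⁾,N_1} ⊙ (Ψ̂_{b⁽²⁾,N_2} ⊙ ⋯ ⊙ Ψ̂_{b⁽ʳ⁾,N_r})`; the empty product is the zero-particle vacuum,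
used only if there are no particles. -/
def segmentProduct (q : ℕ) (γ : ℝ) :
    (L : List ℕ) → (Fin L.sum → ℕ) → (Fin L.sum → ℂ) → ℂ
  | [], _ => fun _ => 1
  | [n], b => PsiHat (N := n) q γ b
  | n :: n' :: L, b =>
      odot (n := n) (m := (n' :: L).sum) q γ (headPart b) (PsiHat q γ (headPart b))
        (segmentProduct q γ (n' :: L) (tailPart (n := n) b))

/-- The term of the segmentation `(N_1, …, N_r)` of the root `(N, b)`. A segmentation, a tuple of
positive integers with sum `N`, is a `Composition N`. -/
def segmentTerm (q : ℕ) (γ : ℝ) {N : ℕ} (b : Fin N → ℕ) (c : Composition N) (z : Fin N → ℂ) : ℂ :=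
  segmentProduct q γ c.blocks (fun j => b (Fin.cast c.blocks_sum j))
    (fun j => z (Fin.cast c.blocks_sum j))

/-- The decay rate `C_q(γ)`. -/
def decayRate (q : ℕ) (γ : ℝ) : ℝ :=
  (γ ^ 2 - 2 * (4 * q + 1)) - 2 * (q : ℝ)⁻¹ * Real.log (1 - Real.exp (-(4 * q + 1)))
    - Real.pi * Real.sqrt (2 / 3)

end QHall

end

/-!
The coefficients `w_b(λ)` are vacuum expectations of products of vertex operators. The generating
series of the operators `D^±` are exponentials, so `D^+` and `D^-` satisfy Newton recursions
(`expPart_newton`) and the normal ordering relation `D^+(s) D^-(t) = (1 - s t)^q D^-(t) D^+(s)`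
(`Dplus_coherent_mul`). Moving all `D^+` to the right, until they hit the vacuum, produces the
factors of the Vandermonde power: a product of vertex operators applied to the vacuum is
`∏_{i < j} (X_j - X_i)^q` paired with products of the states `D_k^- |0⟩`
(`WW_eq_coherentPairing`). Hence `w_b(λ)` is the coefficient of `X^λ` in
`m_b(X) ∏_{i < j} (X_j - X_i)^q` (`coeff_wavePoly`), and collecting the monomials that are
rearrangements of one partition expands `Ψ_b` in the `Φ_λ` (`Psi_eq_partialWave`).

The Fock space has no states of negative energy, and only the vacuum at energy zero. The energy after
`i` factors is the difference of two partial sums. So `w_b(λ)` vanishes unless `λ` is dominated by the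
root partition (`dominated_of_wCoeff_ne_zero`), and it factorizes at every place where the partial
sums of `λ` and of the root partition agree (`wCoeff_union`). These places are exactly the renewal
points (`hasRenewalAt_iff`). The remaining factors of `h_b` are multiplicative there too, so a product
of irreducible wavefunctions collects precisely the dominated partitions whose set of renewal points
is given by the composition (`segmentTerm_eq`). Each dominated partition has one set of renewal
points; this gives the expansion, and, because the `Φ_λ` are orthogonal, the orthogonality of its
terms.

For the norm bound put `D(μ) = ∑_j λ_j (λ_j - μ_j)`, where `λ` is the root partition of `b`, of length
`L = λ_N - λ_1`. Summation by parts gives `D(μ) ≤ Δ_b(μ)` for dominated `μ` (`le_Delta`) and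
`L ≤ D(μ)` for irreducible `μ` (`length_le_of_irred`). With `a = 4 q + 1` and `γ² ≥ 2 a`, this yields
`|h_b(μ)|² ≤ e^{-(γ² - 2 a) L} (|w_b(μ)| e^{-a D(μ)})²`. The sum over `μ` of `|w_b(μ)| e^{-a D(μ)}` is
a weighted `ℓ¹` norm of the coefficients of `m_b(X) ∏_{i < j} (X_j - X_i)^q`, and so is bounded by the
value at `X_j = e^{a λ_j}` of the polynomial with every minus sign replaced by a plus sign, divided by
`∏_j e^{a λ_j²}`. The `λ_j` are separated by at least `q`, and by the rearrangement inequality each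
rearrangement of `b` costs a Gaussian factor; so geometric series bound that quotient by
`e^{(19/21) L}` (`sum_norm_wCoeff_exp_le`). The resulting rate
`γ² - 2 (4 q + 1) - 38/21` is at least `C_q(γ)` (`decayRate_le`).
-/

open scoped BigOperators Nat ComplexConjugate

noncomputable section

namespace QHall

open Finset

/-! ### Exponential sums over compositions -/

/-- Splitting off the first block of a composition. -/
theorem sum_composition_succ {M : Type*} [AddCommMonoid M] (F : List ℕ → M) (n : ℕ) :
    ∑ c : Composition (n + 1), F c.blocks =
      ∑ p ∈ antidiagonal n, ∑ c : Composition p.2, F ((p.1 + 1) :: c.blocks) := by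
  rw [Finset.sum_sigma']
  symm
  refine Finset.sum_bij (fun x hx => (⟨(x.1.1 + 1) :: x.2.blocks, ?_, ?_⟩ : Composition (n + 1)))
    ?_ ?_ ?_ ?_
  · intro i hi
    rcases List.mem_cons.1 hi with rfl | hi
    · omega
    · exact x.2.blocks_pos hi
  · have := HasAntidiagonal.mem_antidiagonal.1 (Finset.mem_sigma.1 hx).1
    rw [List.sum_cons, x.2.blocks_sum]
    omega
  · intros
    exact mem_univ _
  · rintro ⟨⟨i, j⟩, c⟩ hx ⟨⟨i', j'⟩, c'⟩ hx' h
    have h' := congrArg Composition.blocks h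
    simp only [List.cons.injEq, Nat.add_right_cancel_iff] at h'
    obtain ⟨rfl, h2⟩ := h'
    have hj := HasAntidiagonal.mem_antidiagonal.1 (Finset.mem_sigma.1 hx).1
    have hj' := HasAntidiagonal.mem_antidiagonal.1 (Finset.mem_sigma.1 hx').1
    simp only at hj hj'
    obtain rfl : j = j' := by omega
    rw [Composition.ext h2]
  · intro c _
    rcases hc : c.blocks with _ | ⟨i, L⟩
    · have := c.blocks_sum
      rw [hc] at this
      simp at this
    · have hpos : 0 < i := c.blocks_pos (by rw [hc]; simp)
      have hsum := c.blocks_sum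
      rw [hc, List.sum_cons] at hsum
      refine ⟨⟨(i - 1, n + 1 - i), ⟨L, fun h => c.blocks_pos (by rw [hc]; simp [h]), by
        simp only; omega⟩⟩, ?_, ?_⟩
      · rw [mem_sigma, HasAntidiagonal.mem_antidiagonal]
        exact ⟨by simp only; omega, mem_univ _⟩
      · apply Composition.ext
        simp only [hc]
        congr 1
        omega
  · intros
    rfl

/-- The coefficients of a power of `∑ x_j t^j` as a sum over compositions into `k` blocks. -/
theorem coeff_mk_pow {R : Type*} [Semiring R] (x : ℕ → R) (hx : x 0 = 0) (k n : ℕ) :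
    PowerSeries.coeff n (PowerSeries.mk x ^ k) =
      ∑ c : Composition n, if c.blocks.length = k then (c.blocks.map x).prod else 0 := by
  induction k generalizing n with
  | zero =>
    cases n with
    | zero =>
      have : ∀ c : Composition 0, c.blocks = [] := fun c => c.blocks_eq_nil.2 rfl
      simp [this, composition_card]
    | succ n =>
      rw [pow_zero, PowerSeries.coeff_one, if_neg (by omega), Finset.sum_eq_zero]
      intro c _
      rw [if_neg]
      rw [List.length_eq_zero_iff, c.blocks_eq_nil]
      omega
  | succ k ih =>
    rw [pow_succ', PowerSeries.coeff_mul]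
    cases n with
    | zero =>
      have : ∀ c : Composition 0, c.blocks = [] := fun c => c.blocks_eq_nil.2 rfl
      simp [this, hx]
    | succ n =>
      rw [Finset.Nat.sum_antidiagonal_succ,
        sum_composition_succ (fun L => if L.length = k + 1 then (L.map x).prod else 0)]
      simp only [PowerSeries.coeff_mk, hx, zero_mul, zero_add]
      refine Finset.sum_congr rfl fun p _ => ?_
      rw [ih, Finset.mul_sum]
      refine Finset.sum_congr rfl fun c _ => ?_
      simp only [List.length_cons, Nat.add_right_cancel_iff, List.map_cons, List.prod_cons, mul_ite,
        mul_zero]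

section Newton

variable {R : Type*} [Ring R] [Algebra ℂ R]

/-- The degree-`l` part of `exp (∑ x_j)`, where `x_j` has degree `j`; zero for negative `l`. -/
def expPart (x : ℕ → R) (l : ℤ) : R :=
  if 0 ≤ l then
    ∑ c : Composition l.toNat, (1 / (c.length ! : ℂ)) • (c.blocks.map x).prod
  else 0

theorem expPart_neg (x : ℕ → R) {l : ℤ} (hl : l < 0) : expPart x l = 0 :=
  if_neg (by omega)

theorem expPart_zero (x : ℕ → R) : expPart x 0 = 1 := by
  have : ∀ c : Composition 0, c.blocks = [] := fun c => c.blocks_eq_nil.2 rfl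
  simp [expPart, this, ← Composition.blocks_length, composition_card]

theorem expPart_natCast (x : ℕ → R) (hx : x 0 = 0) {n K : ℕ} (hK : n ≤ K) :
    expPart x n = ∑ k ∈ range (K + 1), (1 / (k ! : ℂ)) •
      PowerSeries.coeff n (PowerSeries.mk x ^ k) := by
  simp only [expPart, coeff_mk_pow x hx, Finset.smul_sum]
  rw [if_pos (by omega), Finset.sum_comm]
  simp only [Int.toNat_natCast]
  refine Finset.sum_congr rfl fun c _ => ?_
  rw [Finset.sum_eq_single c.length]
  · simp
  · intro k _ hk
    rw [if_neg, smul_zero]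
    simpa using hk.symm
  · intro h
    have := c.length_le
    simp at h
    omega

/-- `t d/dt` on power series. -/
def theta (f : PowerSeries R) : PowerSeries R :=
  PowerSeries.mk fun n => (n : ℂ) • PowerSeries.coeff n f

theorem theta_mul (f g : PowerSeries R) : theta (f * g) = theta f * g + f * theta g := by
  ext n
  simp only [theta, PowerSeries.coeff_mk, map_add, PowerSeries.coeff_mul, Finset.smul_sum]
  rw [← Finset.sum_add_distrib]
  refine Finset.sum_congr rfl fun p hp => ?_
  rw [← HasAntidiagonal.mem_antidiagonal.1 hp, smul_mul_assoc, mul_smul_comm, ← add_smul]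
  push_cast
  rfl

theorem theta_pow (x : ℕ → R) (hc : ∀ i j, Commute (x i) (x j)) (k : ℕ) :
    theta (PowerSeries.mk x ^ (k + 1)) =
      (k + 1 : ℂ) • (theta (PowerSeries.mk x) * PowerSeries.mk x ^ k) := by
  induction k with
  | zero => simp
  | succ k ih =>
    have hcomm : PowerSeries.mk x * theta (PowerSeries.mk x) =
        theta (PowerSeries.mk x) * PowerSeries.mk x := by
      ext n
      rw [PowerSeries.coeff_mul, PowerSeries.coeff_mul,
        ← Finset.Nat.sum_antidiagonal_swap (n := n)]
      refine Finset.sum_congr rfl fun p _ => ?_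
      simp only [theta, PowerSeries.coeff_mk, Prod.fst_swap, Prod.snd_swap, smul_mul_assoc,
        mul_smul_comm, (hc p.2 p.1).eq]
    rw [pow_succ', theta_mul, ih, mul_smul_comm, ← mul_assoc, hcomm, mul_assoc, ← pow_succ']
    push_cast
    rw [add_smul (k + 1 : ℂ), one_smul, add_comm]

/-- The recursion for the Taylor coefficients of an exponential, read off from
`t E'(t) = t f'(t) E(t)` for `E = exp f`. Terms with `l - 1 - i < 0` vanish, so the upper limit
`K` is arbitrary. -/
theorem expPart_newton (x : ℕ → R) (hx : x 0 = 0) (hc : ∀ i j, Commute (x i) (x j)) (l : ℤ) (K : ℕ)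
    (hK : l ≤ K) :
    (l : ℂ) • expPart x l =
      ∑ i ∈ range K, ((i + 1 : ℕ) : ℂ) • (x (i + 1) * expPart x (l - 1 - i)) := by
  have hvan : ∀ i : ℕ, l ≤ i → expPart x (l - 1 - i) = 0 := fun i hi => expPart_neg x (by omega)
  rcases lt_or_ge l 1 with hl | hl
  · have h1 : (l : ℂ) • expPart x l = 0 := by
      rcases eq_or_ne l 0 with rfl | h
      · simp
      · rw [expPart_neg x (by omega), smul_zero]
    rw [h1, Finset.sum_eq_zero]
    intro i _
    rw [hvan i (by omega), mul_zero, smul_zero]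
  · obtain ⟨n, rfl⟩ : ∃ n : ℕ, l = ((n + 1 : ℕ) : ℤ) := ⟨l.toNat - 1, by omega⟩
    have hsub : range (n + 1) ⊆ range K := by
      intro i
      simp only [mem_range]
      omega
    rw [← Finset.sum_subset hsub (fun i _ hi => by
      rw [hvan i (by simp only [mem_range] at hi; omega), mul_zero, smul_zero])]
    rw [expPart_natCast x hx le_rfl, Finset.sum_range_succ']
    have h0 : PowerSeries.coeff (n + 1) (PowerSeries.mk x ^ 0) = (0 : R) := by
      simp [PowerSeries.coeff_one]
    rw [h0, smul_zero, add_zero, Finset.smul_sum]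
    have hterm : ∀ k : ℕ, (((n + 1 : ℕ) : ℤ) : ℂ) • ((1 / ((k + 1)! : ℂ)) •
        PowerSeries.coeff (n + 1) (PowerSeries.mk x ^ (k + 1))) =
        ∑ i ∈ range (n + 1), ((i + 1 : ℕ) : ℂ) • (x (i + 1) * ((1 / (k ! : ℂ)) •
          PowerSeries.coeff (n - i) (PowerSeries.mk x ^ k))) := by
      intro k
      have h := congrArg (PowerSeries.coeff (n + 1)) (theta_pow x hc k)
      have hs : ∀ (c : ℂ) (g : PowerSeries R), PowerSeries.coeff (n + 1) (c • g) =
          c • PowerSeries.coeff (n + 1) g := fun _ _ => rfl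
      rw [hs, PowerSeries.coeff_mul, Finset.Nat.sum_antidiagonal_succ,
        Finset.Nat.sum_antidiagonal_eq_sum_range_succ_mk] at h
      simp only [theta, PowerSeries.coeff_mk, hx, smul_zero, zero_mul, zero_add] at h
      have hk : ((k + 1)! : ℂ) = (k + 1 : ℂ) * (k ! : ℂ) := by
        rw [Nat.factorial_succ]
        push_cast
        ring
      have hk1 : (k + 1 : ℂ) ≠ 0 := by exact_mod_cast Nat.succ_ne_zero k
      have hk2 : (k ! : ℂ) ≠ 0 := by exact_mod_cast Nat.factorial_ne_zero k
      rw [smul_comm]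
      simp only [Int.cast_natCast]
      rw [h, smul_smul, Finset.smul_sum]
      refine Finset.sum_congr rfl fun i _ => ?_
      rw [smul_mul_assoc, mul_smul_comm, smul_comm]
      congr 2
      rw [hk]
      field_simp
    simp only [hterm]
    rw [Finset.sum_comm]
    refine Finset.sum_congr rfl fun i hi => ?_
    rw [← Finset.smul_sum, ← Finset.mul_sum]
    have hi' := mem_range.1 hi
    have : ((n + 1 : ℕ) : ℤ) - 1 - i = ((n - i : ℕ) : ℤ) := by omega
    rw [this, expPart_natCast x hx (Nat.sub_le n i)]

theorem prod_ofFn_smul (k : ℕ) (c : Fin k → ℂ) (f : Fin k → R) :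
    (List.ofFn fun t => c t • f t).prod = (∏ t, c t) • (List.ofFn f).prod := by
  induction k with
  | zero => simp
  | succ k ih =>
    rw [List.ofFn_succ, List.ofFn_succ, List.prod_cons, List.prod_cons, ih, Fin.prod_univ_succ,
      smul_mul_smul_comm]

/-- The product over the blocks of a composition, in the form in which it enters the definition of the
operators `D^±`. -/
theorem prod_map_blocks {l : ℕ} (c : Composition l) (x : ℕ → R) (y : ℂ) (f : ℕ+ → R)
    (hxf : ∀ j : ℕ+, x j = (y / (j : ℕ)) • f j) :
    (c.blocks.map x).prod =
      (y ^ c.length * ∏ s, (1 / (((parts c s : ℕ+) : ℕ) : ℂ))) •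
        (List.ofFn fun t => f (parts c t)).prod := by
  conv_lhs => rw [← c.ofFn_blocksFun]
  rw [List.map_ofFn]
  have h : (x ∘ c.blocksFun) = fun t => (y / ((parts c t : ℕ+) : ℕ)) • f (parts c t) := by
    funext t
    exact hxf (parts c t)
  rw [h, prod_ofFn_smul]
  congr 1
  simp [div_eq_mul_inv, Finset.prod_mul_distrib]

end Newton

/-! ### The vertex operators on the Fock space -/

/-- The state `D_m^- |0⟩`, a polynomial in the creation operators. -/
def coherent (q : ℕ) (m : ℤ) : Fock :=
  expPart (fun i => (((Real.sqrt q : ℝ) : ℂ) / (i : ℂ)) • (MvPolynomial.X i.toPNat' : Fock)) m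

theorem coherent_neg (q : ℕ) {m : ℤ} (hm : m < 0) : coherent q m = 0 := expPart_neg _ hm

theorem coherent_zero (q : ℕ) : coherent q 0 = 1 := expPart_zero _

theorem toPNat'_coe (j : ℕ+) : (j : ℕ).toPNat' = j := by
  apply PNat.eq
  simp

theorem Dminus_apply (q : ℕ) (m : ℤ) (v : Fock) : Dminus q m v = coherent q m * v := by
  unfold Dminus coherent expPart
  split_ifs with h
  · rw [LinearMap.sum_apply, Finset.sum_mul]
    refine Finset.sum_congr rfl fun c _ => ?_
    rw [prod_map_blocks c _ ((Real.sqrt q : ℝ) : ℂ) (fun j => (MvPolynomial.X j : Fock))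
      (fun j => by rw [toPNat'_coe])]
    have hprod : ∀ (k : ℕ) (p : Fin k → ℕ+), (List.ofFn fun t => create (p t)).prod v =
        (List.ofFn fun t => (MvPolynomial.X (p t) : Fock)).prod * v := by
      intro k p
      induction k with
      | zero => simp
      | succ k ih =>
        rw [List.ofFn_succ, List.ofFn_succ, List.prod_cons, List.prod_cons, Module.End.mul_apply,
          ih, create, LinearMap.mulLeft_apply, mul_assoc]
    rw [LinearMap.smul_apply, hprod, smul_smul, smul_mul_assoc]
    congr 1
    ring
  · simp

theorem Dplus_eq (q : ℕ) (l : ℤ) : Dplus q l =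
    expPart (fun i => (-((Real.sqrt q : ℝ) : ℂ) / (i : ℂ)) • annihilate i.toPNat') l := by
  unfold Dplus expPart
  split_ifs with h
  · refine Finset.sum_congr rfl fun c _ => ?_
    rw [prod_map_blocks c _ (-((Real.sqrt q : ℝ) : ℂ)) annihilate (fun j => by rw [toPNat'_coe]),
      smul_smul]
    congr 1
    rw [neg_pow]
    ring
  · rfl

theorem Dplus_neg (q : ℕ) {l : ℤ} (hl : l < 0) : Dplus q l = 0 := by
  rw [Dplus_eq, expPart_neg _ hl]

theorem Dplus_zero (q : ℕ) : Dplus q 0 = 1 := by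
  rw [Dplus_eq, expPart_zero]

theorem annihilate_comm (i j : ℕ+) : Commute (annihilate i) (annihilate j) := by
  have h : ∀ v : Fock, MvPolynomial.pderiv i (MvPolynomial.pderiv j v) =
      MvPolynomial.pderiv j (MvPolynomial.pderiv i v) := by
    intro v
    have h0 : ⁅(MvPolynomial.pderiv i : Derivation ℂ Fock Fock),
        (MvPolynomial.pderiv j : Derivation ℂ Fock Fock)⁆ = 0 := by
      apply MvPolynomial.derivation_ext
      intro k
      classical
      simp [Derivation.commutator_apply, MvPolynomial.pderiv_X, Pi.single_apply, apply_ite]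
    have := congrArg (fun D => D v) h0
    simpa [Derivation.commutator_apply, sub_eq_zero] using this
  refine LinearMap.ext fun v => ?_
  simp only [annihilate, Module.End.mul_apply, LinearMap.smul_apply, Derivation.coeFn_coe,
    map_smul, h, smul_comm ((i : ℕ) : ℂ) ((j : ℕ) : ℂ)]

/-- The recursion `m D_m^- |0⟩ = √q ∑_{j ≥ 1} a_j^* D_{m-j}^- |0⟩`. -/
theorem coherent_newton (q : ℕ) (m : ℤ) (K : ℕ) (hK : m ≤ K) :
    (m : ℂ) • coherent q m = ((Real.sqrt q : ℝ) : ℂ) • ∑ i ∈ range K,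
      MvPolynomial.X i.succPNat * coherent q (m - 1 - i) := by
  unfold coherent
  rw [expPart_newton _ (by simp) (fun _ _ => Commute.all _ _) m K hK, Finset.smul_sum]
  refine Finset.sum_congr rfl fun i _ => ?_
  have h1 : ((i + 1 : ℕ) : ℂ) ≠ 0 := by exact_mod_cast Nat.succ_ne_zero i
  rw [smul_mul_assoc, smul_smul, mul_div_cancel₀ _ h1]
  rfl

/-- The recursion `l D_l^+ = -√q ∑_{j ≥ 1} a_j D_{l-j}^+`. -/
theorem Dplus_newton (q : ℕ) (l : ℤ) (K : ℕ) (hK : l ≤ K) (v : Fock) :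
    (l : ℂ) • Dplus q l v = (-((Real.sqrt q : ℝ) : ℂ)) • ∑ i ∈ range K,
      annihilate i.succPNat (Dplus q (l - 1 - i) v) := by
  have h : (l : ℂ) • Dplus q l = (-((Real.sqrt q : ℝ) : ℂ)) • ∑ i ∈ range K,
      annihilate i.succPNat * Dplus q (l - 1 - i) := by
    simp only [Dplus_eq]
    rw [expPart_newton _ (by simp)
      (fun i j => ((annihilate_comm _ _).smul_left _).smul_right _) l K hK, Finset.smul_sum]
    refine Finset.sum_congr rfl fun i _ => ?_
    have h1 : ((i + 1 : ℕ) : ℂ) ≠ 0 := by exact_mod_cast Nat.succ_ne_zero i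
    rw [smul_mul_assoc, smul_smul, mul_div_cancel₀ _ h1]
    rfl
  have := congrArg (fun D => D v) h
  simpa using this

/-- `a_j` acts as the derivation `j ∂/∂X_j`. -/
theorem annihilate_mul (j : ℕ+) (v w : Fock) :
    annihilate j (v * w) = annihilate j v * w + v * annihilate j w := by
  simp only [annihilate, LinearMap.smul_apply, Derivation.coeFn_coe, Derivation.leibniz,
    smul_eq_mul]
  rw [smul_add, mul_comm w, add_comm, smul_mul_assoc, mul_smul_comm]

theorem annihilate_X (j i : ℕ+) :
    annihilate j (MvPolynomial.X i) = if i = j then (((j : ℕ) : ℂ) • (1 : Fock)) else 0 := by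
  classical
  simp only [annihilate, LinearMap.smul_apply, Derivation.coeFn_coe, MvPolynomial.pderiv_X,
    Pi.single_apply]
  split_ifs <;> simp

/-- `D_m^- |0⟩` is an eigenvector of the annihilation operators up to a shift of the degree. -/
theorem annihilate_coherent (q : ℕ) (i : ℕ) (m : ℤ) :
    annihilate i.succPNat (coherent q m) =
      ((Real.sqrt q : ℝ) : ℂ) • coherent q (m - 1 - i) := by
  rcases lt_or_ge m 0 with hm | hm
  · rw [coherent_neg q hm, coherent_neg q (by omega), map_zero, smul_zero]
  obtain ⟨n, rfl⟩ := Int.eq_ofNat_of_zero_le hm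
  induction n using Nat.strong_induction_on with
  | _ n ih =>
  rcases Nat.eq_zero_or_pos n with rfl | hn
  · rw [Nat.cast_zero, coherent_zero, coherent_neg q (by omega), smul_zero]
    simp [annihilate]
  have hn0 : ((n : ℤ) : ℂ) ≠ 0 := by
    exact_mod_cast hn.ne'
  have hinj : Function.Injective fun v : Fock => ((n : ℤ) : ℂ) • v := smul_right_injective _ hn0
  apply hinj
  simp only
  have hN := coherent_newton q n (n + i + 1) (by omega)
  have hN' := coherent_newton q (n - 1 - i) (n + i + 1) (by omega)
  rw [← map_smul, hN, map_smul, map_sum]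
  have hstep : ∀ k ∈ range (n + i + 1), annihilate i.succPNat
      (MvPolynomial.X k.succPNat * coherent q (n - 1 - k)) =
      (if k = i then ((i + 1 : ℕ) : ℂ) • coherent q (n - 1 - i) else 0) +
        ((Real.sqrt q : ℝ) : ℂ) •
          (MvPolynomial.X k.succPNat * coherent q ((n - 1 - i : ℤ) - 1 - k)) := by
    intro k _
    rw [annihilate_mul, annihilate_X]
    congr 1
    · by_cases h : k = i
      · subst h
        simp
      · rw [if_neg h, if_neg, zero_mul]
        intro h'
        exact h (Nat.succPNat_injective h')
    · have : annihilate i.succPNat (coherent q (n - 1 - k)) =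
          ((Real.sqrt q : ℝ) : ℂ) • coherent q ((n - 1 - i : ℤ) - 1 - k) := by
        rcases lt_or_ge (n - 1 - k : ℤ) 0 with h | h
        · rw [coherent_neg q h, coherent_neg q (by omega), map_zero, smul_zero]
        · have := ih (n - 1 - k) (by omega) (by omega)
          rw [show (((n - 1 - k : ℕ) : ℤ)) = n - 1 - k by omega] at this
          rw [this]
          congr 2
          ring
      rw [this, mul_smul_comm]
  rw [Finset.sum_congr rfl hstep, Finset.sum_add_distrib, Finset.sum_ite_eq', if_pos (by simp),
    ← Finset.smul_sum, ← hN', ← add_smul, smul_comm]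
  congr 2
  push_cast
  ring

/-- `(-1)^a binom(q, a)`, the Taylor coefficients of `(1 - t)^q`. -/
def signedChoose (q a : ℕ) : ℂ := (-1) ^ a * (q.choose a : ℂ)

/-- Summation by parts against the Taylor coefficients of `(1 - t)^q`. -/
theorem sum_signedChoose_mul_tail {M : Type*} [AddCommGroup M] [Module ℂ M] (q : ℕ) (G : ℕ → M) :
    ∑ a ∈ range (q + 1), ((a : ℂ) * signedChoose q a) • (G a - G (a + 1)) =
      -((q : ℂ) • ∑ a ∈ range (q + 1), signedChoose q a • G (a + 1)) := by
  have h1 : ∑ a ∈ range (q + 1), ((a : ℂ) * signedChoose q a) • G a =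
      ∑ a ∈ range (q + 1), (-(((q : ℂ) - a) * signedChoose q a)) • G (a + 1) := by
    rw [Finset.sum_range_succ', Finset.sum_range_succ _ q]
    simp only [Nat.cast_zero, zero_mul, zero_smul, add_zero, sub_self, neg_zero]
    refine Finset.sum_congr rfl fun a ha => ?_
    have ha' : a ≤ q := (mem_range.1 ha).le
    have h := congrArg (fun n : ℕ => (n : ℂ)) (Nat.choose_succ_right_eq q a)
    simp only [Nat.cast_mul, Nat.cast_sub ha', Nat.cast_add, Nat.cast_one] at h
    congr 1
    unfold signedChoose
    push_cast
    rw [pow_succ]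
    linear_combination (-(-1) ^ a) * h
  simp only [smul_sub]
  rw [Finset.sum_sub_distrib, h1, ← Finset.sum_sub_distrib, Finset.smul_sum,
    ← Finset.sum_neg_distrib]
  refine Finset.sum_congr rfl fun a _ => ?_
  rw [← sub_smul, smul_smul, ← neg_smul]
  congr 1
  ring

/-- Normal ordering: `D^+(s) D^-(t) = (1 - s t)^q D^-(t) D^+(s)` for the generating series. -/
theorem Dplus_coherent_mul (q : ℕ) (l m : ℤ) (v : Fock) :
    Dplus q l (coherent q m * v) =
      ∑ a ∈ range (q + 1), signedChoose q a • (coherent q (m - a) * Dplus q (l - a) v) := by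
  rcases lt_or_ge l 0 with hl | hl
  · rw [Dplus_neg q hl, LinearMap.zero_apply, Finset.sum_eq_zero]
    intro a _
    rw [Dplus_neg q (by omega), LinearMap.zero_apply, mul_zero, smul_zero]
  obtain ⟨n, rfl⟩ := Int.eq_ofNat_of_zero_le hl
  induction n using Nat.strong_induction_on generalizing m with
  | _ n ih =>
  rcases Nat.eq_zero_or_pos n with rfl | hn
  · rw [Finset.sum_range_succ', Finset.sum_eq_zero]
    · simp [Dplus_zero, signedChoose]
    · intro a _
      rw [Dplus_neg q (by push_cast; omega), LinearMap.zero_apply, mul_zero, smul_zero]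
  have hn0 : ((n : ℤ) : ℂ) ≠ 0 := by
    exact_mod_cast hn.ne'
  have hinj : Function.Injective fun v : Fock => ((n : ℤ) : ℂ) • v := smul_right_injective _ hn0
  apply hinj
  simp only
  -- Strong induction through the recursion for `D^+`: `H` are the terms of the right-hand side and `G`
  -- their tail sums, which vanish from `n + 1` on because `D^+` has negative index there.
  set K : ℕ := n + 1 with hK
  set H : ℕ → Fock := fun i => coherent q (m - i) * Dplus q (n - i) v with hH
  set G : ℕ → Fock := fun i => ∑ j ∈ range K, H (i + j) with hG
  set r : ℂ := ((Real.sqrt q : ℝ) : ℂ) with hr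
  have hrr : r * r = q := by
    rw [hr, ← Complex.ofReal_mul, Real.mul_self_sqrt (Nat.cast_nonneg q), Complex.ofReal_natCast]
  have hHG : ∀ i, G i - G (i + 1) = H i := by
    intro i
    have hz : H (i + K) = 0 := by
      simp only [hH]
      rw [Dplus_neg q (by push_cast; omega), LinearMap.zero_apply, mul_zero]
    have h1 := Finset.sum_range_succ (fun j => H (i + j)) K
    rw [Finset.sum_range_succ', hz, add_zero, add_zero] at h1
    simp only [hG]
    rw [← h1, show (∑ j ∈ range K, H (i + 1 + j)) = ∑ j ∈ range K, H (i + (j + 1)) from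
      Finset.sum_congr rfl fun j _ => by rw [add_assoc, add_comm 1 j], add_sub_cancel_left]
  rw [Dplus_newton q n K (by omega)]
  have hstep : ∀ i ∈ range K, annihilate i.succPNat (Dplus q (n - 1 - i) (coherent q m * v)) =
      ∑ a ∈ range (q + 1), signedChoose q a • (r • H (a + 1 + i) +
        coherent q (m - a) * annihilate i.succPNat (Dplus q ((n - a : ℤ) - 1 - i) v)) := by
    intro i _
    have h : Dplus q (n - 1 - i) (coherent q m * v) = ∑ a ∈ range (q + 1),
        signedChoose q a • (coherent q (m - a) * Dplus q ((n - a : ℤ) - 1 - i) v) := by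
      rcases lt_or_ge (n - 1 - i : ℤ) 0 with h | h
      · rw [Dplus_neg q h, LinearMap.zero_apply, Finset.sum_eq_zero]
        intro a _
        rw [Dplus_neg q (by omega), LinearMap.zero_apply, mul_zero, smul_zero]
      · have := ih (n - 1 - i) (by omega) m (by omega)
        rw [show (((n - 1 - i : ℕ) : ℤ)) = n - 1 - i by omega] at this
        rw [this]
        refine Finset.sum_congr rfl fun a _ => ?_
        rw [show (n - 1 - i : ℤ) - a = (n - a : ℤ) - 1 - i by ring]
    rw [h, map_sum]
    refine Finset.sum_congr rfl fun a _ => ?_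
    rw [map_smul, annihilate_mul, annihilate_coherent, ← hr, smul_mul_assoc]
    have e1 : m - (a : ℤ) - 1 - i = m - ((a + 1 + i : ℕ) : ℤ) := by
      push_cast
      ring
    have e2 : (n - a : ℤ) - 1 - i = n - ((a + 1 + i : ℕ) : ℤ) := by
      push_cast
      ring
    rw [e1, e2]
  rw [Finset.sum_congr rfl hstep, Finset.sum_comm, Finset.smul_sum, Finset.smul_sum]
  have hterm : ∀ a ∈ range (q + 1), (-r) • ∑ i ∈ range K, signedChoose q a • (r • H (a + 1 + i) +
        coherent q (m - a) * annihilate i.succPNat (Dplus q ((n - a : ℤ) - 1 - i) v)) =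
      -((q : ℂ) • (signedChoose q a • G (a + 1))) +
        signedChoose q a • (((n : ℂ) - a) • H a) := by
    intro a _
    have hN := Dplus_newton q (n - a) K (by omega) v
    rw [← Finset.smul_sum, Finset.sum_add_distrib, ← Finset.smul_sum, ← Finset.mul_sum, smul_add,
      smul_add, smul_comm (-r), smul_comm (-r) (signedChoose q a), smul_smul (-r) r, neg_mul, hrr,
      ← mul_smul_comm (-r), ← hN, mul_smul_comm]
    congr 1
    · rw [neg_smul, smul_neg, smul_comm (q : ℂ)]
    · push_cast
      rfl
  rw [Finset.sum_congr rfl hterm, Finset.sum_add_distrib, Finset.sum_neg_distrib,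
    ← Finset.smul_sum, ← sum_signedChoose_mul_tail, ← Finset.sum_add_distrib]
  refine Finset.sum_congr rfl fun a _ => ?_
  rw [hHG, smul_smul, ← add_smul, smul_smul]
  congr 1
  push_cast
  ring

theorem Dplus_one (q : ℕ) (l : ℤ) : Dplus q l (1 : Fock) = if l = 0 then 1 else 0 := by
  split_ifs with h
  · rw [h, Dplus_zero, Module.End.one_apply]
  rcases lt_or_ge l 0 with hl | hl
  · rw [Dplus_neg q hl, LinearMap.zero_apply]
  obtain ⟨n, rfl⟩ := Int.eq_ofNat_of_zero_le hl
  induction n using Nat.strong_induction_on with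
  | _ n ih =>
  have hn0 : ((n : ℤ) : ℂ) ≠ 0 := by
    exact_mod_cast h
  have hinj : Function.Injective fun v : Fock => ((n : ℤ) : ℂ) • v := smul_right_injective _ hn0
  apply hinj
  simp only
  rw [Dplus_newton q n n le_rfl, smul_zero, Finset.sum_eq_zero, smul_zero]
  intro i hi
  have hi' := mem_range.1 hi
  rcases eq_or_ne (n - 1 - i : ℤ) 0 with h0 | h0
  · rw [h0, Dplus_zero]
    simp [annihilate]
  · have := ih (n - 1 - i) (by omega) (by omega) (by omega)
    rw [show (((n - 1 - i : ℕ) : ℤ)) = n - 1 - i by omega] at this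
    rw [this, map_zero]

theorem Wop_smul (q : ℕ) (m : ℤ) (c : ℂ) (v : Fock) : Wop q m (c • v) = c • Wop q m v := by
  unfold Wop
  rw [smul_finsum' c (Wop_support_finite q m v)]
  simp only [map_smul]

theorem Wop_add (q : ℕ) (m : ℤ) (v w : Fock) : Wop q m (v + w) = Wop q m v + Wop q m w := by
  unfold Wop
  rw [← finsum_add_distrib (Wop_support_finite q m v) (Wop_support_finite q m w)]
  simp only [map_add]

theorem Wop_one (q : ℕ) (m : ℤ) : Wop q m 1 = coherent q m := by
  unfold Wop
  rw [finsum_eq_single _ (0 : ℤ)]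
  · rw [Dplus_one, if_pos rfl, Dminus_apply, mul_one, add_zero]
  · intro l hl
    rw [Dplus_one, if_neg hl, map_zero]

/-- Moving `W_s` past a state `D_m^- |0⟩` shifts the indices according to `(1 - t)^q`. -/
theorem Wop_coherent_mul (q : ℕ) (s m : ℤ) (v : Fock) :
    Wop q s (coherent q m * v) =
      ∑ a ∈ range (q + 1), signedChoose q a • (coherent q (m - a) * Wop q (s + a) v) := by
  have h : ∀ a : ℕ, coherent q (m - a) * Wop q (s + a) v =
      ∑ᶠ l : ℤ, coherent q (m - a) * (coherent q (s + l) * Dplus q (l - a) v) := by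
    intro a
    unfold Wop
    rw [mul_finsum' _ _ (Wop_support_finite q (s + a) v)]
    refine finsum_eq_of_bijective (fun l => l + a) (Equiv.addRight (a : ℤ)).bijective ?_
    intro l
    rw [Dminus_apply]
    congr 3
    · ring
    · congr 1
      ring
  have hfin : ∀ a : ℕ, (Function.support fun l : ℤ =>
      signedChoose q a • (coherent q (m - a) * (coherent q (s + l) * Dplus q (l - a) v))).Finite := by
    intro a
    refine ((Wop_support_finite q (s + a) v).image (fun l : ℤ => l + a)).subset fun l hl => ?_
    refine ⟨l - a, fun h0 => hl ?_, by ring⟩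
    simp only [Dminus_apply] at h0
    rw [show s + (a : ℤ) + (l - a) = s + l by ring] at h0
    simp only [h0, mul_zero, smul_zero]
  have hsm : ∀ a : ℕ, signedChoose q a • (coherent q (m - a) * Wop q (s + a) v) = ∑ᶠ l : ℤ,
      signedChoose q a • (coherent q (m - a) * (coherent q (s + l) * Dplus q (l - a) v)) := by
    intro a
    rw [h a, smul_finsum]
  rw [Finset.sum_congr rfl fun a _ => hsm a, ← finsum_sum_comm _ _ fun a _ => hfin a]
  unfold Wop
  refine finsum_congr fun l => ?_
  rw [Dminus_apply, Dplus_coherent_mul, Finset.mul_sum]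
  refine Finset.sum_congr rfl fun a _ => ?_
  rw [mul_smul_comm, mul_left_comm]

/-! ### Vacuum expectations are the coefficients of the Vandermonde power -/

/-- The polynomial `∏_{i < j} (X_j - X_i)^q`. -/
def vandermondePow (q N : ℕ) : MvPolynomial (Fin N) ℂ :=
  ∏ j, ∏ i ∈ Iio j, (MvPolynomial.X j - MvPolynomial.X i) ^ q

theorem vandermondePow_succ (q N : ℕ) : vandermondePow q (N + 1) =
    MvPolynomial.rename Fin.castSucc (vandermondePow q N) *
      ∏ i : Fin N, (MvPolynomial.X (Fin.last N) - MvPolynomial.X i.castSucc) ^ q := by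
  unfold vandermondePow
  rw [Fin.prod_univ_castSucc]
  congr 1
  · simp only [map_prod, map_pow, map_sub, MvPolynomial.rename_X]
    refine Finset.prod_congr rfl fun j _ => ?_
    rw [← Fin.map_castSuccEmb_Iio, Finset.prod_map]
    rfl
  · rw [Fin.Iio_last_eq_map, Finset.prod_map]
    rfl

/-- The linear map `X^m ↦ ∏_j D^-_{k_j - m_j} |0⟩`. -/
def coherentPairing (q : ℕ) {N : ℕ} (k : Fin N → ℤ) : MvPolynomial (Fin N) ℂ →ₗ[ℂ] Fock :=
  (MvPolynomial.basisMonomials (Fin N) ℂ).constr ℂ fun m => ∏ j, coherent q (k j - m j)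

theorem coherentPairing_monomial (q : ℕ) {N : ℕ} (k : Fin N → ℤ) (m : Fin N →₀ ℕ) (c : ℂ) :
    coherentPairing q k (MvPolynomial.monomial m c) = c • ∏ j, coherent q (k j - m j) := by
  have h : MvPolynomial.monomial m c = c • MvPolynomial.basisMonomials (Fin N) ℂ m := by
    simp [MvPolynomial.smul_monomial]
  rw [h, map_smul, coherentPairing, Module.Basis.constr_basis]

theorem coherentPairing_eq_sum (q : ℕ) {N : ℕ} (k : Fin N → ℤ) (p : MvPolynomial (Fin N) ℂ) :
    coherentPairing q k p = ∑ m ∈ p.support, p.coeff m • ∏ j, coherent q (k j - m j) := by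
  conv_lhs => rw [p.as_sum, map_sum]
  exact Finset.sum_congr rfl fun m _ => coherentPairing_monomial q k m _

theorem coherentPairing_monomial_mul (q : ℕ) {N : ℕ} (k : Fin N → ℤ) (m : Fin N →₀ ℕ) (c : ℂ)
    (p : MvPolynomial (Fin N) ℂ) : coherentPairing q k (MvPolynomial.monomial m c * p) =
      c • coherentPairing q (fun j => k j - m j) p := by
  induction p using MvPolynomial.induction_on' with
  | monomial u a =>
    rw [MvPolynomial.monomial_mul, coherentPairing_monomial, coherentPairing_monomial, mul_smul]
    congr 2
    refine Finset.prod_congr rfl fun j _ => ?_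
    congr 1
    simp only [Finsupp.coe_add, Pi.add_apply]
    push_cast
    ring
  | add p r hp hr => rw [mul_add, map_add, hp, hr, map_add, smul_add]

theorem pow_sub_eq_sum_monomial (q : ℕ) {N : ℕ} (i : Fin N) :
    (MvPolynomial.X (Fin.last N) - MvPolynomial.X i.castSucc : MvPolynomial (Fin (N + 1)) ℂ) ^ q =
      ∑ a ∈ range (q + 1), MvPolynomial.monomial
        (Finsupp.single i.castSucc a + Finsupp.single (Fin.last N) (q - a)) (signedChoose q a) := by
  rw [sub_eq_neg_add, add_pow]
  refine Finset.sum_congr rfl fun a _ => ?_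
  have h1 : ((-1 : MvPolynomial (Fin (N + 1)) ℂ)) ^ a * (q.choose a : MvPolynomial (Fin (N + 1)) ℂ)
      = MvPolynomial.C (signedChoose q a) := by
    simp [signedChoose]
  have h2 : ∀ (s t : Fin (N + 1)) (n l : ℕ), MvPolynomial.monomial
      (Finsupp.single s n + Finsupp.single t l) (signedChoose q a) =
      MvPolynomial.C (signedChoose q a) * (MvPolynomial.X s ^ n * MvPolynomial.X t ^ l) := by
    intro s t n l
    rw [MvPolynomial.X_pow_eq_monomial, MvPolynomial.X_pow_eq_monomial, MvPolynomial.monomial_mul,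
      MvPolynomial.C_mul_monomial]
    simp
  rw [h2, ← h1, neg_pow]
  ring

/-- `W` applied to a product of coherent states: each factor that `W` is moved past contributes a
factor `(X_N - X_i)^q`. -/
theorem coherentPairing_prod (q : ℕ) {N : ℕ} (J : Finset (Fin N)) (κ : Fin N → ℤ) (r : ℤ) :
    coherentPairing q (Fin.snoc κ r : Fin (N + 1) → ℤ)
        (∏ i ∈ J, (MvPolynomial.X (Fin.last N) - MvPolynomial.X i.castSucc) ^ q) =
      (∏ j ∈ Jᶜ, coherent q (κ j)) * Wop q (r - q * #J) (∏ j ∈ J, coherent q (κ j)) := by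
  induction J using Finset.induction_on generalizing κ r with
  | empty =>
    rw [Finset.prod_empty, ← MvPolynomial.C_1, ← MvPolynomial.monomial_zero',
      coherentPairing_monomial, one_smul, Fin.prod_univ_castSucc]
    simp [Wop_one]
  | insert i J hi ih =>
    have hJc : Jᶜ = insert i (insert i J)ᶜ := by
      ext j
      by_cases h : j = i
      · simp [h, hi]
      · simp [h]
    rw [Finset.prod_insert hi, Finset.prod_insert hi, pow_sub_eq_sum_monomial, Finset.sum_mul,
      map_sum, Wop_coherent_mul, Finset.mul_sum]
    refine Finset.sum_congr rfl fun a ha => ?_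
    have ha' : a ≤ q := Nat.lt_succ_iff.1 (mem_range.1 ha)
    rw [coherentPairing_monomial_mul]
    have hk : (fun j => (Fin.snoc κ r : Fin (N + 1) → ℤ) j -
        (((Finsupp.single i.castSucc a + Finsupp.single (Fin.last N) (q - a) :
          Fin (N + 1) →₀ ℕ) j : ℕ) : ℤ)) =
        Fin.snoc (Function.update κ i (κ i - a)) (r - q + a) := by
      funext j
      refine Fin.lastCases ?_ (fun j => ?_) j
      · simp [Nat.cast_sub ha', (Fin.castSucc_lt_last i).ne]
        ring
      · by_cases h : j = i
        · subst h
          simp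
        · simp [h]
    rw [hk, ih, mul_smul_comm, hJc, Finset.prod_insert (by simp), Function.update_self]
    have h1 : ∏ j ∈ (insert i J)ᶜ, coherent q (Function.update κ i (κ i - a) j) =
        ∏ j ∈ (insert i J)ᶜ, coherent q (κ j) := by
      refine Finset.prod_congr rfl fun j hj => ?_
      rw [Function.update_of_ne]
      rintro rfl
      simp at hj
    have h2 : ∏ j ∈ J, coherent q (Function.update κ i (κ i - a) j) =
        ∏ j ∈ J, coherent q (κ j) := by
      refine Finset.prod_congr rfl fun j hj => ?_
      rw [Function.update_of_ne]
      rintro rfl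
      exact hi hj
    have h3 : r - q + a - q * #J = r - q * #(insert i J) + a := by
      rw [Finset.card_insert_of_notMem hi]
      push_cast
      ring
    rw [h1, h2, h3]
    congr 1
    ring

theorem coherentPairing_succ (q : ℕ) {N : ℕ} (k : Fin (N + 1) → ℤ) (p : MvPolynomial (Fin N) ℂ) :
    coherentPairing q k (MvPolynomial.rename Fin.castSucc p *
        ∏ i : Fin N, (MvPolynomial.X (Fin.last N) - MvPolynomial.X i.castSucc) ^ q) =
      Wop q (k (Fin.last N) - q * N) (coherentPairing q (fun j => k j.castSucc) p) := by
  induction p using MvPolynomial.induction_on' with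
  | monomial u a =>
    rw [MvPolynomial.rename_monomial, coherentPairing_monomial_mul, coherentPairing_monomial,
      Wop_smul]
    have hk : (fun j => k j - ((Finsupp.mapDomain Fin.castSucc u j : ℕ) : ℤ)) =
        (Fin.snoc (fun j : Fin N => k j.castSucc - (u j : ℤ)) (k (Fin.last N)) :
          Fin (N + 1) → ℤ) := by
      funext j
      refine Fin.lastCases ?_ (fun j => ?_) j
      · rw [Finsupp.mapDomain_of_notMem_range, Fin.snoc_last]
        · simp
        · rintro ⟨i, hi⟩
          exact (Fin.castSucc_lt_last i).ne hi
      · rw [Finsupp.mapDomain_apply (Fin.castSucc_injective N), Fin.snoc_castSucc]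
    rw [hk, coherentPairing_prod]
    simp
  | add p r hp hr => rw [map_add, add_mul, map_add, hp, hr, map_add, Wop_add]

theorem WW_succ (q : ℕ) {N : ℕ} (k : Fin (N + 1) → ℤ) :
    WW q k = Wop q (k (Fin.last N) - q * N) (WW q fun j => k j.castSucc) := by
  unfold WW
  rw [Fin.foldl_succ_last]
  simp

/-- Products of vertex operator components applied to the vacuum: the generating series of
`W_{k_N - q(N-1)} ⋯ W_{k_1} |0⟩` is the Vandermonde power times the product of the generating
series of the states `D^-_k |0⟩`. -/
theorem WW_eq_coherentPairing (q : ℕ) {N : ℕ} (k : Fin N → ℤ) :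
    WW q k = coherentPairing q k (vandermondePow q N) := by
  induction N with
  | zero =>
    have : vandermondePow q 0 = MvPolynomial.monomial 0 1 := by
      simp [vandermondePow]
    rw [this, coherentPairing_monomial]
    simp [WW, vacuum]
  | succ N ih => rw [WW_succ, ih, vandermondePow_succ, coherentPairing_succ]

/-- The vacuum expectation `⟨0| 𝕎(k) |0⟩`. -/
def vacuumExp (q : ℕ) {N : ℕ} (k : Fin N → ℤ) : ℂ := fockInner vacuum (WW q k)

theorem fockInner_vacuum (v : Fock) : fockInner vacuum v = v.coeff 0 := by
  have hs : (vacuum : Fock).support = {0} := by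
    unfold vacuum
    rw [← MvPolynomial.C_1, ← MvPolynomial.monomial_zero', MvPolynomial.support_monomial,
      if_neg one_ne_zero]
  unfold fockInner
  rw [hs]
  simp [vacuum]

theorem coeff_zero_coherent (q : ℕ) (m : ℤ) :
    (coherent q m).coeff 0 = if m = 0 then 1 else 0 := by
  split_ifs with h
  · rw [h, coherent_zero]
    simp
  rcases lt_or_ge m 0 with hm | hm
  · rw [coherent_neg q hm]
    simp
  have hm0 : (m : ℂ) ≠ 0 := by exact_mod_cast h
  have hN := congrArg (MvPolynomial.coeff 0) (coherent_newton q m m.toNat (by omega))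
  rw [MvPolynomial.coeff_smul, MvPolynomial.coeff_smul, MvPolynomial.coeff_sum,
    Finset.sum_eq_zero, smul_zero] at hN
  · exact (smul_eq_zero.1 hN).resolve_left hm0
  · intro i _
    simp [← MvPolynomial.constantCoeff_eq]

theorem vacuumExp_eq (q : ℕ) {N : ℕ} (k : Fin N → ℤ) :
    vacuumExp q k = ∑ m ∈ (vandermondePow q N).support,
      if (∀ j, k j = m j) then (vandermondePow q N).coeff m else 0 := by
  rw [vacuumExp, fockInner_vacuum, WW_eq_coherentPairing, coherentPairing_eq_sum,
    MvPolynomial.coeff_sum]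
  refine Finset.sum_congr rfl fun m _ => ?_
  rw [MvPolynomial.coeff_smul, ← MvPolynomial.constantCoeff_eq, map_prod]
  simp only [MvPolynomial.constantCoeff_eq, coeff_zero_coherent, smul_eq_mul]
  split_ifs with h
  · rw [Finset.prod_eq_one, mul_one]
    intro j _
    rw [if_pos (by rw [h j, sub_self])]
  · push Not at h
    obtain ⟨j, hj⟩ := h
    rw [Finset.prod_eq_zero (mem_univ j), mul_zero]
    exact if_neg fun h0 => hj (by omega)

theorem vacuumExp_natCast (q : ℕ) {N : ℕ} (m : Fin N →₀ ℕ) :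
    vacuumExp q (fun j => (m j : ℤ)) = (vandermondePow q N).coeff m := by
  rw [vacuumExp_eq]
  have h : ∀ m' : Fin N →₀ ℕ, (∀ j, (m j : ℤ) = m' j) ↔ m = m' := by
    intro m'
    rw [Finsupp.ext_iff]
    exact forall_congr' fun j => Nat.cast_inj
  simp only [h]
  rw [Finset.sum_ite_eq]
  split_ifs with hm
  · rfl
  · exact (MvPolynomial.notMem_support_iff.1 hm).symm

theorem exists_of_vacuumExp_ne_zero (q : ℕ) {N : ℕ} {k : Fin N → ℤ} (h : vacuumExp q k ≠ 0) :
    ∃ m ∈ (vandermondePow q N).support, ∀ j, k j = m j := by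
  rw [vacuumExp_eq] at h
  obtain ⟨m, hm, hne⟩ := Finset.exists_ne_zero_of_sum_ne_zero h
  refine ⟨m, hm, ?_⟩
  by_contra hcon
  exact hne (if_neg hcon)

theorem sum_fin_val (N : ℕ) : ∑ j : Fin N, (j : ℕ) = N * (N - 1) / 2 := by
  rw [Fin.sum_univ_eq_sum_range (fun i => i), Finset.sum_range_id]

theorem vandermondePow_isHomogeneous (q N : ℕ) :
    (vandermondePow q N).IsHomogeneous (∑ j : Fin N, q * (j : ℕ)) := by
  unfold vandermondePow
  refine MvPolynomial.IsHomogeneous.prod _ _ _ fun j _ => ?_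
  have h : q * (j : ℕ) = ∑ i ∈ Iio j, 1 * q := by
    rw [Finset.sum_const, Fin.card_Iio, smul_eq_mul]
    ring
  rw [h]
  refine MvPolynomial.IsHomogeneous.prod _ _ _ fun i _ => ?_
  exact ((MvPolynomial.isHomogeneous_X _ _).sub (MvPolynomial.isHomogeneous_X _ _)).pow q

theorem sum_of_mem_support {q N : ℕ} {m : Fin N →₀ ℕ} (hm : m ∈ (vandermondePow q N).support) :
    ∑ j, m j = ∑ j : Fin N, q * (j : ℕ) := by
  have := vandermondePow_isHomogeneous q N (MvPolynomial.mem_support_iff.1 hm)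
  rw [← this, Finsupp.weight_apply, Finsupp.sum_fintype]
  · simp
  · simp

/-- At energy level zero only multiples of the vacuum are left. -/
theorem WW_of_sum_eq (q : ℕ) {N : ℕ} (k : Fin N → ℤ) (hk : ∑ j, k j = ∑ j : Fin N, (q : ℤ) * (j : ℕ)) :
    WW q k = vacuumExp q k • vacuum := by
  rw [vacuumExp_eq, WW_eq_coherentPairing, coherentPairing_eq_sum, Finset.sum_smul]
  refine Finset.sum_congr rfl fun m hm => ?_
  split_ifs with h
  · rw [Finset.prod_eq_one]
    · rfl
    · intro j _
      rw [h j, sub_self, coherent_zero]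
  · have hs : ∑ j, (m j : ℤ) = ∑ j, k j := by
      rw [hk]
      exact_mod_cast sum_of_mem_support hm
    have : ∃ j, k j < m j := by
      by_contra hcon
      push Not at hcon
      refine h fun j => ?_
      have := (Finset.sum_eq_sum_iff_of_le fun j _ => hcon j).1 hs j (mem_univ j)
      exact this.symm
    obtain ⟨j, hj⟩ := this
    rw [Finset.prod_eq_zero (mem_univ j) (coherent_neg q (by omega)), smul_zero, zero_smul]

/-- There are no states of negative energy. -/
theorem WW_of_sum_lt (q : ℕ) {N : ℕ} (k : Fin N → ℤ) (hk : ∑ j, k j < ∑ j : Fin N, (q : ℤ) * (j : ℕ)) :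
    WW q k = 0 := by
  rw [WW_eq_coherentPairing, coherentPairing_eq_sum, Finset.sum_eq_zero]
  intro m hm
  have hs : ∑ j, (m j : ℤ) = ∑ j : Fin N, (q : ℤ) * (j : ℕ) := by
    exact_mod_cast sum_of_mem_support hm
  obtain ⟨j, -, hj⟩ := Finset.exists_lt_of_sum_lt (hk.trans_eq hs.symm)
  rw [Finset.prod_eq_zero (mem_univ j) (coherent_neg q (by omega)), smul_zero]

theorem WW_add (q : ℕ) {n m : ℕ} (k : Fin (n + m) → ℤ) :
    WW q k = Fin.foldl m (fun v j => Wop q (k (Fin.natAdd n j) - q * ((n + j : ℕ) : ℤ)) v)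
      (WW q fun j => k (Fin.castAdd m j)) := by
  unfold WW
  rw [Fin.foldl_add]
  rfl

theorem foldl_Wop_smul (q : ℕ) {m : ℕ} (k : Fin m → ℤ) (c : ℂ) (v : Fock) :
    Fin.foldl m (fun v j => Wop q (k j) v) (c • v) =
      c • Fin.foldl m (fun v j => Wop q (k j) v) v := by
  induction m with
  | zero => simp
  | succ m ih => rw [Fin.foldl_succ_last, Fin.foldl_succ_last, ih, Wop_smul]

/-- Once the first `n` factors have brought the energy back to zero, the remaining ones act on a
multiple of the vacuum, so the vacuum expectation factorizes. -/
theorem vacuumExp_append (q : ℕ) {n m : ℕ} (k : Fin n → ℤ) (l : Fin m → ℤ)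
    (hk : ∑ j, k j = ∑ j : Fin n, (q : ℤ) * (j : ℕ)) :
    vacuumExp q (Fin.append k l) = vacuumExp q k * vacuumExp q (fun j => l j - q * n) := by
  have h : WW q (Fin.append k l) = vacuumExp q k • WW q (fun j => l j - q * n) := by
    rw [WW_add]
    simp only [Fin.append_left, Fin.append_right]
    rw [WW_of_sum_eq q k hk, foldl_Wop_smul]
    unfold WW
    congr 3
    funext v j
    congr 1
    push_cast
    ring
  rw [vacuumExp, h, fockInner_vacuum, MvPolynomial.coeff_smul, ← fockInner_vacuum]
  rfl

theorem vacuumExp_append_eq_zero (q : ℕ) {n m : ℕ} (k : Fin n → ℤ) (l : Fin m → ℤ)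
    (hk : ∑ j, k j < ∑ j : Fin n, (q : ℤ) * (j : ℕ)) : vacuumExp q (Fin.append k l) = 0 := by
  have h : WW q (Fin.append k l) = 0 := by
    rw [WW_add]
    simp only [Fin.append_left, Fin.append_right]
    rw [WW_of_sum_lt q k hk]
    simpa using foldl_Wop_smul q (fun j => l j - q * ((n + j : ℕ) : ℤ)) 0 0
  rw [vacuumExp, h, fockInner_vacuum]
  simp

/-! ### Rearrangements and partial sums -/

open scoped Classical in
/-- The distinct rearrangements of a tuple. -/
def rearrangements {N : ℕ} (b : Fin N → ℕ) : Finset (Fin N → ℕ) :=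
  univ.image fun τ : Equiv.Perm (Fin N) => b ∘ τ

theorem mem_rearrangements {N : ℕ} {b β : Fin N → ℕ} :
    β ∈ rearrangements b ↔ ∃ τ : Equiv.Perm (Fin N), b ∘ τ = β := by
  simp [rearrangements]

theorem card_stabilizer {N : ℕ} (b : Fin N → ℕ) (τ : Equiv.Perm (Fin N)) :
    #{σ : Equiv.Perm (Fin N) | b ∘ σ = b ∘ τ} = occFactorial b := by
  classical
  have h := DomMulAct.stabilizer_card' b
  have h2 : occFactorial b = ∏ i ∈ univ.image b, (Fintype.card {a // b a = i})! := by
    unfold occFactorial occ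
    refine Finset.prod_congr rfl fun k _ => ?_
    rw [Fintype.card_subtype]
  rw [h2, ← h, Fintype.card_subtype]
  refine Finset.card_bij' (fun σ _ => σ * τ⁻¹) (fun σ _ => σ * τ) ?_ ?_ ?_ ?_
  · intro σ hσ
    rw [mem_filter_univ] at hσ ⊢
    funext j
    have := congrFun hσ (τ⁻¹ j)
    simpa using this
  · intro σ hσ
    rw [mem_filter_univ] at hσ ⊢
    funext j
    have := congrFun hσ (τ j)
    simpa using this
  · intro σ _
    simp
  · intro σ _
    simp

/-- Every rearrangement of `b` comes from `M(b)!` permutations. -/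
theorem sum_perm_comp {R : Type*} [CommSemiring R] {N : ℕ} (b : Fin N → ℕ)
    (f : (Fin N → ℕ) → R) :
    ∑ τ : Equiv.Perm (Fin N), f (b ∘ τ) = (occFactorial b : R) * ∑ β ∈ rearrangements b, f β := by
  classical
  rw [Finset.sum_comp f fun τ : Equiv.Perm (Fin N) => b ∘ τ, Finset.mul_sum]
  have hr : rearrangements b = univ.image fun τ : Equiv.Perm (Fin N) => b ∘ τ := by
    ext β
    simp [mem_rearrangements]
  rw [hr]
  refine Finset.sum_congr rfl fun β hβ => ?_
  obtain ⟨τ, -, rfl⟩ := Finset.mem_image.1 hβ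
  rw [nsmul_eq_mul, ← card_stabilizer b τ]

theorem occFactorial_pos {N : ℕ} (b : Fin N → ℕ) : 0 < occFactorial b :=
  Finset.prod_pos fun _ _ => Nat.factorial_pos _

theorem occFactorial_ne_zero {N : ℕ} (b : Fin N → ℕ) : (occFactorial b : ℂ) ≠ 0 := by
  exact_mod_cast (occFactorial_pos b).ne'

/-- The symmetrization over `S_N` in `w_b`, divided by `M(b)!`, is a sum over the rearrangements. -/
theorem wCoeff_eq_sum (q : ℕ) {N : ℕ} (b μ : Fin N → ℕ) :
    wCoeff q b μ =
      ∑ β ∈ rearrangements b, vacuumExp q fun j => (μ j : ℤ) - (β j : ℤ) := by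
  unfold wCoeff
  have h := sum_perm_comp b fun β => vacuumExp q fun j => (μ j : ℤ) - (β j : ℤ)
  have h' : ∑ τ : Equiv.Perm (Fin N),
      fockInner vacuum (WW q fun j => (μ j : ℤ) - (b (τ j) : ℤ)) =
      (occFactorial b : ℂ) * ∑ β ∈ rearrangements b,
        vacuumExp q fun j => (μ j : ℤ) - (β j : ℤ) := h
  rw [h', one_div, inv_mul_cancel_left₀ (occFactorial_ne_zero b)]

theorem count_map_univ {N : ℕ} (b : Fin N → ℕ) (v : ℕ) :
    (univ.val.map b).count v = occ b v := by
  rw [Multiset.count_map]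
  unfold occ
  rw [Finset.card_def, Finset.filter_val]
  congr 2
  funext j
  exact propext eq_comm

theorem mem_rearrangements_iff {N : ℕ} {b β : Fin N → ℕ} :
    β ∈ rearrangements b ↔ univ.val.map β = univ.val.map b := by
  rw [mem_rearrangements]
  constructor
  · rintro ⟨τ, rfl⟩
    rw [← Multiset.map_map, Multiset.map_univ_val_equiv]
  · intro h
    have hc : ∀ v, Fintype.card {j // β j = v} = Fintype.card {j // b j = v} := by
      intro v
      have := congrArg (Multiset.count v) h
      rw [count_map_univ, count_map_univ] at this
      rw [Fintype.card_subtype, Fintype.card_subtype]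
      exact this
    refine ⟨Equiv.ofFiberEquiv fun v => Fintype.equivOfCardEq (hc v), ?_⟩
    funext j
    exact Equiv.ofFiberEquiv_map _ j

/-- The partial sum of the first `i` entries. -/
def partialSum {α : Type*} [AddCommMonoid α] {N : ℕ} (μ : Fin N → α) (i : ℕ) : α :=
  ∑ j : Fin N, if (j : ℕ) < i then μ j else 0

section partialSum

variable {α : Type*} [AddCommMonoid α]

theorem partialSum_zero {N : ℕ} (μ : Fin N → α) : partialSum μ 0 = 0 := by
  simp [partialSum]

theorem partialSum_of_le {N : ℕ} (μ : Fin N → α) {i : ℕ} (h : N ≤ i) :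
    partialSum μ i = ∑ j, μ j :=
  Finset.sum_congr rfl fun j _ => if_pos (j.2.trans_le h)

theorem partialSum_succ {N : ℕ} (μ : Fin N → α) (j : Fin N) :
    partialSum μ (j + 1) = partialSum μ j + μ j := by
  unfold partialSum
  have : μ j = ∑ i : Fin N, if i = j then μ i else 0 := by simp
  conv_rhs => rw [this]
  rw [← Finset.sum_add_distrib]
  refine Finset.sum_congr rfl fun i _ => ?_
  rcases lt_trichotomy (i : ℕ) j with h | h | h
  · simp [h, show (i : ℕ) < j + 1 by omega, Fin.ext_iff, h.ne]
  · simp [h, Fin.ext_iff]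
  · simp [show ¬ (i : ℕ) < j + 1 by omega, show ¬ (i : ℕ) < j by omega, Fin.ext_iff, h.ne']

theorem partialSum_append_of_le {n m : ℕ} (μ : Fin n → α) (ν : Fin m → α) {i : ℕ} (h : i ≤ n) :
    partialSum (Fin.append μ ν) i = partialSum μ i := by
  unfold partialSum
  rw [Fin.sum_univ_add]
  simp only [Fin.append_left, Fin.append_right, Fin.val_castAdd, Fin.val_natAdd]
  rw [Finset.sum_eq_zero (s := univ (α := Fin m)) fun j _ => if_neg (by omega), add_zero]

theorem partialSum_append_add {n m : ℕ} (μ : Fin n → α) (ν : Fin m → α) (i : ℕ) :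
    partialSum (Fin.append μ ν) (n + i) = ∑ j, μ j + partialSum ν i := by
  unfold partialSum
  rw [Fin.sum_univ_add]
  simp only [Fin.append_left, Fin.append_right, Fin.val_castAdd, Fin.val_natAdd,
    Nat.add_lt_add_iff_left]
  congr 1
  exact Finset.sum_congr rfl fun j _ => if_pos (by omega)

theorem partialSum_add {N : ℕ} (μ ν : Fin N → α) (i : ℕ) :
    partialSum (fun j => μ j + ν j) i = partialSum μ i + partialSum ν i := by
  unfold partialSum
  rw [← Finset.sum_add_distrib]
  refine Finset.sum_congr rfl fun j _ => ?_
  split_ifs <;> simp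

end partialSum

theorem partialSum_natCast {N : ℕ} (μ : Fin N → ℕ) (i : ℕ) :
    partialSum (fun j => (μ j : ℤ)) i = (partialSum μ i : ℕ) := by
  simp [partialSum]

theorem partialSum_add_Ici {N : ℕ} (μ : Fin N → ℕ) (i : Fin N) :
    partialSum μ i + ∑ j ∈ Ici i, μ j = ∑ j, μ j := by
  have : ∑ j ∈ Ici i, μ j = ∑ j : Fin N, if i ≤ j then μ j else 0 := by
    rw [← Finset.sum_filter]
    congr 1
    ext j
    simp
  rw [this, partialSum, ← Finset.sum_add_distrib]
  refine Finset.sum_congr rfl fun j _ => ?_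
  by_cases h : i ≤ j
  · rw [if_pos h, if_neg (by rw [Fin.le_def] at h; omega), zero_add]
  · rw [if_neg h, if_pos (by rw [Fin.le_def] at h; omega), add_zero]

/-- Dominance in terms of the partial sums from the left, where the inequality is reversed. -/
theorem dominated_iff {N : ℕ} {μ ν : Fin N → ℕ} :
    Dominated μ ν ↔ Monotone μ ∧ Monotone ν ∧ ∑ j, μ j = ∑ j, ν j ∧
      ∀ i, partialSum ν i ≤ partialSum μ i := by
  unfold Dominated
  refine and_congr_right fun _ => and_congr_right fun _ => and_congr_right fun hs => ?_
  constructor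
  · intro h i
    rcases lt_or_ge i N with hi | hi
    · have h1 := partialSum_add_Ici μ ⟨i, hi⟩
      have h2 := partialSum_add_Ici ν ⟨i, hi⟩
      have := h ⟨i, hi⟩
      simp only at h1 h2
      omega
    · rw [partialSum_of_le _ hi, partialSum_of_le _ hi, hs]
  · intro h i
    have h1 := partialSum_add_Ici μ i
    have h2 := partialSum_add_Ici ν i
    have := h i
    omega

theorem partialSum_le_of_mem_rearrangements {N : ℕ} {b β : Fin N → ℕ} (hb : Monotone b)
    (hβ : β ∈ rearrangements b) (i : ℕ) : partialSum b i ≤ partialSum β i := by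
  obtain ⟨τ, rfl⟩ := mem_rearrangements.1 hβ
  have hanti : Antivary (fun j : Fin N => if (j : ℕ) < i then 1 else 0) b := by
    intro j k hjk
    have : j ≤ k := by
      by_contra h
      exact absurd (hb (not_le.1 h).le) (not_le.2 hjk)
    rw [Fin.le_def] at this
    dsimp only
    split_ifs <;> omega
  have := hanti.sum_mul_le_sum_mul_comp_perm (σ := τ)
  simpa [partialSum] using this

theorem sum_of_mem_rearrangements {N : ℕ} {b β : Fin N → ℕ} (hβ : β ∈ rearrangements b) :
    ∑ j, β j = ∑ j, b j := by
  obtain ⟨τ, rfl⟩ := mem_rearrangements.1 hβ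
  exact Equiv.sum_comp τ b

theorem monotone_rootPartition (q : ℕ) {N : ℕ} {b : Fin N → ℕ} (hb : Monotone b) :
    Monotone (rootPartition q b) := fun _ _ h =>
  Nat.add_le_add (Nat.mul_le_mul_left q h) (hb h)

theorem vacuumExp_sum_eq {q N : ℕ} {k : Fin N → ℤ} (h : vacuumExp q k ≠ 0) :
    ∑ j, k j = ∑ j : Fin N, (q : ℤ) * (j : ℕ) := by
  obtain ⟨m, hm, hk⟩ := exists_of_vacuumExp_ne_zero q h
  rw [Finset.sum_congr rfl fun j _ => hk j]
  exact_mod_cast sum_of_mem_support hm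

/-- After `i` factors the energy, a difference of partial sums, must not be negative. -/
theorem partialSum_le_of_vacuumExp_ne_zero {q N : ℕ} {k : Fin N → ℤ} (h : vacuumExp q k ≠ 0)
    (i : ℕ) : partialSum (fun j : Fin N => (q : ℤ) * (j : ℕ)) i ≤ partialSum k i := by
  rcases lt_or_ge N i with hi | hi
  · rw [partialSum_of_le _ hi.le, partialSum_of_le _ hi.le, vacuumExp_sum_eq h]
  · obtain ⟨m, rfl⟩ := Nat.exists_eq_add_of_le hi
    by_contra hcon
    apply h
    rw [← Fin.append_castAdd_natAdd (f := k)]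
    apply vacuumExp_append_eq_zero
    have e1 := partialSum_append_of_le (fun j => k (Fin.castAdd m j)) (fun j => k (Fin.natAdd i j))
      le_rfl
    rw [Fin.append_castAdd_natAdd, partialSum_of_le _ le_rfl] at e1
    have e2 := partialSum_append_of_le (fun j : Fin i => (q : ℤ) * (j : ℕ))
      (fun j : Fin m => (q : ℤ) * ((i + j : ℕ) : ℤ)) le_rfl
    have e3 : Fin.append (fun j : Fin i => (q : ℤ) * (j : ℕ))
        (fun j : Fin m => (q : ℤ) * ((i + j : ℕ) : ℤ)) = fun j : Fin (i + m) => (q : ℤ) * (j : ℕ) := by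
      funext j
      refine Fin.addCases (fun j => ?_) (fun j => ?_) j <;> simp
    rw [e3, partialSum_of_le _ le_rfl] at e2
    omega

/-- The expansion of the wavefunction involves only dominated partitions. -/
theorem dominated_of_wCoeff_ne_zero {q N : ℕ} {b μ : Fin N → ℕ} (hb : Monotone b) (hμ : Monotone μ)
    (h : wCoeff q b μ ≠ 0) : Dominated μ (rootPartition q b) := by
  rw [wCoeff_eq_sum] at h
  obtain ⟨β, hβ, hne⟩ := Finset.exists_ne_zero_of_sum_ne_zero h
  have hadd : (fun j => (μ j : ℤ)) = fun j => ((μ j : ℤ) - β j) + (β j : ℤ) := by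
    funext j
    ring
  have hroot : (fun j => ((rootPartition q b j : ℕ) : ℤ)) =
      fun j : Fin N => (q : ℤ) * (j : ℕ) + (b j : ℤ) := by
    funext j
    simp [rootPartition]
  refine dominated_iff.2 ⟨hμ, monotone_rootPartition q hb, ?_, fun i => ?_⟩
  · have h1 := vacuumExp_sum_eq hne
    have h2 : ∑ j, (β j : ℤ) = ∑ j, (b j : ℤ) := by exact_mod_cast sum_of_mem_rearrangements hβ
    rw [Finset.sum_sub_distrib, h2] at h1
    have h3 : ((∑ j, rootPartition q b j : ℕ) : ℤ) =
        ∑ j : Fin N, (q : ℤ) * (j : ℕ) + ∑ j, (b j : ℤ) := by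
      rw [← Finset.sum_add_distrib]
      push_cast [rootPartition]
      rfl
    have h4 : ((∑ j, μ j : ℕ) : ℤ) = ∑ j, (μ j : ℤ) := by push_cast; rfl
    omega
  · have h1 := partialSum_le_of_vacuumExp_ne_zero hne i
    have h2 := partialSum_le_of_mem_rearrangements hb hβ i
    have h3 := partialSum_natCast μ i
    have h4 := partialSum_natCast (rootPartition q b) i
    rw [hadd, partialSum_add, partialSum_natCast] at h3
    rw [hroot, partialSum_add, partialSum_natCast] at h4
    omega

/-- All entries of a dominated partition lie strictly below the shift applied to the next segment. -/
theorem Dominated.lt_rootLength {q : ℕ} (hq : 1 ≤ q) {n : ℕ} {b μ : Fin n → ℕ}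
    (h : Dominated μ (rootPartition q b)) (i : Fin n) : μ i < rootLength q b := by
  have hn : 0 < n := i.pos
  have h1 := h.2.2.2 ⟨n - 1, Nat.sub_lt hn Nat.one_pos⟩
  have hI : Ici (⟨n - 1, Nat.sub_lt hn Nat.one_pos⟩ : Fin n) =
      {⟨n - 1, Nat.sub_lt hn Nat.one_pos⟩} := by
    ext k
    simp only [mem_Ici, mem_singleton, Fin.le_def, Fin.ext_iff]
    omega
  rw [hI, sum_singleton, sum_singleton] at h1
  have h2 : μ i ≤ μ ⟨n - 1, Nat.sub_lt hn Nat.one_pos⟩ := h.1 (by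
    rw [Fin.le_def]
    simp only
    omega)
  have h3 : q * (n - 1) < q * n := Nat.mul_lt_mul_of_pos_left (by omega) hq
  simp only [rootPartition, rootLength, lastEntry, dif_pos hn] at h1 ⊢
  omega

theorem le_lastEntry {n : ℕ} {b : Fin n → ℕ} (hb : Monotone b) (j : Fin n) : b j ≤ lastEntry b := by
  unfold lastEntry
  rw [dif_pos j.pos]
  refine hb ?_
  rw [Fin.le_def]
  simp only
  omega

/-- If two multisets of equal size and sum both draw on `B + C`, where `B ≤ ℓ ≤ C`, and one of them
is `B`, then they agree. -/
theorem Multiset.eq_of_le_add {A B C : Multiset ℕ} {l : ℕ} (hB : ∀ x ∈ B, x ≤ l)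
    (hC : ∀ x ∈ C, l ≤ x) (hle : A ≤ B + C) (hcard : A.card = B.card) (hsum : A.sum = B.sum) :
    A = B := by
  have hU : A - B + B = B - A + A := by
    have := Multiset.union_comm A B
    rwa [Multiset.union_def, Multiset.union_def] at this
  have hc := congrArg Multiset.card hU
  have hs := congrArg Multiset.sum hU
  rw [Multiset.card_add, Multiset.card_add, hcard, Nat.add_right_cancel_iff] at hc
  rw [Multiset.sum_add, Multiset.sum_add, hsum, Nat.add_right_cancel_iff] at hs
  have hA : ∀ x ∈ A - B, l ≤ x := fun x hx =>
    hC x (Multiset.mem_of_le (tsub_le_iff_left.2 hle) hx)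
  have hB' : ∀ x ∈ B - A, x ≤ l := fun x hx => hB x (Multiset.mem_of_le tsub_le_self hx)
  -- The excess parts `A - B ≥ l` and `B - A ≤ l` have equal size and sum, so both could consist of
  -- copies of `l` only; but they share no element, so they are empty.
  have hdis : l ∉ A - B ∨ l ∉ B - A := by
    rw [← Multiset.count_eq_zero, ← Multiset.count_eq_zero, Multiset.count_sub, Multiset.count_sub]
    omega
  have hzero : (A - B).card = 0 := by
    by_contra hne
    have hpos : 0 < (A - B).card := Nat.pos_of_ne_zero hne
    have h1 := Multiset.card_nsmul_le_sum hA
    have h2 := Multiset.sum_le_card_nsmul _ _ hB'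
    rw [smul_eq_mul] at h1 h2
    rcases hdis with h | h
    · have h3 := Multiset.card_nsmul_le_sum (s := A - B) (a := l + 1) (fun x hx => by
        have := hA x hx
        have : x ≠ l := fun e => h (e ▸ hx)
        omega)
      rw [smul_eq_mul, mul_add, mul_one] at h3
      rw [hc] at h3 hpos
      omega
    · have hl : 0 < l := by
        obtain ⟨x, hx⟩ := Multiset.card_pos_iff_exists_mem.1 (hc ▸ hpos)
        have := hB' x hx
        have : x ≠ l := fun e => h (e ▸ hx)
        omega
      have h3 := Multiset.sum_le_card_nsmul (B - A) (l - 1) (fun x hx => by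
        have := hB' x hx
        have : x ≠ l := fun e => h (e ▸ hx)
        omega)
      obtain ⟨l, rfl⟩ : ∃ l', l = l' + 1 := ⟨l - 1, by omega⟩
      rw [smul_eq_mul, Nat.add_sub_cancel] at h3
      rw [mul_add, mul_one, hc] at h1
      omega
  have h0 := Multiset.card_eq_zero.1 hzero
  have h0' : B - A = 0 := Multiset.card_eq_zero.1 (hc ▸ hzero)
  rw [h0', h0, zero_add, zero_add] at hU
  exact hU.symm

theorem map_univ_append {n m : ℕ} (μ : Fin n → ℕ) (ν : Fin m → ℕ) :
    (univ.val.map (Fin.append μ ν) : Multiset ℕ) = univ.val.map μ + univ.val.map ν := by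
  ext v
  rw [Multiset.count_add, count_map_univ, count_map_univ, count_map_univ]
  simp only [occ, Finset.card_filter, Fin.sum_univ_add, Fin.append_left, Fin.append_right]

/-- The rearrangements of a composition whose first part has the least possible sum are the
compositions of rearrangements. -/
theorem append_mem_rearrangements_concat {n m : ℕ} {b₁ : Fin n → ℕ} {b₂ : Fin m → ℕ}
    (hb₁ : Monotone b₁) (β₁ : Fin n → ℕ) (β₂ : Fin m → ℕ) :
    (Fin.append β₁ β₂ ∈ rearrangements (concat b₁ b₂) ∧ ∑ j, β₁ j = ∑ j, b₁ j) ↔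
      β₁ ∈ rearrangements b₁ ∧ ∃ β ∈ rearrangements b₂, β₂ = fun j => lastEntry b₁ + β j := by
  have hconcat : (univ.val.map (concat b₁ b₂) : Multiset ℕ) =
      univ.val.map b₁ + univ.val.map fun j => lastEntry b₁ + b₂ j := map_univ_append _ _
  constructor
  · rintro ⟨h, hs⟩
    rw [mem_rearrangements_iff, hconcat, map_univ_append] at h
    have h1 : (univ.val.map β₁ : Multiset ℕ) = univ.val.map b₁ := by
      refine Multiset.eq_of_le_add (C := univ.val.map fun j => lastEntry b₁ + b₂ j)
        (l := lastEntry b₁) ?_ ?_ ?_ ?_ ?_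
      · simp only [Multiset.mem_map]
        rintro x ⟨j, -, rfl⟩
        exact le_lastEntry hb₁ j
      · simp only [Multiset.mem_map]
        rintro x ⟨j, -, rfl⟩
        exact Nat.le_add_right _ _
      · rw [← h]
        exact Multiset.le_add_right _ _
      · simp
      · exact hs
    refine ⟨mem_rearrangements_iff.2 h1, ?_⟩
    rw [h1, add_right_inj] at h
    obtain ⟨τ, hτ⟩ := mem_rearrangements.1 (mem_rearrangements_iff.2 h)
    refine ⟨b₂ ∘ τ, mem_rearrangements.2 ⟨τ, rfl⟩, ?_⟩
    rw [← hτ]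
    rfl
  · rintro ⟨h1, β, hβ, rfl⟩
    refine ⟨?_, sum_of_mem_rearrangements h1⟩
    rw [mem_rearrangements_iff, hconcat, map_univ_append, mem_rearrangements_iff.1 h1]
    congr 1
    obtain ⟨τ, rfl⟩ := mem_rearrangements.1 hβ
    have : (fun j => lastEntry b₁ + (b₂ ∘ τ) j) = (fun j => lastEntry b₁ + b₂ j) ∘ τ := rfl
    rw [this, ← Multiset.map_map, Multiset.map_univ_val_equiv]

/-- Multiplicativity of the coefficients at a renewal point. -/
theorem wCoeff_union (q : ℕ) {n m : ℕ} {b₁ μ₁ : Fin n → ℕ} (b₂ μ₂ : Fin m → ℕ)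
    (hb₁ : Monotone b₁) (hb : Monotone (concat b₁ b₂))
    (hsum : ∑ j, μ₁ j = ∑ j, rootPartition q b₁ j) :
    wCoeff q (concat b₁ b₂) (union q b₁ μ₁ μ₂) = wCoeff q b₁ μ₁ * wCoeff q b₂ μ₂ := by
  classical
  rw [wCoeff_eq_sum, wCoeff_eq_sum, wCoeff_eq_sum, Finset.sum_mul_sum, ← Finset.sum_product']
  have hroot : ((∑ j, μ₁ j : ℕ) : ℤ) = ∑ j : Fin n, (q : ℤ) * (j : ℕ) + ((∑ j, b₁ j : ℕ) : ℤ) := by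
    rw [hsum]
    push_cast [rootPartition]
    rw [Finset.sum_add_distrib]
  have hsplit : ∀ β₁ : Fin n → ℕ, ∀ β₂ : Fin m → ℕ,
      (fun j => ((union q b₁ μ₁ μ₂ j : ℕ) : ℤ) - (Fin.append β₁ β₂ j : ℕ)) =
      Fin.append (fun j => (μ₁ j : ℤ) - β₁ j)
        (fun j => ((rootLength q b₁ + μ₂ j : ℕ) : ℤ) - β₂ j) := by
    intro β₁ β₂
    funext j
    refine Fin.addCases (fun j => ?_) (fun j => ?_) j <;> simp [union]
  have hsub : ∀ β₁ : Fin n → ℕ, ∑ j, ((μ₁ j : ℤ) - β₁ j) =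
      ∑ j : Fin n, (q : ℤ) * (j : ℕ) + ((∑ j, b₁ j : ℕ) : ℤ) - ((∑ j, β₁ j : ℕ) : ℤ) := by
    intro β₁
    rw [Finset.sum_sub_distrib, ← hroot]
    push_cast
    rfl
  have hval : ∀ β₁ ∈ rearrangements b₁, ∀ β : Fin m → ℕ,
      (vacuumExp q fun j => ((union q b₁ μ₁ μ₂ j : ℕ) : ℤ) -
        (Fin.append β₁ (fun j => lastEntry b₁ + β j) j : ℕ)) =
      (vacuumExp q fun j => (μ₁ j : ℤ) - β₁ j) * vacuumExp q fun j => (μ₂ j : ℤ) - β j := by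
    intro β₁ hβ₁ β
    rw [hsplit, vacuumExp_append]
    · congr 2
      funext j
      simp only [rootLength]
      push_cast
      ring
    · rw [hsub, sum_of_mem_rearrangements hβ₁]
      ring
  symm
  -- A rearrangement of `b` whose first part has larger sum than `b₁` would lead to a state of negative
  -- energy; a smaller sum is impossible. The remaining ones split.
  refine Finset.sum_bij_ne_zero (fun p _ _ => Fin.append p.1 fun j => lastEntry b₁ + p.2 j)
    ?_ ?_ ?_ ?_
  · rintro ⟨β₁, β⟩ hp _
    obtain ⟨h1, h2⟩ := mem_product.1 hp
    exact ((append_mem_rearrangements_concat hb₁ _ _).2 ⟨h1, β, h2, rfl⟩).1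
  · rintro ⟨β₁, β⟩ _ _ ⟨β₁', β'⟩ _ _ h
    have h1 : ∀ j, β₁ j = β₁' j := fun j => by simpa using congrFun h (Fin.castAdd m j)
    have h2 : ∀ j, β j = β' j := fun j => by simpa using congrFun h (Fin.natAdd n j)
    rw [Prod.mk.injEq]
    exact ⟨funext h1, funext h2⟩
  · intro γ hγ hne
    obtain ⟨β₁, β₂, rfl⟩ : ∃ β₁ β₂, γ = Fin.append β₁ β₂ :=
      ⟨fun j => γ (Fin.castAdd m j), fun j => γ (Fin.natAdd n j), Fin.append_castAdd_natAdd.symm⟩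
    have hge : ∑ j, b₁ j ≤ ∑ j, β₁ j := by
      have h := partialSum_le_of_mem_rearrangements hb hγ n
      rwa [concat, partialSum_append_of_le _ _ le_rfl, partialSum_append_of_le _ _ le_rfl,
        partialSum_of_le _ le_rfl, partialSum_of_le _ le_rfl] at h
    have hle : ∑ j, β₁ j ≤ ∑ j, b₁ j := by
      by_contra hcon
      apply hne
      rw [hsplit, vacuumExp_append_eq_zero]
      rw [hsub]
      omega
    obtain ⟨h1, β, h2, rfl⟩ := (append_mem_rearrangements_concat hb₁ _ _).1
      ⟨hγ, le_antisymm hle hge⟩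
    refine ⟨(β₁, β), mem_product.2 ⟨h1, h2⟩, ?_, rfl⟩
    rw [hval β₁ h1] at hne
    exact hne
  · rintro ⟨β₁, β⟩ hp _
    exact (hval β₁ (mem_product.1 hp).1 β).symm

/-! ### Renewal points and segments -/

theorem rootPartition_concat (q : ℕ) {n m : ℕ} (b₁ : Fin n → ℕ) (b₂ : Fin m → ℕ) :
    rootPartition q (concat b₁ b₂) = union q b₁ (rootPartition q b₁) (rootPartition q b₂) := by
  funext j
  refine Fin.addCases (fun j => ?_) (fun j => ?_) j
  · simp [rootPartition, union, concat]
  · simp only [rootPartition, union, concat, rootLength, Fin.append_right, Fin.val_natAdd]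
    ring

theorem monotone_concat {n m : ℕ} {b₁ : Fin n → ℕ} {b₂ : Fin m → ℕ} (h₁ : Monotone b₁)
    (h₂ : Monotone b₂) : Monotone (concat b₁ b₂) := by
  intro i j hij
  unfold concat
  induction i using Fin.addCases with
  | left i =>
    induction j using Fin.addCases with
    | left j =>
      simp only [Fin.append_left]
      exact h₁ hij
    | right j =>
      simp only [Fin.append_left, Fin.append_right]
      exact (le_lastEntry h₁ i).trans (Nat.le_add_right _ _)
  | right i =>
    induction j using Fin.addCases with
    | left j =>
      rw [Fin.le_def] at hij
      simp only [Fin.val_natAdd, Fin.val_castAdd] at hij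
      omega
    | right j =>
      simp only [Fin.append_right]
      refine Nat.add_le_add_left (h₂ ?_) _
      rw [Fin.le_def] at hij ⊢
      simp only [Fin.val_natAdd] at hij
      omega

theorem monotone_headPart {n m : ℕ} {b : Fin (n + m) → ℕ} (hb : Monotone b) :
    Monotone (headPart b) := fun _ _ h => hb h

theorem monotone_tailPart {n m : ℕ} {b : Fin (n + m) → ℕ} (hb : Monotone b) :
    Monotone (tailPart b) := fun i j h => by
  unfold tailPart
  refine Nat.sub_le_sub_right (hb ?_) _
  rw [Fin.le_def] at h ⊢
  simp only [Fin.val_natAdd]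
  omega

theorem partialSum_append_const {n m : ℕ} (l : ℕ) (μ : Fin n → ℕ) (ν : Fin m → ℕ) (i : ℕ) :
    partialSum (Fin.append μ fun j => l + ν j) (n + i) =
      ∑ j, μ j + (partialSum (fun _ : Fin m => l) i + partialSum ν i) := by
  rw [partialSum_append_add, partialSum_add]

/-- Concatenation preserves dominance. -/
theorem Dominated.union {q : ℕ} (hq : 1 ≤ q) {n m : ℕ} {b₁ μ₁ : Fin n → ℕ} {b₂ μ₂ : Fin m → ℕ}
    (hb₁ : Monotone b₁) (hb₂ : Monotone b₂) (h₁ : Dominated μ₁ (rootPartition q b₁))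
    (h₂ : Dominated μ₂ (rootPartition q b₂)) :
    Dominated (union q b₁ μ₁ μ₂) (rootPartition q (concat b₁ b₂)) := by
  have hlt := h₁.lt_rootLength hq
  rw [dominated_iff] at h₁ h₂ ⊢
  refine ⟨?_, monotone_rootPartition q (monotone_concat hb₁ hb₂), ?_, fun i => ?_⟩
  · intro i j hij
    unfold QHall.union
    induction i using Fin.addCases with
    | left i =>
      induction j using Fin.addCases with
      | left j =>
        simp only [Fin.append_left]
        exact h₁.1 hij
      | right j =>
        simp only [Fin.append_left, Fin.append_right]
        exact (hlt i).le.trans (Nat.le_add_right _ _)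
    | right i =>
      induction j using Fin.addCases with
      | left j =>
        rw [Fin.le_def] at hij
        simp only [Fin.val_natAdd, Fin.val_castAdd] at hij
        omega
      | right j =>
        simp only [Fin.append_right]
        refine Nat.add_le_add_left (h₂.1 ?_) _
        rw [Fin.le_def] at hij ⊢
        simp only [Fin.val_natAdd] at hij
        omega
  · rw [rootPartition_concat]
    unfold QHall.union
    rw [Fin.sum_univ_add, Fin.sum_univ_add]
    simp only [Fin.append_left, Fin.append_right, Finset.sum_add_distrib, h₁.2.2.1, h₂.2.2.1]
  · rw [rootPartition_concat]
    unfold QHall.union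
    rcases le_total i n with hi | hi
    · rw [partialSum_append_of_le _ _ hi, partialSum_append_of_le _ _ hi]
      exact h₁.2.2.2 i
    · obtain ⟨i, rfl⟩ := Nat.exists_eq_add_of_le hi
      rw [partialSum_append_const, partialSum_append_const, h₁.2.2.1]
      have := h₂.2.2.2 i
      omega

/-- A dominated partition splits wherever its partial sum agrees with that of the root. -/
theorem Dominated.exists_union {q n m : ℕ} {b₁ : Fin n → ℕ} {b₂ : Fin m → ℕ}
    {μ : Fin (n + m) → ℕ} (hb₁ : Monotone b₁) (hb₂ : Monotone b₂)
    (h : Dominated μ (rootPartition q (concat b₁ b₂)))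
    (hn : partialSum μ n = partialSum (rootPartition q (concat b₁ b₂)) n) :
    ∃ μ₁ μ₂, Dominated μ₁ (rootPartition q b₁) ∧ Dominated μ₂ (rootPartition q b₂) ∧
      μ = QHall.union q b₁ μ₁ μ₂ := by
  rw [dominated_iff] at h
  obtain ⟨hmono, -, hsum, hpart⟩ := h
  -- The partial sums agree at `n` and are ordered at `n + 1`, so the next entry of `μ` is at least that
  -- of the root.
  have hge : ∀ j : Fin m, rootLength q b₁ ≤ μ (Fin.natAdd n j) := by
    intro j
    have hm : 0 < m := j.pos
    have h1 := hpart (n + 1)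
    have h2 := partialSum_succ μ (Fin.natAdd n ⟨0, hm⟩)
    have h3 := partialSum_succ (rootPartition q (concat b₁ b₂)) (Fin.natAdd n ⟨0, hm⟩)
    simp only [Fin.val_natAdd, add_zero] at h2 h3
    have h4 : rootLength q b₁ ≤ rootPartition q (concat b₁ b₂) (Fin.natAdd n ⟨0, hm⟩) := by
      rw [rootPartition_concat]
      unfold QHall.union
      rw [Fin.append_right]
      exact Nat.le_add_right _ _
    have h5 : μ (Fin.natAdd n ⟨0, hm⟩) ≤ μ (Fin.natAdd n j) := hmono (by
      rw [Fin.le_def]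
      simp only [Fin.val_natAdd]
      omega)
    omega
  have hμ : μ = QHall.union q b₁ (fun j => μ (Fin.castAdd m j))
      fun j => μ (Fin.natAdd n j) - rootLength q b₁ := by
    funext j
    unfold QHall.union
    refine Fin.addCases (fun j => ?_) (fun j => ?_) j
    · simp
    · simp [Nat.add_sub_cancel' (hge j)]
  set μ₁ : Fin n → ℕ := fun j => μ (Fin.castAdd m j) with hμ₁
  set μ₂ : Fin m → ℕ := fun j => μ (Fin.natAdd n j) - rootLength q b₁ with hμ₂
  have hs₁ : ∑ j, μ₁ j = ∑ j, rootPartition q b₁ j := by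
    rw [hμ, rootPartition_concat] at hn
    unfold QHall.union at hn
    rwa [partialSum_append_of_le _ _ le_rfl, partialSum_append_of_le _ _ le_rfl,
      partialSum_of_le _ le_rfl, partialSum_of_le _ le_rfl] at hn
  refine ⟨μ₁, μ₂, ?_, ?_, hμ⟩
  · refine dominated_iff.2 ⟨fun _ _ h => hmono h, monotone_rootPartition q hb₁, hs₁, fun i => ?_⟩
    rcases le_total i n with hi | hi
    · have := hpart i
      rw [hμ, rootPartition_concat] at this
      unfold QHall.union at this
      rwa [partialSum_append_of_le _ _ hi, partialSum_append_of_le _ _ hi] at this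
    · rw [partialSum_of_le _ hi, partialSum_of_le _ hi, hs₁]
  · refine dominated_iff.2 ⟨?_, monotone_rootPartition q hb₂, ?_, fun i => ?_⟩
    · intro i j hij
      refine Nat.sub_le_sub_right (hmono ?_) _
      rw [Fin.le_def] at hij ⊢
      simp only [Fin.val_natAdd]
      omega
    · rw [hμ, rootPartition_concat] at hsum
      unfold QHall.union at hsum
      rw [Fin.sum_univ_add, Fin.sum_univ_add] at hsum
      simp only [Fin.append_left, Fin.append_right, Finset.sum_add_distrib, hs₁] at hsum
      omega
    · have := hpart (n + i)
      rw [hμ, rootPartition_concat] at this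
      unfold QHall.union at this
      rw [partialSum_append_const, partialSum_append_const, hs₁] at this
      omega

/-- Renewal points are the interior places where the partial sums of `μ` and of the root agree. -/
theorem hasRenewalAt_iff {q : ℕ} {N : ℕ} {b μ : Fin N → ℕ} (hb : Monotone b)
    (h : Dominated μ (rootPartition q b)) (n : ℕ) :
    HasRenewalAt q b μ n ↔ 1 ≤ n ∧ n < N ∧ partialSum μ n = partialSum (rootPartition q b) n := by
  constructor
  · rintro ⟨hn, m, rfl, hm, b₁, μ₁, b₂, μ₂, -, -, h₁, -, hμ, hb'⟩
    obtain rfl : μ = union q b₁ μ₁ μ₂ := funext hμ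
    obtain rfl : b = concat b₁ b₂ := funext hb'
    refine ⟨hn, by omega, ?_⟩
    rw [rootPartition_concat]
    unfold union
    rw [partialSum_append_of_le _ _ le_rfl, partialSum_append_of_le _ _ le_rfl,
      partialSum_of_le _ le_rfl, partialSum_of_le _ le_rfl, h₁.2.2.1]
  · rintro ⟨hn, hlt, heq⟩
    obtain ⟨m, rfl⟩ := Nat.exists_eq_add_of_le hlt.le
    have hc := concat_headPart_tailPart b hb
    rw [← hc] at h heq
    obtain ⟨μ₁, μ₂, h₁, h₂, rfl⟩ :=
      h.exists_union (monotone_headPart hb) (monotone_tailPart hb) heq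
    exact ⟨hn, m, rfl, by omega, headPart b, μ₁, tailPart b, μ₂, monotone_headPart hb,
      monotone_tailPart hb, h₁, h₂, fun _ => rfl, fun j => (congrFun hc j).symm⟩

open scoped Classical in
/-- The partitions dominated by the root partition of `b`. -/
def dominatedPartitions (q : ℕ) {N : ℕ} (b : Fin N → ℕ) : Finset (Fin N → ℕ) :=
  (Finset.Nat.antidiagonalTuple N (∑ j, rootPartition q b j)).filter fun μ =>
    Dominated μ (rootPartition q b)

theorem mem_dominatedPartitions {q N : ℕ} {b μ : Fin N → ℕ} :
    μ ∈ dominatedPartitions q b ↔ Dominated μ (rootPartition q b) := by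
  simp only [dominatedPartitions, Finset.mem_filter, Finset.Nat.mem_antidiagonalTuple]
  exact ⟨fun h => h.2, fun h => ⟨h.2.2.1, h⟩⟩

open scoped Classical in
/-- The dominated partitions whose partial sums agree with those of the root exactly at the places
in `B`. -/
def segmentPartitions (q : ℕ) {N : ℕ} (b : Fin N → ℕ) (B : ℕ → Prop) : Finset (Fin N → ℕ) :=
  (dominatedPartitions q b).filter fun μ =>
    ∀ i ≤ N, partialSum μ i = partialSum (rootPartition q b) i ↔ B i

theorem mem_segmentPartitions {q N : ℕ} {b μ : Fin N → ℕ} {B : ℕ → Prop} :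
    μ ∈ segmentPartitions q b B ↔ Dominated μ (rootPartition q b) ∧
      ∀ i ≤ N, partialSum μ i = partialSum (rootPartition q b) i ↔ B i := by
  simp [segmentPartitions, mem_dominatedPartitions]

/-- Irreducible partitions meet the partial sums of the root only at the two ends. -/
theorem irredPartitions_eq (q : ℕ) {N : ℕ} {b : Fin N → ℕ} (hb : Monotone b) :
    irredPartitions q b = segmentPartitions q b fun i => i = 0 ∨ i = N := by
  ext μ
  rw [mem_irredPartitions, mem_segmentPartitions]
  refine and_congr_right fun h => ?_
  unfold Irred
  simp only [hasRenewalAt_iff hb h]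
  constructor
  · intro hirr i hi
    constructor
    · intro heq
      by_contra hcon
      exact hirr i ⟨by omega, by omega, heq⟩
    · rintro (rfl | rfl)
      · rw [partialSum_zero, partialSum_zero]
      · rw [partialSum_of_le _ le_rfl, partialSum_of_le _ le_rfl, h.2.2.1]
  · rintro hall n ⟨h1, h2, h3⟩
    have := (hall n h2.le).1 h3
    omega

/-- The partitions with first renewal point `n` are the concatenations of an irreducible partition
with a second one. -/
theorem segmentPartitions_concat {q : ℕ} (hq : 1 ≤ q) {n m : ℕ} {b₁ : Fin n → ℕ}
    {b₂ : Fin m → ℕ} (hb₁ : Monotone b₁) (hb₂ : Monotone b₂) (P : ℕ → Prop) (hP : P 0)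
    (ν : Fin (n + m) → ℕ) :
    ν ∈ segmentPartitions q (concat b₁ b₂) (fun i => i = 0 ∨ ∃ j, P j ∧ n + j = i) ↔
      ∃ μ₁ ∈ irredPartitions q b₁, ∃ μ₂ ∈ segmentPartitions q b₂ P, union q b₁ μ₁ μ₂ = ν := by
  have hlow : ∀ (μ₁ : Fin n → ℕ) (μ₂ : Fin m → ℕ) (i : ℕ), i ≤ n →
      (partialSum (union q b₁ μ₁ μ₂) i = partialSum (rootPartition q (concat b₁ b₂)) i ↔
        partialSum μ₁ i = partialSum (rootPartition q b₁) i) := by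
    intro μ₁ μ₂ i hi
    rw [rootPartition_concat]
    unfold union
    rw [partialSum_append_of_le _ _ hi, partialSum_append_of_le _ _ hi]
  have hhigh : ∀ (μ₁ : Fin n → ℕ) (μ₂ : Fin m → ℕ), Dominated μ₁ (rootPartition q b₁) → ∀ i : ℕ,
      (partialSum (union q b₁ μ₁ μ₂) (n + i) =
        partialSum (rootPartition q (concat b₁ b₂)) (n + i) ↔
        partialSum μ₂ i = partialSum (rootPartition q b₂) i) := by
    intro μ₁ μ₂ h i
    rw [rootPartition_concat]
    unfold union
    rw [partialSum_append_const, partialSum_append_const, h.2.2.1]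
    omega
  rw [irredPartitions_eq q hb₁]
  simp only [mem_segmentPartitions]
  constructor
  · rintro ⟨hd, hall⟩
    obtain ⟨μ₁, μ₂, h₁, h₂, rfl⟩ := hd.exists_union hb₁ hb₂
      ((hall n (Nat.le_add_right n m)).2 (Or.inr ⟨0, hP, rfl⟩))
    refine ⟨μ₁, ⟨h₁, fun i hi => ?_⟩, μ₂, ⟨h₂, fun i hi => ?_⟩, rfl⟩
    · rw [← hlow μ₁ μ₂ i hi, hall i (by omega)]
      constructor
      · rintro (h | ⟨j, -, h⟩)
        · exact Or.inl h
        · exact Or.inr (by omega)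
      · rintro (h | rfl)
        · exact Or.inl h
        · exact Or.inr ⟨0, hP, rfl⟩
    · rw [← hhigh μ₁ μ₂ h₁ i, hall (n + i) (by omega)]
      constructor
      · rintro (h | ⟨j, hj, h⟩)
        · obtain rfl : i = 0 := by omega
          exact hP
        · obtain rfl : i = j := by omega
          exact hj
      · intro h
        exact Or.inr ⟨i, h, rfl⟩
  · rintro ⟨μ₁, ⟨h₁, hall₁⟩, μ₂, ⟨h₂, hall₂⟩, rfl⟩
    refine ⟨h₁.union hq hb₁ hb₂ h₂, fun i hi => ?_⟩
    rcases lt_or_ge i n with h | h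
    · rw [hlow μ₁ μ₂ i h.le, hall₁ i h.le]
      constructor
      · rintro (h | h)
        · exact Or.inl h
        · omega
      · rintro (h | ⟨j, -, h⟩)
        · exact Or.inl h
        · omega
    · obtain ⟨i, rfl⟩ := Nat.exists_eq_add_of_le h
      rw [hhigh μ₁ μ₂ h₁ i, hall₂ i (by omega)]
      constructor
      · intro h
        exact Or.inr ⟨i, h, rfl⟩
      · rintro (h | ⟨j, hj, h⟩)
        · obtain rfl : i = 0 := by omega
          exact hP
        · obtain rfl : i = j := by omega
          exact hj

/-- `Δ` is additive: shifting the second part changes `Δ` by a multiple of the difference of the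
sums of `μ₂` and of its root partition, which vanishes. -/
theorem Delta_union (q : ℕ) {n m : ℕ} {b₁ μ₁ : Fin n → ℕ} {b₂ μ₂ : Fin m → ℕ}
    (h₂ : ∑ j, μ₂ j = ∑ j, rootPartition q b₂ j) :
    Delta q (concat b₁ b₂) (union q b₁ μ₁ μ₂) = Delta q b₁ μ₁ + Delta q b₂ μ₂ := by
  unfold Delta
  rw [rootPartition_concat]
  unfold union
  rw [Fin.sum_univ_add]
  simp only [Fin.append_left, Fin.append_right]
  congr 1
  have h2 : ∑ j, (μ₂ j : ℝ) = ∑ j, (rootPartition q b₂ j : ℝ) := by exact_mod_cast h₂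
  have h3 : ∑ j, (2 * (rootLength q b₁ : ℝ)) * ((rootPartition q b₂ j : ℝ) - μ₂ j) = 0 := by
    rw [← Finset.mul_sum, Finset.sum_sub_distrib, h2, sub_self, mul_zero]
  rw [← sub_eq_zero, ← Finset.sum_sub_distrib, ← h3]
  refine Finset.sum_congr rfl fun j _ => ?_
  push_cast
  ring

/-- Multiplicativity of the expansion coefficients at a renewal point. -/
theorem hCoeff_union {q : ℕ} (hq : 1 ≤ q) (γ : ℝ) {n m : ℕ} {b₁ μ₁ : Fin n → ℕ}
    {b₂ μ₂ : Fin m → ℕ} (hb₁ : Monotone b₁) (hb₂ : Monotone b₂)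
    (h₁ : Dominated μ₁ (rootPartition q b₁)) (h₂ : Dominated μ₂ (rootPartition q b₂)) :
    hCoeff q γ (concat b₁ b₂) (union q b₁ μ₁ μ₂) = hCoeff q γ b₁ μ₁ * hCoeff q γ b₂ μ₂ := by
  unfold hCoeff
  rw [Delta_union q h₂.2.2.1, wCoeff_union q b₂ μ₂ hb₁ (monotone_concat hb₁ hb₂) h₁.2.2.1]
  have hocc : occFactorial (union q b₁ μ₁ μ₂) = occFactorial μ₁ * occFactorial μ₂ := by
    unfold union
    rw [occFactorial_append]
    · congr 1
      classical
      have himg : univ.image (fun j => rootLength q b₁ + μ₂ j) =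
          (univ.image μ₂).image (rootLength q b₁ + ·) := by
        rw [image_image]
        rfl
      unfold occFactorial
      rw [himg, prod_image (fun a _ c _ h => by simpa using h)]
      simp [occ]
    · intro i j
      have := h₁.lt_rootLength hq i
      omega
  rw [hocc, mul_add, Real.exp_add, Nat.cast_mul, Real.sqrt_mul (Nat.cast_nonneg _)]
  push_cast
  ring

/-- The linear combination of the `Φ_μ`, `μ ∈ S`, with the expansion coefficients of the root. -/
def partialWave (q : ℕ) (γ : ℝ) {N : ℕ} (b : Fin N → ℕ) (S : Finset (Fin N → ℕ))
    (z : Fin N → ℂ) : ℂ :=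
  ∑ μ ∈ S, hCoeff q γ b μ * Phi q γ μ z

theorem odot_sum (q : ℕ) (γ : ℝ) {n m : ℕ} (b₁ : Fin n → ℕ) {ι κ : Type*} (s : Finset ι)
    (t : Finset κ) (c : ι → ℂ) (d : κ → ℂ) (f : ι → (Fin n → ℂ) → ℂ) (g : κ → (Fin m → ℂ) → ℂ)
    (z : Fin (n + m) → ℂ) :
    odot q γ b₁ (fun x => ∑ i ∈ s, c i * f i x) (fun x => ∑ k ∈ t, d k * g k x) z =
      ∑ i ∈ s, ∑ k ∈ t, c i * d k * odot q γ b₁ (f i) (g k) z := by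
  unfold odot qTensor shift
  have h : ∀ σ : Equiv.Perm (Fin (n + m)), ∀ (A : ℂ) (u : ι → ℂ) (v : κ → ℂ),
      sgnPow q σ * ((∑ i ∈ s, c i * u i) * (A * ∑ k ∈ t, d k * v k)) =
      ∑ i ∈ s, ∑ k ∈ t, c i * d k * (sgnPow q σ * (u i * (A * v k))) := by
    intro σ A u v
    rw [Finset.mul_sum, Finset.sum_mul_sum, Finset.mul_sum]
    refine Finset.sum_congr rfl fun i _ => ?_
    rw [Finset.mul_sum]
    refine Finset.sum_congr rfl fun k _ => ?_
    ring
  simp only [h]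
  rw [Finset.sum_comm, Finset.mul_sum]
  refine Finset.sum_congr rfl fun i _ => ?_
  rw [Finset.sum_comm, Finset.mul_sum]
  refine Finset.sum_congr rfl fun k _ => ?_
  rw [← Finset.mul_sum]
  ring

/-- Prepending an irreducible segment to a partial wave. -/
theorem odot_partialWave {q : ℕ} (hq : 1 ≤ q) (γ : ℝ) {n m : ℕ} {b₁ : Fin n → ℕ}
    {b₂ : Fin m → ℕ} (hb₁ : Monotone b₁) (hb₂ : Monotone b₂) (P : ℕ → Prop) (hP : P 0)
    (z : Fin (n + m) → ℂ) :
    odot q γ b₁ (PsiHat q γ b₁) (partialWave q γ b₂ (segmentPartitions q b₂ P)) z =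
      partialWave q γ (concat b₁ b₂) (segmentPartitions q (concat b₁ b₂)
        (fun i => i = 0 ∨ ∃ j, P j ∧ n + j = i)) z := by
  refine (odot_sum q γ b₁ _ _ _ _ _ _ z).trans ?_
  rw [← Finset.sum_product']
  refine Finset.sum_bij (fun p _ => union q b₁ p.1 p.2) ?_ ?_ ?_ ?_
  · rintro ⟨μ₁, μ₂⟩ hp
    obtain ⟨h1, h2⟩ := mem_product.1 hp
    exact (segmentPartitions_concat hq hb₁ hb₂ P hP _).2 ⟨μ₁, h1, μ₂, h2, rfl⟩
  · rintro ⟨μ₁, μ₂⟩ _ ⟨μ₁', μ₂'⟩ _ h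
    have h1 : ∀ j, μ₁ j = μ₁' j := fun j => by simpa [union] using congrFun h (Fin.castAdd m j)
    have h2 : ∀ j, μ₂ j = μ₂' j := fun j => by simpa [union] using congrFun h (Fin.natAdd n j)
    rw [Prod.mk.injEq]
    exact ⟨funext h1, funext h2⟩
  · intro ν hν
    obtain ⟨μ₁, h1, μ₂, h2, rfl⟩ := (segmentPartitions_concat hq hb₁ hb₂ P hP _).1 hν
    exact ⟨(μ₁, μ₂), mem_product.2 ⟨h1, h2⟩, rfl⟩
  · rintro ⟨μ₁, μ₂⟩ hp
    obtain ⟨h1, h2⟩ := mem_product.1 hp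
    have hd₁ := ((mem_irredPartitions q b₁ μ₁).1 h1).1
    have hd₂ := (mem_segmentPartitions.1 h2).1
    rw [odot_Phi hq γ μ₂ hd₁, hCoeff_union hq γ hb₁ hb₂ hd₁ hd₂]

/-- Being a partial sum of the list `L`. -/
def IsTakeSum (L : List ℕ) (i : ℕ) : Prop := ∃ j ≤ L.length, (L.take j).sum = i

theorem isTakeSum_cons (n : ℕ) (L : List ℕ) (i : ℕ) :
    IsTakeSum (n :: L) i ↔ i = 0 ∨ ∃ j, IsTakeSum L j ∧ n + j = i := by
  constructor
  · rintro ⟨j, hj, rfl⟩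
    cases j with
    | zero => exact Or.inl rfl
    | succ j =>
      right
      exact ⟨_, ⟨j, by simpa using hj, rfl⟩, by simp⟩
  · rintro (rfl | ⟨_, ⟨j, hj, rfl⟩, rfl⟩)
    · exact ⟨0, by simp, rfl⟩
    · exact ⟨j + 1, by simpa using hj, by simp⟩

theorem isTakeSum_zero (L : List ℕ) : IsTakeSum L 0 := ⟨0, by simp, rfl⟩

/-- A segment product collects the dominated partitions whose renewal points are exactly the
boundaries of the segments. -/
theorem segmentProduct_eq {q : ℕ} (hq : 1 ≤ q) (γ : ℝ) (L : List ℕ) (hL : L ≠ [])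
    (b : Fin L.sum → ℕ) (hb : Monotone b) :
    segmentProduct q γ L b = partialWave q γ b (segmentPartitions q b (IsTakeSum L)) := by
  induction L with
  | nil => exact absurd rfl hL
  | cons n L ih =>
    cases L with
    | nil =>
      have h : (segmentPartitions q b (IsTakeSum [n])) = irredPartitions q b := by
        rw [irredPartitions_eq q hb]
        congr 1
        funext i
        rw [isTakeSum_cons]
        simp only [List.sum_cons, List.sum_nil, add_zero]
        congr 1
        refine propext ⟨?_, ?_⟩
        · rintro ⟨_, ⟨j, hj, rfl⟩, rfl⟩
          simp
        · rintro rfl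
          exact ⟨0, isTakeSum_zero [], rfl⟩
      rw [h]
      rfl
    | cons n' L =>
      have h2 := monotone_tailPart (n := n) (m := (n' :: L).sum) hb
      have h1 := monotone_headPart (n := n) (m := (n' :: L).sum) hb
      have hc := concat_headPart_tailPart (n := n) (m := (n' :: L).sum) b hb
      funext z
      have hstep : segmentProduct q γ (n :: n' :: L) b z =
          odot (n := n) (m := (n' :: L).sum) q γ (headPart b) (PsiHat q γ (headPart b))
            (segmentProduct q γ (n' :: L) (tailPart (n := n) b)) z := rfl
      rw [hstep, ih (List.cons_ne_nil _ _) _ h2]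
      refine (odot_partialWave hq γ h1 h2 (IsTakeSum (n' :: L)) (isTakeSum_zero _) z).trans ?_
      have hp : (fun i => i = 0 ∨ ∃ j, IsTakeSum (n' :: L) j ∧ n + j = i) =
          IsTakeSum (n :: n' :: L) := by
        funext i
        exact propext (isTakeSum_cons n (n' :: L) i).symm
      rw [hc, hp]
      rfl

/-- The term of the expansion indexed by a composition consists of the dominated partitions whose
partial sums agree with those of the root exactly at the boundaries of the composition. -/
theorem segmentTerm_eq {q : ℕ} (hq : 1 ≤ q) (γ : ℝ) {N : ℕ} (hN : 1 ≤ N) {b : Fin N → ℕ}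
    (hb : Monotone b) (c : Composition N) :
    segmentTerm q γ b c = partialWave q γ b (segmentPartitions q b (IsTakeSum c.blocks)) := by
  have key : ∀ (L : List ℕ) (M : ℕ) (h : L.sum = M) (b : Fin M → ℕ) (z : Fin M → ℂ), Monotone b →
      L ≠ [] → segmentProduct q γ L (fun j => b (Fin.cast h j)) (fun j => z (Fin.cast h j)) =
        partialWave q γ b (segmentPartitions q b (IsTakeSum L)) z := by
    rintro L M rfl b z hb hL
    exact congrFun (segmentProduct_eq hq γ L hL b hb) z
  funext z
  refine key c.blocks N c.blocks_sum b z hb ?_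
  rw [ne_eq, c.blocks_eq_nil]
  omega

theorem isTakeSum_blocks_iff {N : ℕ} (c : Composition N) (i : Fin (N + 1)) :
    IsTakeSum c.blocks i ↔ i ∈ c.boundaries := by
  simp only [Composition.boundaries, Composition.boundary, mem_map, mem_univ, true_and]
  constructor
  · rintro ⟨j, hj, h⟩
    exact ⟨⟨j, by rw [c.blocks_length] at hj; omega⟩, Fin.ext h⟩
  · rintro ⟨j, rfl⟩
    exact ⟨j, by rw [c.blocks_length]; omega, rfl⟩

theorem composition_ext_boundaries {N : ℕ} {c c' : Composition N}
    (h : c.boundaries = c'.boundaries) : c = c' :=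
  (compositionEquiv N).injective (CompositionAsSet.ext h)

/-- A dominated partition determines its segmentation, so no `Φ_μ` occurs in two terms. -/
theorem disjoint_segmentPartitions (q : ℕ) {N : ℕ} (b : Fin N → ℕ) {c c' : Composition N}
    (h : c ≠ c') : Disjoint (segmentPartitions q b (IsTakeSum c.blocks))
      (segmentPartitions q b (IsTakeSum c'.blocks)) := by
  rw [Finset.disjoint_left]
  intro μ h1 h2
  apply h
  apply composition_ext_boundaries
  ext i
  rw [← isTakeSum_blocks_iff, ← isTakeSum_blocks_iff,
    ← (mem_segmentPartitions.1 h1).2 i (by omega), ← (mem_segmentPartitions.1 h2).2 i (by omega)]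

/-- Every dominated partition belongs to exactly one segmentation. -/
theorem sum_partialWave_segmentPartitions (q : ℕ) (γ : ℝ) {N : ℕ} (b : Fin N → ℕ)
    (z : Fin N → ℂ) :
    ∑ c : Composition N, partialWave q γ b (segmentPartitions q b (IsTakeSum c.blocks)) z =
      partialWave q γ b (dominatedPartitions q b) z := by
  classical
  unfold partialWave
  rw [← Finset.sum_biUnion fun c _ c' _ h => disjoint_segmentPartitions q b h]
  refine Finset.sum_congr ?_ fun _ _ => rfl
  ext μ
  simp only [mem_biUnion, mem_univ, true_and, mem_dominatedPartitions, mem_segmentPartitions]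
  refine ⟨fun ⟨c, h, _⟩ => h, fun h => ?_⟩
  let A : CompositionAsSet N :=
    { boundaries := univ.filter fun i : Fin (N + 1) =>
        partialSum μ i = partialSum (rootPartition q b) i
      zero_mem := by
        rw [mem_filter_univ]
        simp [partialSum_zero]
      getLast_mem := by
        rw [mem_filter_univ, Fin.val_last, partialSum_of_le _ le_rfl, partialSum_of_le _ le_rfl,
          h.2.2.1] }
  refine ⟨A.toComposition, h, fun i hi => ?_⟩
  have h1 := isTakeSum_blocks_iff A.toComposition ⟨i, by omega⟩
  rw [h1, CompositionAsSet.toComposition_boundaries, mem_filter_univ]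

/-! ### Orthogonality of the occupation-number basis -/

section

open MeasureTheory

instance (γ : ℝ) : SigmaFinite (cylMeasure₁ γ) := by
  unfold cylMeasure₁
  infer_instance

/-- Fubini on the cylinder for products of a function of `Re z` and a function of `Im z`. -/
theorem integral_cylMeasure₁_mul (γ : ℝ) {F G : ℝ → ℂ} {g : ℂ → ℂ}
    (hg : ∀ z : ℂ, (Real.exp (-z.re ^ 2) : ℂ) * g z = F z.re * G z.im) (hF : Integrable F)
    (hG : IntegrableOn G (Set.Ico 0 (2 * Real.pi / γ))) :
    Integrable g (cylMeasure₁ γ) ∧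
      ∫ z, g z ∂cylMeasure₁ γ = (∫ x, F x) * ∫ y in Set.Ico 0 (2 * Real.pi / γ), G y := by
  have hmeas : Measurable fun z : ℂ => ENNReal.ofReal (Real.exp (-z.re ^ 2)) := by
    have := Complex.measurable_re
    fun_prop
  have htop : ∀ᵐ z : ℂ ∂(volume.restrict {z : ℂ | 0 ≤ z.im ∧ z.im < 2 * Real.pi / γ}),
      ENNReal.ofReal (Real.exp (-z.re ^ 2)) < ⊤ := Filter.Eventually.of_forall fun z =>
    ENNReal.ofReal_lt_top
  have hfun : (fun z : ℂ => (ENNReal.ofReal (Real.exp (-z.re ^ 2))).toReal • g z) =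
      (fun p : ℝ × ℝ => F p.1 * G p.2) ∘ Complex.measurableEquivRealProd := by
    funext z
    rw [ENNReal.toReal_ofReal (Real.exp_pos _).le, Complex.real_smul, hg z]
    rfl
  have hset : {z : ℂ | 0 ≤ z.im ∧ z.im < 2 * Real.pi / γ} =
      Complex.measurableEquivRealProd ⁻¹' (Set.univ ×ˢ Set.Ico 0 (2 * Real.pi / γ)) := by
    ext z
    simp [Complex.measurableEquivRealProd]
  have hmp := Complex.volume_preserving_equiv_real_prod.restrict_preimage_emb
    Complex.measurableEquivRealProd.measurableEmbedding
    (Set.univ ×ˢ Set.Ico 0 (2 * Real.pi / γ))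
  have hprod : (volume : Measure (ℝ × ℝ)).restrict (Set.univ ×ˢ Set.Ico 0 (2 * Real.pi / γ)) =
      (volume : Measure ℝ).prod (volume.restrict (Set.Ico 0 (2 * Real.pi / γ))) := by
    rw [Measure.volume_eq_prod, ← Measure.prod_restrict, Measure.restrict_univ]
  rw [hprod] at hmp
  unfold cylMeasure₁
  rw [integrable_withDensity_iff_integrable_smul' hmeas htop,
    integral_withDensity_eq_integral_toReal_smul hmeas htop, hfun, hset]
  constructor
  · rw [hmp.integrable_comp_emb Complex.measurableEquivRealProd.measurableEmbedding]
    exact hF.mul_prod hG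
  · exact (hmp.integral_comp Complex.measurableEquivRealProd.measurableEmbedding
      (fun p : ℝ × ℝ => F p.1 * G p.2)).trans (integral_prod_mul F G)

theorem continuous_orbital (γ : ℝ) (k : ℕ) : Continuous (orbital γ k) := by
  unfold orbital
  fun_prop

/-- The orbitals are orthonormal. -/
theorem orbital_orthonormal {γ : ℝ} (hγ : 0 < γ) (k l : ℕ) :
    Integrable (fun z => conj (orbital γ k z) * orbital γ l z) (cylMeasure₁ γ) ∧
      ∫ z, conj (orbital γ k z) * orbital γ l z ∂cylMeasure₁ γ = if k = l then 1 else 0 := by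
  set A : ℝ := Real.sqrt (γ / (2 * Real.pi ^ (3 / 2 : ℝ))) with hA
  set C : ℂ := (A : ℂ) * ((Real.exp (-γ ^ 2 * (k : ℝ) ^ 2 / 2) : ℝ) : ℂ) *
    ((A : ℂ) * ((Real.exp (-γ ^ 2 * (l : ℝ) ^ 2 / 2) : ℝ) : ℂ)) with hC
  -- In `z = x + i y` the integrand is a Gaussian in `x` with linear term `c x`, times `e^{d y}`.
  set c : ℂ := (γ : ℂ) * ((k : ℂ) + l) with hc
  set d : ℂ := (γ : ℂ) * ((l : ℂ) - k) * Complex.I with hd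
  have hT : 0 < 2 * Real.pi / γ := by positivity
  have hγ0 : (γ : ℂ) ≠ 0 := by exact_mod_cast hγ.ne'
  have hmain := integral_cylMeasure₁_mul γ
    (F := fun x : ℝ => C * Complex.exp ((-1 : ℂ) * (x : ℂ) ^ 2 + c * x + 0))
    (G := fun y : ℝ => Complex.exp (d * y))
    (g := fun z => conj (orbital γ k z) * orbital γ l z) (by
      intro z
      simp only [orbital, map_mul, Complex.conj_ofReal, Complex.conj_natCast, ← Complex.exp_conj]
      have : Complex.exp ((γ : ℂ) * conj z * k) * Complex.exp ((γ : ℂ) * z * l) *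
          ((Real.exp (-z.re ^ 2) : ℝ) : ℂ) =
          Complex.exp ((-1 : ℂ) * (z.re : ℂ) ^ 2 + c * z.re + 0) * Complex.exp (d * z.im) := by
        rw [Complex.ofReal_exp, ← Complex.exp_add, ← Complex.exp_add, ← Complex.exp_add]
        congr 1
        conv_lhs => rw [← Complex.re_add_im z]
        simp only [map_add, map_mul, Complex.conj_ofReal, Complex.conj_I, hc, hd]
        push_cast
        simp only [Complex.add_re, Complex.ofReal_re, Complex.mul_re, Complex.I_re, mul_zero,
          Complex.ofReal_im, Complex.I_im, mul_one, sub_self, add_zero]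
        ring
      simp only [hC, hA]
      linear_combination ((A : ℂ) * ((Real.exp (-γ ^ 2 * (k : ℝ) ^ 2 / 2) : ℝ) : ℂ) *
        ((A : ℂ) * ((Real.exp (-γ ^ 2 * (l : ℝ) ^ 2 / 2) : ℝ) : ℂ))) * this)
    ((by
      have := integrable_cexp_quadratic (b := 1) (by norm_num) c 0
      exact this.const_mul C))
    (by
      refine (Continuous.integrableOn_Icc ?_).mono_set Set.Ico_subset_Icc_self
      fun_prop)
  refine ⟨hmain.1, hmain.2.trans ?_⟩
  rw [integral_const_mul, integral_cexp_quadratic (by norm_num), integral_Ico_eq_integral_Ioc,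
    ← intervalIntegral.integral_of_le hT.le]
  split_ifs with h
  · subst h
    have hd0 : d = 0 := by simp [hd]
    simp only [hd0, zero_mul, Complex.exp_zero, intervalIntegral.integral_const, sub_zero]
    have hA2 : A * A = γ / (2 * Real.pi ^ (3 / 2 : ℝ)) := Real.mul_self_sqrt (by positivity)
    have he : Real.exp (-γ ^ 2 * (k : ℝ) ^ 2 / 2) * Real.exp (-γ ^ 2 * (k : ℝ) ^ 2 / 2) *
        Real.exp (γ ^ 2 * (k : ℝ) ^ 2) = 1 := by
      rw [← Real.exp_add, ← Real.exp_add, ← Real.exp_zero]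
      congr 1
      ring
    have hpi : Real.pi ^ (3 / 2 : ℝ) = Real.pi * Real.sqrt Real.pi := by
      rw [Real.sqrt_eq_rpow, show (3 / 2 : ℝ) = 1 + 1 / 2 by norm_num, Real.rpow_add Real.pi_pos,
        Real.rpow_one]
    have hsq : ((Real.pi : ℂ) / -(-1)) ^ (1 / 2 : ℂ) = ((Real.sqrt Real.pi : ℝ) : ℂ) := by
      rw [neg_neg, div_one, Real.sqrt_eq_rpow, Complex.ofReal_cpow Real.pi_pos.le]
      norm_num
    have hex : Complex.exp (0 - c ^ 2 / (4 * -1)) =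
        ((Real.exp (γ ^ 2 * (k : ℝ) ^ 2) : ℝ) : ℂ) := by
      rw [Complex.ofReal_exp]
      congr 1
      simp only [hc]
      push_cast
      ring
    rw [hsq, hex]
    have hreal : A * Real.exp (-γ ^ 2 * (k : ℝ) ^ 2 / 2) *
        (A * Real.exp (-γ ^ 2 * (k : ℝ) ^ 2 / 2)) *
        (Real.sqrt Real.pi * Real.exp (γ ^ 2 * (k : ℝ) ^ 2)) * (2 * Real.pi / γ) = 1 := by
      have h1 : A * A * (Real.sqrt Real.pi * (2 * Real.pi / γ)) = 1 := by
        rw [hA2, hpi]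
        have : 0 < Real.sqrt Real.pi := Real.sqrt_pos.2 Real.pi_pos
        field_simp
      linear_combination (A * A * (Real.sqrt Real.pi * (2 * Real.pi / γ))) * he + h1
    rw [hC]
    simp only [Complex.real_smul, mul_one]
    exact_mod_cast hreal
  · have hd0 : d ≠ 0 := by
      have : (l : ℂ) - k ≠ 0 := by
        rw [sub_ne_zero]
        exact_mod_cast Ne.symm h
      simp only [hd]
      exact mul_ne_zero (mul_ne_zero hγ0 this) Complex.I_ne_zero
    rw [integral_exp_mul_complex hd0]
    have : Complex.exp (d * ((2 * Real.pi / γ : ℝ) : ℂ)) = 1 := by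
      rw [Complex.exp_eq_one_iff]
      refine ⟨(l : ℤ) - k, ?_⟩
      simp only [hd]
      push_cast
      field_simp
    rw [this]
    simp

/-- The product wavefunction `∏_j φ_{α_j}(z_j)`. -/
def orbitalProd (γ : ℝ) {N : ℕ} (α : Fin N → ℕ) (z : Fin N → ℂ) : ℂ := ∏ j, orbital γ (α j) (z j)

theorem continuous_orbitalProd (γ : ℝ) {N : ℕ} (α : Fin N → ℕ) : Continuous (orbitalProd γ α) :=
  continuous_finsetProd _ fun j _ => (continuous_orbital γ (α j)).comp (continuous_apply j)

theorem scalarProd_orbitalProd {γ : ℝ} (hγ : 0 < γ) {N : ℕ} (α β : Fin N → ℕ) :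
    scalarProd γ (orbitalProd γ α) (orbitalProd γ β) = if α = β then 1 else 0 := by
  unfold scalarProd orbitalProd cylMeasure
  simp only [map_prod, ← Finset.prod_mul_distrib]
  rw [integral_fintype_prod_eq_prod
    (f := fun j z => conj (orbital γ (α j) z) * orbital γ (β j) z)]
  simp only [(orbital_orthonormal hγ _ _).2]
  split_ifs with h
  · subst h
    simp
  · obtain ⟨j, hj⟩ := Function.ne_iff.1 h
    exact Finset.prod_eq_zero (mem_univ j) (if_neg hj)

theorem memLp_orbitalProd {γ : ℝ} (hγ : 0 < γ) {N : ℕ} (α : Fin N → ℕ) :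
    MemLp (orbitalProd γ α) 2 (cylMeasure γ N) := by
  rw [memLp_two_iff_integrable_sq_norm (continuous_orbitalProd γ α).aestronglyMeasurable]
  have h : (fun z => ‖orbitalProd γ α z‖ ^ 2) = fun z =>
      ∏ j, ‖orbital γ (α j) (z j)‖ ^ 2 := by
    funext z
    rw [orbitalProd, norm_prod, Finset.prod_pow]
  rw [h]
  refine Integrable.fintype_prod (μ := fun _ => cylMeasure₁ γ)
    (f := fun j w => ‖orbital γ (α j) w‖ ^ 2) fun j => ?_
  have := (orbital_orthonormal hγ (α j) (α j)).1.norm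
  simpa [sq] using this

theorem integrable_conj_mul {γ : ℝ} {N : ℕ} {f g : (Fin N → ℂ) → ℂ}
    (hf : MemLp f 2 (cylMeasure γ N)) (hg : MemLp g 2 (cylMeasure γ N)) :
    Integrable (fun z => conj (f z) * g z) (cylMeasure γ N) :=
  MemLp.integrable_mul hf.star hg

theorem memLp_sum {γ : ℝ} {N : ℕ} {ι : Type*} (s : Finset ι) (c : ι → ℂ)
    (f : ι → (Fin N → ℂ) → ℂ) (hf : ∀ i ∈ s, MemLp (f i) 2 (cylMeasure γ N)) :
    MemLp (fun z => ∑ i ∈ s, c i * f i z) 2 (cylMeasure γ N) :=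
  memLp_finsetSum s fun i hi => (hf i hi).const_mul (c i)

theorem scalarProd_sum {γ : ℝ} {N : ℕ} {ι κ : Type*} (s : Finset ι) (t : Finset κ) (c : ι → ℂ)
    (d : κ → ℂ) (f : ι → (Fin N → ℂ) → ℂ) (g : κ → (Fin N → ℂ) → ℂ)
    (hf : ∀ i ∈ s, MemLp (f i) 2 (cylMeasure γ N)) (hg : ∀ k ∈ t, MemLp (g k) 2 (cylMeasure γ N)) :
    scalarProd γ (fun z => ∑ i ∈ s, c i * f i z) (fun z => ∑ k ∈ t, d k * g k z) =
      ∑ i ∈ s, ∑ k ∈ t, conj (c i) * d k * scalarProd γ (f i) (g k) := by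
  unfold scalarProd
  have h : ∀ z, conj (∑ i ∈ s, c i * f i z) * (∑ k ∈ t, d k * g k z) =
      ∑ i ∈ s, ∑ k ∈ t, conj (c i) * d k * (conj (f i z) * g k z) := by
    intro z
    rw [map_sum, Finset.sum_mul_sum]
    refine Finset.sum_congr rfl fun i _ => Finset.sum_congr rfl fun k _ => ?_
    rw [map_mul]
    ring
  simp only [h]
  rw [integral_finsetSum _ fun i hi => integrable_finsetSum _ fun k hk =>
    (integrable_conj_mul (hf i hi) (hg k hk)).const_mul _]
  refine Finset.sum_congr rfl fun i hi => ?_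
  rw [integral_finsetSum _ fun k hk => (integrable_conj_mul (hf i hi) (hg k hk)).const_mul _]
  exact Finset.sum_congr rfl fun k _ => integral_const_mul _ _

/-- `Φ_μ` as a combination of product wavefunctions, indexed by the permutations. -/
theorem Phi_eq_sum (q : ℕ) (γ : ℝ) {N : ℕ} (μ : Fin N → ℕ) :
    Phi q γ μ = fun z => ∑ σ : Equiv.Perm (Fin N),
      (1 / ((Real.sqrt ((occFactorial μ : ℝ) * (N ! : ℝ)) : ℝ) : ℂ) * sgnPow q σ) *
        orbitalProd γ (μ ∘ σ.symm) z := by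
  funext z
  unfold Phi orbitalProd
  rw [Finset.mul_sum]
  refine Finset.sum_congr rfl fun σ _ => ?_
  rw [mul_assoc]
  congr 2
  rw [← Equiv.prod_comp σ fun j => orbital γ ((μ ∘ σ.symm) j) (z j)]
  simp

theorem memLp_Phi (q : ℕ) {γ : ℝ} (hγ : 0 < γ) {N : ℕ} (μ : Fin N → ℕ) :
    MemLp (Phi q γ μ) 2 (cylMeasure γ N) := by
  rw [Phi_eq_sum]
  exact memLp_sum _ _ _ fun σ _ => memLp_orbitalProd hγ _

theorem scalarProd_Phi_eq_zero (q : ℕ) {γ : ℝ} (hγ : 0 < γ) {N : ℕ} {μ ν : Fin N → ℕ}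
    (hμ : Monotone μ) (hν : Monotone ν) (h : μ ≠ ν) :
    scalarProd γ (Phi q γ μ) (Phi q γ ν) = 0 := by
  rw [Phi_eq_sum, Phi_eq_sum, scalarProd_sum _ _ _ _ _ _ (fun σ _ => memLp_orbitalProd hγ _)
    (fun σ _ => memLp_orbitalProd hγ _)]
  refine Finset.sum_eq_zero fun σ _ => Finset.sum_eq_zero fun τ _ => ?_
  rw [scalarProd_orbitalProd hγ, if_neg, mul_zero]
  intro hcon
  apply h
  have h1 : ν = μ ∘ (σ.symm * τ : Equiv.Perm (Fin N)) := by
    funext j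
    have := congrFun hcon (τ j)
    simpa using this.symm
  have h2 : Monotone (μ ∘ (1 : Equiv.Perm (Fin N))) := hμ
  have h3 : Monotone (μ ∘ (σ.symm * τ : Equiv.Perm (Fin N))) := h1 ▸ hν
  rw [h1]
  exact Tuple.unique_monotone h2 h3

theorem norm_sgnPow (q : ℕ) {N : ℕ} (σ : Equiv.Perm (Fin N)) : ‖sgnPow q σ‖ = 1 := by
  unfold sgnPow
  rw [norm_pow]
  rcases Int.units_eq_one_or (Equiv.Perm.sign σ) with h | h <;> simp [h]

/-- The `Φ_μ` are normalized, or zero when the exclusion principle applies. -/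
theorem norm_scalarProd_Phi_le (q : ℕ) {γ : ℝ} (hγ : 0 < γ) {N : ℕ} (μ : Fin N → ℕ) :
    ‖scalarProd γ (Phi q γ μ) (Phi q γ μ)‖ ≤ 1 := by
  classical
  rw [Phi_eq_sum, scalarProd_sum _ _ _ _ _ _ (fun σ _ => memLp_orbitalProd hγ _)
    (fun σ _ => memLp_orbitalProd hγ _)]
  set r : ℝ := (occFactorial μ : ℝ) * (N ! : ℝ) with hr
  have hr0 : 0 < r := mul_pos (by exact_mod_cast occFactorial_pos μ) (by positivity)
  have hterm : ∀ σ τ : Equiv.Perm (Fin N),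
      ‖conj (1 / ((Real.sqrt r : ℝ) : ℂ) * sgnPow q σ) * (1 / ((Real.sqrt r : ℝ) : ℂ) * sgnPow q τ) *
        scalarProd γ (orbitalProd γ (μ ∘ σ.symm)) (orbitalProd γ (μ ∘ τ.symm))‖ =
      r⁻¹ * if μ ∘ τ.symm = μ ∘ σ.symm then 1 else 0 := by
    intro σ τ
    rw [scalarProd_orbitalProd hγ, norm_mul, norm_mul, RCLike.norm_conj, norm_mul, norm_mul,
      norm_sgnPow, norm_sgnPow, norm_div, norm_one, Complex.norm_real, Real.norm_eq_abs,
      abs_of_nonneg (Real.sqrt_nonneg r)]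
    have : 1 / Real.sqrt r * 1 * (1 / Real.sqrt r * 1) = r⁻¹ := by
      rw [mul_one, ← sq, div_pow, Real.sq_sqrt hr0.le, one_pow, one_div]
    rw [this]
    simp only [eq_comm (a := μ ∘ σ.symm)]
    split_ifs <;> simp
  refine (norm_sum_le _ _).trans ?_
  refine (Finset.sum_le_sum fun σ _ => norm_sum_le _ _).trans (le_of_eq ?_)
  simp only [hterm, ← Finset.mul_sum]
  have hcount : ∀ σ : Equiv.Perm (Fin N), ∑ τ : Equiv.Perm (Fin N),
      (if μ ∘ τ.symm = μ ∘ σ.symm then (1 : ℝ) else 0) = occFactorial μ := by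
    intro σ
    have e : ∑ τ : Equiv.Perm (Fin N), (if μ ∘ τ.symm = μ ∘ σ.symm then (1 : ℝ) else 0) =
        ∑ τ : Equiv.Perm (Fin N), (if μ ∘ τ = μ ∘ σ.symm then (1 : ℝ) else 0) :=
      Equiv.sum_comp (Equiv.inv (Equiv.Perm (Fin N)))
        fun τ : Equiv.Perm (Fin N) => if μ ∘ τ = μ ∘ σ.symm then (1 : ℝ) else 0
    rw [e, Finset.sum_boole, ← card_stabilizer μ σ.symm]
  rw [Finset.sum_congr rfl fun σ _ => hcount σ, Finset.sum_const, Finset.card_univ,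
    Fintype.card_perm, Fintype.card_fin, nsmul_eq_mul, mul_comm (N ! : ℝ), ← hr,
    inv_mul_cancel₀ hr0.ne']

theorem memLp_partialWave (q : ℕ) {γ : ℝ} (hγ : 0 < γ) {N : ℕ} (b : Fin N → ℕ)
    (S : Finset (Fin N → ℕ)) : MemLp (partialWave q γ b S) 2 (cylMeasure γ N) :=
  memLp_sum _ _ _ fun μ _ => memLp_Phi q hγ μ

theorem scalarProd_partialWave_eq_zero (q : ℕ) {γ : ℝ} (hγ : 0 < γ) {N : ℕ} (b : Fin N → ℕ)
    {S T : Finset (Fin N → ℕ)} (hS : ∀ μ ∈ S, Monotone μ) (hT : ∀ μ ∈ T, Monotone μ)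
    (h : Disjoint S T) : scalarProd γ (partialWave q γ b S) (partialWave q γ b T) = 0 := by
  refine (scalarProd_sum S T _ _ _ _ (fun μ _ => memLp_Phi q hγ μ)
    fun μ _ => memLp_Phi q hγ μ).trans ?_
  refine Finset.sum_eq_zero fun μ hμ => Finset.sum_eq_zero fun ν hν => ?_
  rw [scalarProd_Phi_eq_zero q hγ (hS μ hμ) (hT ν hν), mul_zero]
  rintro rfl
  exact Finset.disjoint_left.1 h hμ hν

theorem normSq_eq_scalarProd (γ : ℝ) {N : ℕ} (f : (Fin N → ℂ) → ℂ) :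
    (normSq γ f : ℂ) = scalarProd γ f f := by
  unfold normSq scalarProd
  rw [← integral_complex_ofReal]
  congr 1
  funext z
  rw [Complex.conj_mul']
  push_cast
  rfl

theorem normSq_partialWave_le (q : ℕ) {γ : ℝ} (hγ : 0 < γ) {N : ℕ} (b : Fin N → ℕ)
    {S : Finset (Fin N → ℕ)} (hS : ∀ μ ∈ S, Monotone μ) :
    normSq γ (partialWave q γ b S) ≤ ∑ μ ∈ S, ‖hCoeff q γ b μ‖ ^ 2 := by
  have h0 : 0 ≤ normSq γ (partialWave q γ b S) := integral_nonneg fun z => by positivity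
  have h1 : scalarProd γ (partialWave q γ b S) (partialWave q γ b S) =
      ∑ μ ∈ S, conj (hCoeff q γ b μ) * hCoeff q γ b μ *
        scalarProd γ (Phi q γ μ) (Phi q γ μ) := by
    refine (scalarProd_sum S S _ _ _ _ (fun μ _ => memLp_Phi q hγ μ)
      fun μ _ => memLp_Phi q hγ μ).trans ?_
    refine Finset.sum_congr rfl fun μ hμ => ?_
    rw [Finset.sum_eq_single μ]
    · intro ν hν hne
      rw [scalarProd_Phi_eq_zero q hγ (hS μ hμ) (hS ν hν) hne.symm, mul_zero]
    · intro h
      exact absurd hμ h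
  have h2 : normSq γ (partialWave q γ b S) =
      ‖scalarProd γ (partialWave q γ b S) (partialWave q γ b S)‖ := by
    rw [← normSq_eq_scalarProd, Complex.norm_real, Real.norm_of_nonneg h0]
  rw [h2, h1]
  refine (norm_sum_le _ _).trans (Finset.sum_le_sum fun μ _ => ?_)
  rw [norm_mul, norm_mul, RCLike.norm_conj, ← sq]
  exact mul_le_of_le_one_right (by positivity) (norm_scalarProd_Phi_le q hγ μ)

end

/-! ### Expansion of the wavefunction -/

/-- A tuple of natural numbers as an exponent vector. -/
def toExponent {N : ℕ} (α : Fin N → ℕ) : Fin N →₀ ℕ := Finsupp.equivFunOnFinite.symm α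

theorem toExponent_apply {N : ℕ} (α : Fin N → ℕ) (j : Fin N) : toExponent α j = α j := rfl

/-- The polynomial `m_b(X) ∏_{i < j} (X_j - X_i)^q`. -/
def wavePoly (q : ℕ) {N : ℕ} (b : Fin N → ℕ) : MvPolynomial (Fin N) ℂ :=
  (MvPolynomial.C (1 / (occFactorial b : ℂ)) *
    ∑ τ : Equiv.Perm (Fin N), MvPolynomial.monomial (toExponent (b ∘ τ)) 1) * vandermondePow q N

/-- The coefficients `w_b(μ)`, defined by vertex operators, are the coefficients of the wavefunction
as a polynomial in the variables `e^{γ z_j}`. -/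
theorem coeff_wavePoly (q : ℕ) {N : ℕ} (b μ : Fin N → ℕ) :
    (wavePoly q b).coeff (toExponent μ) = wCoeff q b μ := by
  unfold wavePoly wCoeff
  rw [mul_assoc, MvPolynomial.coeff_C_mul, Finset.sum_mul, MvPolynomial.coeff_sum]
  congr 1
  refine Finset.sum_congr rfl fun τ _ => ?_
  rw [MvPolynomial.coeff_monomial_mul', one_mul]
  split_ifs with h
  · rw [← vacuumExp_natCast, vacuumExp]
    congr 2
    funext j
    have := h j
    simp only [toExponent_apply, Function.comp_apply] at this
    rw [Finsupp.tsub_apply, toExponent_apply, toExponent_apply, Function.comp_apply, Nat.cast_sub this]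
  · by_contra hne
    obtain ⟨m, -, hm⟩ := exists_of_vacuumExp_ne_zero q (Ne.symm hne)
    apply h
    intro j
    have := hm j
    simp only [toExponent_apply, Function.comp_apply]
    omega

/-- The determinant form makes the behaviour under permutations of the variables visible. -/
theorem vandermondePow_eq_det (q N : ℕ) :
    vandermondePow q N = (Matrix.vandermonde fun i : Fin N => (MvPolynomial.X i :
      MvPolynomial (Fin N) ℂ)).det ^ q := by
  rw [Matrix.det_vandermonde, ← Finset.prod_pow]
  simp only [← Finset.prod_pow]
  unfold vandermondePow
  exact Finset.prod_comm' (by simp)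

theorem rename_vandermondePow (q : ℕ) {N : ℕ} (σ : Equiv.Perm (Fin N)) :
    MvPolynomial.rename σ (vandermondePow q N) =
      MvPolynomial.C (sgnPow q σ) * vandermondePow q N := by
  rw [vandermondePow_eq_det, map_pow, AlgHom.map_det]
  have h : (MvPolynomial.rename (R := ℂ) σ).mapMatrix
      (Matrix.vandermonde fun i : Fin N => (MvPolynomial.X i : MvPolynomial (Fin N) ℂ)) =
      (Matrix.vandermonde fun i : Fin N =>
        (MvPolynomial.X i : MvPolynomial (Fin N) ℂ)).submatrix σ id := by
    ext1 i j
    simp [Matrix.vandermonde_apply]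
  rw [h, Matrix.det_permute, mul_pow]
  congr 1
  unfold sgnPow
  simp

theorem rename_wavePoly (q : ℕ) {N : ℕ} (b : Fin N → ℕ) (σ : Equiv.Perm (Fin N)) :
    MvPolynomial.rename σ (wavePoly q b) = MvPolynomial.C (sgnPow q σ) * wavePoly q b := by
  unfold wavePoly
  rw [map_mul, map_mul, rename_vandermondePow, MvPolynomial.rename_C, map_sum]
  have h : ∑ τ : Equiv.Perm (Fin N), MvPolynomial.rename σ
      (MvPolynomial.monomial (toExponent (b ∘ τ)) (1 : ℂ)) =
      ∑ τ : Equiv.Perm (Fin N), MvPolynomial.monomial (toExponent (b ∘ τ)) 1 := by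
    rw [← Equiv.sum_comp (Equiv.mulRight σ⁻¹)
      fun τ : Equiv.Perm (Fin N) => MvPolynomial.monomial (toExponent (b ∘ τ)) (1 : ℂ)]
    refine Finset.sum_congr rfl fun τ _ => ?_
    have hm : (toExponent (b ∘ τ)).mapDomain σ = toExponent (b ∘ Equiv.mulRight σ⁻¹ τ) := by
      ext j
      obtain ⟨i, rfl⟩ := σ.surjective j
      rw [Finsupp.mapDomain_apply σ.injective]
      simp [toExponent_apply]
    rw [MvPolynomial.rename_monomial, hm]
  rw [h]
  ring

/-- The coefficients inherit the exchange symmetry of the wavefunction. -/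
theorem wCoeff_comp_perm (q : ℕ) {N : ℕ} (b μ : Fin N → ℕ) (σ : Equiv.Perm (Fin N)) :
    wCoeff q b (μ ∘ σ) = sgnPow q σ * wCoeff q b μ := by
  have h := congrArg (MvPolynomial.coeff (toExponent μ)) (rename_wavePoly q b σ)
  have hm : toExponent μ = (toExponent (μ ∘ σ)).mapDomain σ := by
    ext j
    obtain ⟨i, rfl⟩ := σ.surjective j
    rw [Finsupp.mapDomain_apply σ.injective]
    rfl
  rw [MvPolynomial.coeff_C_mul, coeff_wavePoly] at h
  conv_lhs at h => rw [hm]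
  rw [MvPolynomial.coeff_rename_mapDomain _ σ.injective, coeff_wavePoly] at h
  exact h

theorem sgnPow_inv (q : ℕ) {N : ℕ} (σ : Equiv.Perm (Fin N)) : sgnPow q σ⁻¹ = sgnPow q σ := by
  simp [sgnPow]

theorem eval_wavePoly (q : ℕ) {N : ℕ} (b : Fin N → ℕ) (x : Fin N → ℂ) :
    MvPolynomial.eval x (wavePoly q b) =
      monSym b x * ∏ j, ∏ i ∈ Iio j, (x j - x i) ^ q := by
  unfold wavePoly vandermondePow monSym
  simp only [map_mul, MvPolynomial.eval_C, map_sum, map_prod, map_pow, map_sub,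
    MvPolynomial.eval_X]
  congr 2
  rw [← Equiv.sum_comp (Equiv.inv (Equiv.Perm (Fin N)))]
  refine Finset.sum_congr rfl fun σ _ => ?_
  rw [MvPolynomial.eval_monomial, Finsupp.prod_fintype _ _ (fun _ => pow_zero _), one_mul,
    ← Equiv.prod_comp σ fun j => x j ^ toExponent (b ∘ (Equiv.inv (Equiv.Perm (Fin N))) σ) j]
  simp [toExponent_apply]

/-- Sorting the monomials of `m_b(X) ∏_{i < j} (X_j - X_i)^q` by partitions. -/
theorem eval_wavePoly_eq_sum (q : ℕ) {N : ℕ} {b : Fin N → ℕ} (hb : Monotone b) (x : Fin N → ℂ) :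
    MvPolynomial.eval x (wavePoly q b) = ∑ μ ∈ dominatedPartitions q b,
      wCoeff q b μ / (occFactorial μ : ℂ) *
        ∑ σ : Equiv.Perm (Fin N), sgnPow q σ * ∏ j, x (σ j) ^ μ j := by
  classical
  have h1 : MvPolynomial.eval x (wavePoly q b) =
      ∑ α ∈ (wavePoly q b).support.image (fun m : Fin N →₀ ℕ => (m : Fin N → ℕ)),
        wCoeff q b α * ∏ j, x j ^ α j := by
    rw [MvPolynomial.eval_eq', Finset.sum_image fun _ _ _ _ h => DFunLike.coe_injective h]
    refine Finset.sum_congr rfl fun m _ => ?_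
    rw [← coeff_wavePoly]
    congr 2
    ext j
    rfl
  have h2 : (wavePoly q b).support.image (fun m : Fin N →₀ ℕ => (m : Fin N → ℕ)) ⊆
      (dominatedPartitions q b).biUnion rearrangements := by
    intro α hα
    obtain ⟨m, hm, rfl⟩ := mem_image.1 hα
    have hw : wCoeff q b m ≠ 0 := by
      rw [← coeff_wavePoly, show toExponent m = m from Finsupp.ext fun _ => rfl]
      exact MvPolynomial.mem_support_iff.1 hm
    rw [mem_biUnion]
    refine ⟨m ∘ Tuple.sort m, mem_dominatedPartitions.2 ?_, ?_⟩
    · refine dominated_of_wCoeff_ne_zero hb (Tuple.monotone_sort _) ?_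
      rw [wCoeff_comp_perm]
      refine mul_ne_zero ?_ hw
      rw [← norm_ne_zero_iff, norm_sgnPow]
      exact one_ne_zero
    · refine mem_rearrangements.2 ⟨(Tuple.sort m)⁻¹, ?_⟩
      funext j
      simp
  have h3 : ∀ α ∈ (dominatedPartitions q b).biUnion rearrangements,
      α ∉ (wavePoly q b).support.image (fun m : Fin N →₀ ℕ => (m : Fin N → ℕ)) →
      wCoeff q b α * ∏ j, x j ^ α j = 0 := by
    intro α _ hα
    rw [← coeff_wavePoly, MvPolynomial.notMem_support_iff.1, zero_mul]
    intro hcon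
    exact hα (mem_image.2 ⟨_, hcon, rfl⟩)
  have hdisj : Set.PairwiseDisjoint (dominatedPartitions q b : Set (Fin N → ℕ)) rearrangements := by
    intro μ hμ ν hν hne
    rw [Function.onFun, Finset.disjoint_left]
    intro α hα hα'
    obtain ⟨σ, rfl⟩ := mem_rearrangements.1 hα
    obtain ⟨τ, hτ⟩ := mem_rearrangements.1 hα'
    apply hne
    have e : ν = μ ∘ (σ * τ⁻¹ : Equiv.Perm (Fin N)) := by
      funext j
      have := congrFun hτ (τ⁻¹ j)
      simpa using this
    have m1 : Monotone (μ ∘ (1 : Equiv.Perm (Fin N))) := (mem_dominatedPartitions.1 hμ).1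
    have m2 : Monotone (μ ∘ (σ * τ⁻¹ : Equiv.Perm (Fin N))) :=
      e ▸ (mem_dominatedPartitions.1 hν).1
    rw [e]
    exact Tuple.unique_monotone m1 m2
  rw [h1, Finset.sum_subset h2 h3, Finset.sum_biUnion hdisj]
  refine Finset.sum_congr rfl fun μ _ => ?_
  have h4 := sum_perm_comp μ fun α => wCoeff q b α * ∏ j, x j ^ α j
  rw [div_mul_eq_mul_div, eq_div_iff (occFactorial_ne_zero μ), mul_comm, ← h4, Finset.mul_sum,
    ← Equiv.sum_comp (Equiv.inv (Equiv.Perm (Fin N)))]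
  refine Finset.sum_congr rfl fun σ _ => ?_
  rw [Equiv.inv_apply, wCoeff_comp_perm, sgnPow_inv,
    ← Equiv.prod_comp σ fun j => x j ^ (μ ∘ (σ⁻¹ : Equiv.Perm (Fin N))) j]
  have h5 : ∀ j, (σ⁻¹ : Equiv.Perm (Fin N)) (σ j) = j := fun j => by simp
  simp only [Function.comp_apply, h5]
  ring

theorem prod_orbital (γ : ℝ) {N : ℕ} (μ : Fin N → ℕ) (z : Fin N → ℂ) (σ : Equiv.Perm (Fin N)) :
    ∏ j, orbital γ (μ j) (z (σ j)) =
      ((Real.sqrt (γ / (2 * Real.pi ^ (3 / 2 : ℝ))) : ℝ) : ℂ) ^ N *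
        ((Real.exp (-(γ ^ 2 / 2) * ∑ j, (μ j : ℝ) ^ 2) : ℝ) : ℂ) *
        ∏ j, Complex.exp (γ * z (σ j)) ^ μ j := by
  unfold orbital
  rw [Finset.prod_mul_distrib, Finset.prod_mul_distrib, Finset.prod_const, Finset.card_univ,
    Fintype.card_fin]
  congr 1
  · congr 1
    rw [← Complex.ofReal_prod, ← Real.exp_sum, Finset.mul_sum]
    congr 2
    refine Finset.sum_congr rfl fun j _ => ?_
    ring
  · refine Finset.prod_congr rfl fun j _ => ?_
    rw [← Complex.exp_nat_mul]
    congr 1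
    ring

theorem prod_sub_pow_Ioi (q : ℕ) {N : ℕ} (x : Fin N → ℂ) :
    ∏ j, ∏ k ∈ Ioi j, (x j - x k) ^ q =
      (-1) ^ (q * (N * (N - 1) / 2)) * ∏ j, ∏ i ∈ Iio j, (x j - x i) ^ q := by
  have h1 : ∏ j, ∏ k ∈ Ioi j, (x j - x k) ^ q = ∏ j, ∏ i ∈ Iio j, (x i - x j) ^ q :=
    Finset.prod_comm' (by simp)
  have h2 : ∀ j i : Fin N, (x i - x j) ^ q = (-1) ^ q * (x j - x i) ^ q := by
    intro j i
    rw [← mul_pow]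
    congr 1
    ring
  rw [h1, Finset.prod_congr rfl fun j _ => Finset.prod_congr rfl fun i _ => h2 j i]
  simp only [Finset.prod_mul_distrib, Finset.prod_const, Fin.card_Iio]
  congr 1
  rw [Finset.prod_pow_eq_pow_sum, ← pow_mul, sum_fin_val]

/-- The expansion of `Ψ_b` in the occupation-number basis. -/
theorem Psi_eq_partialWave (q : ℕ) {γ : ℝ} (hγ : 0 < γ) {N : ℕ} {b : Fin N → ℕ} (hb : Monotone b)
    (z : Fin N → ℂ) : Psi q γ b z = partialWave q γ b (dominatedPartitions q b) z := by
  have h1 : Psi q γ b z = (kappa q γ b : ℂ) * (-1) ^ (q * (N * (N - 1) / 2)) *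
      MvPolynomial.eval (fun j => Complex.exp (γ * z j)) (wavePoly q b) := by
    unfold Psi
    rw [prod_sub_pow_Ioi q fun j => Complex.exp (γ * z j), eval_wavePoly]
    ring
  rw [h1, eval_wavePoly_eq_sum q hb, Finset.mul_sum]
  refine Finset.sum_congr rfl fun μ _ => ?_
  unfold hCoeff Phi
  simp only [prod_orbital]
  set A : ℝ := Real.sqrt (γ / (2 * Real.pi ^ (3 / 2 : ℝ))) with hA
  set E : ℝ := Real.exp (-(γ ^ 2 / 2) * ∑ j, (μ j : ℝ) ^ 2) with hE
  set S : ℂ := ∑ σ : Equiv.Perm (Fin N),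
    sgnPow q σ * ∏ j, Complex.exp (γ * z (σ j)) ^ μ j with hS
  have hsum : ∑ σ : Equiv.Perm (Fin N), sgnPow q σ *
      ((A : ℂ) ^ N * (E : ℂ) * ∏ j, Complex.exp (γ * z (σ j)) ^ μ j) =
      (A : ℂ) ^ N * (E : ℂ) * S := by
    rw [hS, Finset.mul_sum]
    refine Finset.sum_congr rfl fun σ _ => ?_
    ring
  rw [hsum]
  have hocc : (0 : ℝ) < occFactorial μ := by exact_mod_cast occFactorial_pos μ
  have hN : (0 : ℝ) < (N ! : ℝ) := by positivity
  have hB : Real.sqrt (2 * Real.pi ^ (3 / 2 : ℝ) / γ) = A⁻¹ := by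
    rw [hA, ← Real.sqrt_inv, inv_div]
  have hA0 : A ≠ 0 := (Real.sqrt_pos.2 (by positivity)).ne'
  have hs : ((-1 : ℝ) ^ (q * (N * (N - 1) / 2))) * (-1) ^ (q * (N * (N - 1) / 2)) = 1 := by
    rw [← mul_pow]
    simp
  set L : ℝ := Real.exp (γ ^ 2 / 2 * ∑ j, (rootPartition q b j : ℝ) ^ 2) with hL
  have hexp : Real.exp (-(γ ^ 2 / 2) * Delta q b μ) * E = L⁻¹ := by
    rw [hE, hL, ← Real.exp_add, ← Real.exp_neg]
    congr 1
    unfold Delta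
    rw [Finset.sum_sub_distrib]
    ring
  have hreal : kappa q γ b * (-1) ^ (q * (N * (N - 1) / 2)) / (occFactorial μ : ℝ) =
      Real.exp (-(γ ^ 2 / 2) * Delta q b μ) / Real.sqrt (occFactorial μ) *
        (1 / Real.sqrt ((occFactorial μ : ℝ) * (N ! : ℝ))) * (A ^ N * E) := by
    have h2 : Real.exp (-(γ ^ 2 / 2) * Delta q b μ) / Real.sqrt (occFactorial μ) *
        (1 / Real.sqrt ((occFactorial μ : ℝ) * (N ! : ℝ))) * (A ^ N * E) =
        L⁻¹ * A ^ N / ((occFactorial μ : ℝ) * Real.sqrt (N ! : ℝ)) := by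
      rw [← hexp, Real.sqrt_mul hocc.le]
      have p1 := Real.sqrt_pos.2 hocc
      have p2 := Real.sqrt_pos.2 hN
      conv_rhs => rw [← Real.mul_self_sqrt hocc.le]
      field_simp
    rw [h2]
    unfold kappa
    rw [hB, ← hL, mul_inv, mul_inv, mul_inv, inv_pow A, inv_inv]
    have hs' : ((-1 : ℝ) ^ (q * (N * (N - 1) / 2)))⁻¹ = (-1) ^ (q * (N * (N - 1) / 2)) :=
      inv_eq_of_mul_eq_one_left hs
    rw [hs']
    linear_combination (A ^ N * L⁻¹ * (Real.sqrt (N ! : ℝ))⁻¹ / (occFactorial μ : ℝ)) * hs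
  have hc := congrArg (fun r : ℝ => (r : ℂ)) hreal
  push_cast at hc
  calc (kappa q γ b : ℂ) * (-1) ^ (q * (N * (N - 1) / 2)) *
        (wCoeff q b μ / (occFactorial μ : ℂ) * S)
      = ((kappa q γ b : ℂ) * (-1) ^ (q * (N * (N - 1) / 2)) / (occFactorial μ : ℂ)) *
        (wCoeff q b μ * S) := by ring
    _ = _ := by
      rw [hc]
      push_cast
      ring

/-! ### Majorant polynomials -/

/-- The coefficients of `P` bound those of `p` in absolute value. -/
def Majorizes {σ : Type*} (P : MvPolynomial σ ℝ) (p : MvPolynomial σ ℂ) : Prop :=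
  ∀ m, ‖p.coeff m‖ ≤ P.coeff m

namespace Majorizes

variable {σ : Type*} {P Q : MvPolynomial σ ℝ} {p r : MvPolynomial σ ℂ}

theorem mul (hp : Majorizes P p) (hr : Majorizes Q r) : Majorizes (P * Q) (p * r) := by
  classical
  intro m
  rw [MvPolynomial.coeff_mul, MvPolynomial.coeff_mul]
  refine (norm_sum_le _ _).trans (Finset.sum_le_sum fun x _ => ?_)
  rw [norm_mul]
  exact mul_le_mul (hp _) (hr _) (norm_nonneg _) ((norm_nonneg _).trans (hp _))

theorem sum {ι : Type*} (s : Finset ι) {P : ι → MvPolynomial σ ℝ} {p : ι → MvPolynomial σ ℂ}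
    (h : ∀ i ∈ s, Majorizes (P i) (p i)) : Majorizes (∑ i ∈ s, P i) (∑ i ∈ s, p i) := by
  intro m
  rw [MvPolynomial.coeff_sum, MvPolynomial.coeff_sum]
  exact (norm_sum_le _ _).trans (Finset.sum_le_sum fun i hi => h i hi m)

theorem monomial (m : σ →₀ ℕ) {c : ℝ} {d : ℂ} (h : ‖d‖ ≤ c) :
    Majorizes (MvPolynomial.monomial m c) (MvPolynomial.monomial m d) := by
  classical
  intro k
  rw [MvPolynomial.coeff_monomial, MvPolynomial.coeff_monomial]
  split_ifs
  · exact h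
  · simp

theorem one : Majorizes (1 : MvPolynomial σ ℝ) (1 : MvPolynomial σ ℂ) :=
  monomial 0 (c := 1) (d := 1) (by simp)

theorem prod {ι : Type*} (s : Finset ι) {P : ι → MvPolynomial σ ℝ} {p : ι → MvPolynomial σ ℂ}
    (h : ∀ i ∈ s, Majorizes (P i) (p i)) : Majorizes (∏ i ∈ s, P i) (∏ i ∈ s, p i) := by
  classical
  induction s using Finset.induction_on with
  | empty => exact one
  | insert i s hi ih =>
    rw [Finset.prod_insert hi, Finset.prod_insert hi]
    exact (h i (mem_insert_self i s)).mul (ih fun k hk => h k (mem_insert_of_mem hk))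

theorem pow (hp : Majorizes P p) (n : ℕ) : Majorizes (P ^ n) (p ^ n) := by
  induction n with
  | zero => exact one
  | succ n ih =>
    rw [pow_succ, pow_succ]
    exact ih.mul hp

theorem X_sub_X (i j : σ) : Majorizes (MvPolynomial.X j + MvPolynomial.X i)
    (MvPolynomial.X j - MvPolynomial.X i) := by
  intro m
  have h : ∀ k : σ, ‖MvPolynomial.coeff m (MvPolynomial.X k : MvPolynomial σ ℂ)‖ ≤
      MvPolynomial.coeff m (MvPolynomial.X k : MvPolynomial σ ℝ) := fun k =>
    monomial (Finsupp.single k 1) (c := 1) (d := 1) (by simp) m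
  rw [MvPolynomial.coeff_sub, MvPolynomial.coeff_add]
  exact (norm_sub_le _ _).trans (add_le_add (h j) (h i))

/-- The weighted `ℓ¹` norm of the coefficients is at most the value of the majorant. -/
theorem sum_norm_coeff_le [Fintype σ] (h : Majorizes P p) {x : σ → ℝ} (hx : ∀ j, 0 ≤ x j)
    (s : Finset (σ →₀ ℕ)) :
    ∑ m ∈ s, ‖p.coeff m‖ * ∏ j, x j ^ m j ≤ MvPolynomial.eval x P := by
  classical
  have hpos : ∀ m : σ →₀ ℕ, 0 ≤ ∏ j, x j ^ m j := fun m =>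
    Finset.prod_nonneg fun j _ => pow_nonneg (hx j) _
  have h0 : ∀ m, 0 ≤ P.coeff m := fun m => (norm_nonneg _).trans (h m)
  rw [MvPolynomial.eval_eq']
  calc ∑ m ∈ s, ‖p.coeff m‖ * ∏ j, x j ^ m j
      ≤ ∑ m ∈ s, P.coeff m * ∏ j, x j ^ m j :=
        Finset.sum_le_sum fun m _ => mul_le_mul_of_nonneg_right (h m) (hpos m)
    _ ≤ ∑ m ∈ s ∪ P.support, P.coeff m * ∏ j, x j ^ m j :=
        Finset.sum_le_sum_of_subset_of_nonneg Finset.subset_union_left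
          fun m _ _ => mul_nonneg (h0 m) (hpos m)
    _ = ∑ m ∈ P.support, P.coeff m * ∏ j, x j ^ m j := by
        symm
        refine Finset.sum_subset Finset.subset_union_right fun m _ hm => ?_
        rw [MvPolynomial.notMem_support_iff.1 hm, zero_mul]

end Majorizes

/-- The weighted `ℓ¹` norm of the expansion coefficients. -/
theorem sum_norm_wCoeff_le (q : ℕ) {N : ℕ} (b : Fin N → ℕ) {x : Fin N → ℝ} (hx : ∀ j, 0 ≤ x j)
    (S : Finset (Fin N → ℕ)) :
    ∑ μ ∈ S, ‖wCoeff q b μ‖ * ∏ j, x j ^ μ j ≤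
      (∑ β ∈ rearrangements b, ∏ j, x j ^ β j) * ∏ j, ∏ i ∈ Iio j, (x j + x i) ^ q := by
  classical
  have hmaj : Majorizes ((MvPolynomial.monomial 0 (1 / (occFactorial b : ℝ)) *
      ∑ τ : Equiv.Perm (Fin N), MvPolynomial.monomial (toExponent (b ∘ τ)) 1) *
        ∏ j, ∏ i ∈ Iio j, (MvPolynomial.X j + MvPolynomial.X i) ^ q) (wavePoly q b) := by
    unfold wavePoly vandermondePow
    refine ((Majorizes.monomial 0 ?_).mul (Majorizes.sum _ fun τ _ =>
      Majorizes.monomial _ ?_)).mul (Majorizes.prod _ fun j _ => Majorizes.prod _ fun i _ =>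
        (Majorizes.X_sub_X i j).pow q)
    · simp
    · simp
  have h := hmaj.sum_norm_coeff_le hx (S.image toExponent)
  have hinj : Function.Injective (toExponent (N := N)) := Finsupp.equivFunOnFinite.symm.injective
  rw [Finset.sum_image fun _ _ _ _ h => hinj h] at h
  simp only [coeff_wavePoly, toExponent_apply] at h
  refine h.trans (le_of_eq ?_)
  simp only [map_mul, map_sum, map_prod, map_pow, map_add, MvPolynomial.eval_X,
    MvPolynomial.eval_monomial, Finsupp.prod_zero_index, mul_one, one_mul]
  congr 1
  have h2 := sum_perm_comp b fun β => ∏ j, x j ^ β j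
  have h3 : ∀ τ : Equiv.Perm (Fin N), ((toExponent (b ∘ τ)).prod fun j e => x j ^ e) =
      ∏ j, x j ^ (b ∘ τ) j := fun τ => Finsupp.prod_fintype _ _ fun _ => pow_zero _
  simp only [h3, h2]
  have hocc : (occFactorial b : ℝ) ≠ 0 := by exact_mod_cast (occFactorial_pos b).ne'
  field_simp

/-! ### Geometric estimates -/

/-- A geometric sum with reversed exponents; `s` is any upper bound for `x / (1 - x)`. -/
theorem sum_pow_sub_le {x s : ℝ} (hx : 0 ≤ x) (h : x * (s + 1) ≤ s) (hs : 0 ≤ s) (n : ℕ) :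
    ∑ i ∈ range n, x ^ (n - i) ≤ s := by
  induction n with
  | zero => simpa using hs
  | succ n ih =>
    have : ∑ i ∈ range (n + 1), x ^ (n + 1 - i) = x * (∑ i ∈ range n, x ^ (n - i) + 1) := by
      rw [Finset.sum_range_succ, mul_add, Finset.mul_sum]
      congr 1
      · refine Finset.sum_congr rfl fun i hi => ?_
        have := mem_range.1 hi
        rw [← pow_succ', show n + 1 - i = n - i + 1 by omega]
      · simp
    rw [this]
    exact (mul_le_mul_of_nonneg_left (by linarith) hx).trans h

/-- A geometric sum; `s` is any upper bound for `1 / (1 - x)`. -/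
theorem sum_pow_le {x s : ℝ} (hx : 0 ≤ x) (h : 1 + x * s ≤ s) (hs : 0 ≤ s) (n : ℕ) :
    ∑ i ∈ range n, x ^ i ≤ s := by
  induction n with
  | zero => simpa using hs
  | succ n ih =>
    have : ∑ i ∈ range (n + 1), x ^ i = 1 + x * ∑ i ∈ range n, x ^ i := by
      rw [Finset.sum_range_succ', Finset.mul_sum, add_comm]
      simp [pow_succ']
    rw [this]
    linarith [mul_le_mul_of_nonneg_left ih hx]

/-- At `q = 1`, where `(4 q + 1) / 2` is least, this is the decay factor per unit step. -/
theorem exp_neg_five_halves_le : Real.exp (-(5 / 2)) ≤ 1 / 8 := by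
  have h1 : (5 / 4 : ℝ) ≤ Real.exp (1 / 4) := by
    have := Real.add_one_le_exp (1 / 4 : ℝ)
    linarith
  have h2 : Real.exp (5 / 2) = Real.exp (1 / 4) ^ 10 := by
    rw [← Real.exp_nat_mul]
    norm_num
  have h3 : (8 : ℝ) ≤ Real.exp (5 / 2) := by
    rw [h2]
    refine le_trans ?_ (pow_le_pow_left₀ (by norm_num) h1 10)
    norm_num
  rw [Real.exp_neg, one_div]
  exact inv_anti₀ (by norm_num) h3

/-- The value `e^{(4 q + 1) λ_j}` at which the majorant is evaluated, `λ` the root partition. -/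
def rootWeight (q : ℕ) {N : ℕ} (b : Fin N → ℕ) (j : Fin N) : ℝ :=
  Real.exp ((4 * q + 1) * (rootPartition q b j : ℝ))

theorem rootWeight_div_le {q : ℕ} (hq : 1 ≤ q) {N : ℕ} {b : Fin N → ℕ} (hb : Monotone b)
    {i j : Fin N} (hij : i < j) :
    rootWeight q b i / rootWeight q b j ≤ (1 / 4) ^ ((j : ℕ) - (i : ℕ)) := by
  have h1 : (1 / 8 : ℝ) ^ ((j : ℕ) - (i : ℕ)) ≤ (1 / 4) ^ ((j : ℕ) - (i : ℕ)) :=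
    pow_le_pow_left₀ (by norm_num) (by norm_num) _
  refine le_trans ?_ h1
  refine le_trans ?_ (pow_le_pow_left₀ (Real.exp_pos _).le exp_neg_five_halves_le _)
  unfold rootWeight
  rw [← Real.exp_sub, ← Real.exp_nat_mul]
  apply Real.exp_le_exp.2
  have h2 : ((j : ℕ) - (i : ℕ) : ℕ) + rootPartition q b i ≤ rootPartition q b j := by
    unfold rootPartition
    have h3 := hb hij.le
    have h4 : ((j : ℕ) - (i : ℕ)) + q * i ≤ q * j := by
      have h5 : (i : ℕ) < j := hij
      obtain ⟨d, hd⟩ := Nat.exists_eq_add_of_le h5.le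
      rw [hd, Nat.add_sub_cancel_left, mul_add, add_comm]
      exact Nat.add_le_add_left (Nat.le_mul_of_pos_left d hq) _
    omega
  have h3 : (((j : ℕ) - (i : ℕ) : ℕ) : ℝ) + rootPartition q b i ≤ rootPartition q b j := by
    exact_mod_cast h2
  have hq' : (1 : ℝ) ≤ q := by exact_mod_cast hq
  have h4 : (0 : ℝ) ≤ (((j : ℕ) - (i : ℕ) : ℕ) : ℝ) := Nat.cast_nonneg _
  nlinarith

/-- The Vandermonde factors, relative to their leading term, cost at most `e^{q/3}` per particle. -/
theorem prod_one_add_rootWeight_le {q : ℕ} (hq : 1 ≤ q) {M : ℕ} {b : Fin (M + 1) → ℕ}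
    (hb : Monotone b) :
    ∏ j, ∏ i ∈ Iio j, (1 + rootWeight q b i / rootWeight q b j) ^ q ≤
      Real.exp ((q : ℝ) * M / 3) := by
  have hpos : ∀ i j : Fin (M + 1), 0 ≤ 1 + rootWeight q b i / rootWeight q b j := fun i j =>
    add_nonneg zero_le_one (div_nonneg (Real.exp_pos _).le (Real.exp_pos _).le)
  have hj : ∀ j : Fin (M + 1), ∏ i ∈ Iio j, (1 + rootWeight q b i / rootWeight q b j) ^ q ≤
      Real.exp ((q : ℝ) / 3) := by
    intro j
    calc ∏ i ∈ Iio j, (1 + rootWeight q b i / rootWeight q b j) ^ q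
        ≤ ∏ i ∈ Iio j, Real.exp (q * (1 / 4) ^ ((j : ℕ) - (i : ℕ))) := by
          refine Finset.prod_le_prod (fun i _ => pow_nonneg (hpos i j) q) fun i hi => ?_
          rw [Real.exp_nat_mul]
          refine pow_le_pow_left₀ (hpos i j) ?_ q
          have h1 := rootWeight_div_le hq hb (mem_Iio.1 hi)
          have h2 := Real.add_one_le_exp ((1 / 4 : ℝ) ^ ((j : ℕ) - (i : ℕ)))
          linarith
      _ = Real.exp (q * ∑ i ∈ range j, (1 / 4 : ℝ) ^ ((j : ℕ) - i)) := by
          rw [← Real.exp_sum, ← Finset.mul_sum, ← Nat.Iio_eq_range, ← Fin.map_valEmbedding_Iio,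
            Finset.sum_map]
          rfl
      _ ≤ Real.exp ((q : ℝ) / 3) := by
          apply Real.exp_le_exp.2
          have := sum_pow_sub_le (x := 1 / 4) (s := 1 / 3) (by norm_num) (by norm_num)
            (by norm_num) j
          have hq0 : (0 : ℝ) ≤ q := Nat.cast_nonneg q
          calc (q : ℝ) * ∑ i ∈ range j, (1 / 4 : ℝ) ^ ((j : ℕ) - i) ≤ q * (1 / 3) :=
                mul_le_mul_of_nonneg_left this hq0
            _ = q / 3 := by ring
  rw [Fin.prod_univ_succ]
  have h0 : Iio (0 : Fin (M + 1)) = ∅ := by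
    ext i
    simp
  rw [h0, Finset.prod_empty, one_mul]
  calc ∏ j : Fin M, ∏ i ∈ Iio j.succ, (1 + rootWeight q b i / rootWeight q b j.succ) ^ q
      ≤ ∏ _j : Fin M, Real.exp ((q : ℝ) / 3) :=
        Finset.prod_le_prod (fun j _ => Finset.prod_nonneg fun i _ => pow_nonneg (hpos _ _) q)
          fun j _ => hj j.succ
    _ = Real.exp ((q : ℝ) * M / 3) := by
        rw [Finset.prod_const, Finset.card_univ, Fintype.card_fin, ← Real.exp_nat_mul]
        congr 1
        ring

/-- By the rearrangement inequality, replacing `b` by a rearrangement `β` costs at least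
`∑ (b_j - β_j)² / 2`. -/
theorem sum_sq_sub_le_of_mem_rearrangements (q : ℕ) {N : ℕ} {b β : Fin N → ℕ} (hb : Monotone b)
    (hβ : β ∈ rearrangements b) :
    ∑ j, ((b j : ℝ) - β j) ^ 2 / 2 ≤
      ∑ j, (rootPartition q b j : ℝ) * ((b j : ℝ) - β j) := by
  obtain ⟨τ, rfl⟩ := mem_rearrangements.1 hβ
  have hmono : Monovary (fun j : Fin N => (q : ℝ) * (j : ℕ)) fun j => (b j : ℝ) := by
    intro i j hij
    have hij' : (b i : ℝ) < b j := hij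
    have : i ≤ j := by
      by_contra h
      exact absurd (hb (not_le.1 h).le) (not_le.2 (by exact_mod_cast hij'))
    refine mul_le_mul_of_nonneg_left ?_ (Nat.cast_nonneg q)
    exact_mod_cast this
  have h1 := hmono.sum_mul_comp_perm_le_sum_mul (σ := τ)
  have h2 : ∑ j, ((b (τ j) : ℝ)) ^ 2 = ∑ j, (b j : ℝ) ^ 2 :=
    Equiv.sum_comp τ fun j => (b j : ℝ) ^ 2
  have h3 : ∑ j, (rootPartition q b j : ℝ) * ((b j : ℝ) - ((b ∘ τ) j : ℕ)) -
      ∑ j, ((b j : ℝ) - ((b ∘ τ) j : ℕ)) ^ 2 / 2 =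
      (∑ j : Fin N, (q : ℝ) * (j : ℕ) * b j - ∑ j : Fin N, (q : ℝ) * (j : ℕ) * b (τ j)) +
        (∑ j, (b j : ℝ) ^ 2 - ∑ j, ((b (τ j) : ℝ)) ^ 2) / 2 := by
    rw [← Finset.sum_sub_distrib, ← Finset.sum_sub_distrib, ← Finset.sum_sub_distrib,
      Finset.sum_div, ← Finset.sum_add_distrib]
    refine Finset.sum_congr rfl fun j _ => ?_
    simp only [rootPartition, Function.comp_apply]
    push_cast
    ring
  linarith

theorem exp_neg_sq_le {q : ℕ} (hq : 1 ≤ q) (k l : ℕ) :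
    Real.exp (-((4 * q + 1) * (((k : ℝ) - l) ^ 2 / 2))) ≤ (1 / 8) ^ (k - l + (l - k)) := by
  refine le_trans ?_ (pow_le_pow_left₀ (Real.exp_pos _).le exp_neg_five_halves_le _)
  rw [← Real.exp_nat_mul]
  apply Real.exp_le_exp.2
  have hq' : (1 : ℝ) ≤ q := by exact_mod_cast hq
  have h : ((k - l + (l - k) : ℕ) : ℝ) ≤ ((k : ℝ) - l) ^ 2 := by
    rcases le_total k l with h | h
    · obtain ⟨d, rfl⟩ := Nat.exists_eq_add_of_le h
      have hd : (d : ℝ) ≤ (d : ℝ) ^ 2 := by exact_mod_cast Nat.le_self_pow two_ne_zero d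
      rw [show k - (k + d) + (k + d - k) = d by omega]
      push_cast
      nlinarith
    · obtain ⟨d, rfl⟩ := Nat.exists_eq_add_of_le h
      have hd : (d : ℝ) ≤ (d : ℝ) ^ 2 := by exact_mod_cast Nat.le_self_pow two_ne_zero d
      rw [show l + d - l + (l - (l + d)) = d by omega]
      push_cast
      nlinarith
  nlinarith [sq_nonneg ((k : ℝ) - l)]

theorem sum_pow_dist_le (k K : ℕ) :
    ∑ l ∈ range K, (1 / 8 : ℝ) ^ (k - l + (l - k)) ≤ Real.exp (2 / 7) := by
  have h1 : ∑ l ∈ range K, (1 / 8 : ℝ) ^ (k - l + (l - k)) ≤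
      ∑ l ∈ range (k + K), (1 / 8 : ℝ) ^ (k - l + (l - k)) :=
    Finset.sum_le_sum_of_subset_of_nonneg (range_mono (by omega)) fun _ _ _ => by positivity
  rw [Finset.sum_range_add] at h1
  have h2 : ∑ l ∈ range k, (1 / 8 : ℝ) ^ (k - l + (l - k)) = ∑ l ∈ range k, (1 / 8) ^ (k - l) := by
    refine Finset.sum_congr rfl fun l hl => ?_
    have := mem_range.1 hl
    rw [show k - l + (l - k) = k - l by omega]
  have h3 : ∑ l ∈ range K, (1 / 8 : ℝ) ^ (k - (k + l) + (k + l - k)) =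
      ∑ l ∈ range K, (1 / 8 : ℝ) ^ l := by
    refine Finset.sum_congr rfl fun l _ => ?_
    rw [show k - (k + l) + (k + l - k) = l by omega]
  rw [h2, h3] at h1
  have h4 := sum_pow_sub_le (x := 1 / 8) (s := 1 / 7) (by norm_num) (by norm_num) (by norm_num) k
  have h5 := sum_pow_le (x := 1 / 8) (s := 8 / 7) (by norm_num) (by norm_num) (by norm_num) K
  have h6 := Real.add_one_le_exp (2 / 7 : ℝ)
  linarith

/-- All rearrangements together cost at most a bounded factor per particle. For a single particle
there is only one rearrangement, which makes the exponent proportional to `M` instead of `M + 1`. -/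
theorem sum_rearrangements_le {q : ℕ} (hq : 1 ≤ q) {M : ℕ} {b : Fin (M + 1) → ℕ}
    (hb : Monotone b) :
    ∑ β ∈ rearrangements b, Real.exp (-((4 * q + 1) *
      ∑ j, (rootPartition q b j : ℝ) * ((b j : ℝ) - β j))) ≤ Real.exp (4 * M / 7) := by
  classical
  rcases Nat.eq_zero_or_pos M with rfl | hM
  · have : rearrangements b = {b} := by
      ext β
      rw [mem_rearrangements, mem_singleton]
      constructor
      · rintro ⟨τ, rfl⟩
        funext j
        rw [Function.comp_apply, show τ j = j from Fin.ext (by omega)]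
      · rintro rfl
        exact ⟨1, rfl⟩
    rw [this, sum_singleton]
    simp
  set K : ℕ := ∑ j, b j + 1 with hK
  have hsub : rearrangements b ⊆ Fintype.piFinset fun _ => range K := by
    intro β hβ
    rw [Fintype.mem_piFinset]
    intro j
    rw [mem_range, hK, ← sum_of_mem_rearrangements hβ]
    exact Nat.lt_succ_of_le (Finset.single_le_sum (f := β) (fun _ _ => Nat.zero_le _) (mem_univ j))
  calc ∑ β ∈ rearrangements b, Real.exp (-((4 * q + 1) *
        ∑ j, (rootPartition q b j : ℝ) * ((b j : ℝ) - β j)))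
      ≤ ∑ β ∈ rearrangements b, ∏ j, (1 / 8 : ℝ) ^ (b j - β j + (β j - b j)) := by
        refine Finset.sum_le_sum fun β hβ => ?_
        calc Real.exp (-((4 * q + 1) * ∑ j, (rootPartition q b j : ℝ) * ((b j : ℝ) - β j)))
            ≤ Real.exp (∑ j, -((4 * q + 1) * (((b j : ℝ) - β j) ^ 2 / 2))) := by
              apply Real.exp_le_exp.2
              rw [Finset.sum_neg_distrib, ← Finset.mul_sum]
              exact neg_le_neg (mul_le_mul_of_nonneg_left
                (sum_sq_sub_le_of_mem_rearrangements q hb hβ) (by positivity))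
          _ ≤ ∏ j, (1 / 8 : ℝ) ^ (b j - β j + (β j - b j)) := by
              rw [Real.exp_sum]
              exact Finset.prod_le_prod (fun j _ => (Real.exp_pos _).le)
                fun j _ => exp_neg_sq_le hq _ _
    _ ≤ ∑ β ∈ Fintype.piFinset fun _ => range K, ∏ j, (1 / 8 : ℝ) ^ (b j - β j + (β j - b j)) :=
        Finset.sum_le_sum_of_subset_of_nonneg hsub fun _ _ _ =>
          Finset.prod_nonneg fun _ _ => by positivity
    _ = ∏ j, ∑ l ∈ range K, (1 / 8 : ℝ) ^ (b j - l + (l - b j)) := by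
        rw [Finset.prod_univ_sum]
    _ ≤ ∏ _j : Fin (M + 1), Real.exp (2 / 7) :=
        Finset.prod_le_prod (fun j _ => Finset.sum_nonneg fun _ _ => by positivity)
          fun j _ => sum_pow_dist_le _ _
    _ ≤ Real.exp (4 * M / 7) := by
        rw [Finset.prod_const, Finset.card_univ, Fintype.card_fin, ← Real.exp_nat_mul]
        apply Real.exp_le_exp.2
        have : (1 : ℝ) ≤ M := by exact_mod_cast hM
        push_cast
        linarith

/-- The weighted `ℓ¹` norm of the expansion coefficients grows at most exponentially with the
length of the root. -/
theorem sum_norm_wCoeff_exp_le {q : ℕ} (hq : 1 ≤ q) {M : ℕ} {b : Fin (M + 1) → ℕ}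
    (hb : Monotone b) (S : Finset (Fin (M + 1) → ℕ)) :
    ∑ μ ∈ S, ‖wCoeff q b μ‖ * Real.exp (-((4 * q + 1) *
        ∑ j, (rootPartition q b j : ℝ) * ((rootPartition q b j : ℝ) - μ j))) ≤
      Real.exp (4 * M / 7 + q * M / 3) := by
  set R : Fin (M + 1) → ℝ := rootWeight q b with hR
  have hRpos : ∀ j, 0 < R j := fun j => Real.exp_pos _
  have hpow : ∀ α : Fin (M + 1) → ℕ, ∏ j, R j ^ α j =
      Real.exp ((4 * q + 1) * ∑ j, (rootPartition q b j : ℝ) * α j) := by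
    intro α
    rw [Finset.mul_sum, Real.exp_sum]
    refine Finset.prod_congr rfl fun j _ => ?_
    rw [hR, rootWeight, ← Real.exp_nat_mul]
    congr 1
    ring
  have hdiff : ∀ α β : Fin (M + 1) → ℕ, Real.exp (-((4 * q + 1) *
      ∑ j, (rootPartition q b j : ℝ) * ((α j : ℝ) - β j))) =
      (∏ j, R j ^ β j) / ∏ j, R j ^ α j := by
    intro α β
    rw [hpow, hpow, ← Real.exp_sub]
    congr 1
    rw [← mul_sub, ← Finset.sum_sub_distrib, ← mul_neg, ← Finset.sum_neg_distrib]
    congr 1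
    refine Finset.sum_congr rfl fun j _ => ?_
    ring
  have hroot : ∏ j, R j ^ rootPartition q b j = (∏ j, R j ^ b j) * ∏ j, ∏ _i ∈ Iio j, R j ^ q := by
    rw [← Finset.prod_mul_distrib]
    refine Finset.prod_congr rfl fun j _ => ?_
    rw [Finset.prod_const, Fin.card_Iio, ← pow_mul, ← pow_add, rootPartition, add_comm]
  have hfac : ∏ j, ∏ i ∈ Iio j, (R j + R i) ^ q =
      (∏ j, ∏ _i ∈ Iio j, R j ^ q) * ∏ j, ∏ i ∈ Iio j, (1 + R i / R j) ^ q := by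
    rw [← Finset.prod_mul_distrib]
    refine Finset.prod_congr rfl fun j _ => ?_
    rw [← Finset.prod_mul_distrib]
    refine Finset.prod_congr rfl fun i _ => ?_
    rw [← mul_pow, mul_add, mul_one, mul_div_cancel₀ _ (hRpos j).ne']
  have hmain := sum_norm_wCoeff_le q b (fun j => (hRpos j).le) S
  have hb0 : 0 < ∏ j, R j ^ b j := Finset.prod_pos fun j _ => pow_pos (hRpos j) _
  have hv0 : 0 < ∏ j, ∏ _i ∈ Iio j, R j ^ q :=
    Finset.prod_pos fun j _ => Finset.prod_pos fun _ _ => pow_pos (hRpos j) _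
  calc ∑ μ ∈ S, ‖wCoeff q b μ‖ * Real.exp (-((4 * q + 1) *
        ∑ j, (rootPartition q b j : ℝ) * ((rootPartition q b j : ℝ) - μ j)))
      = (∑ μ ∈ S, ‖wCoeff q b μ‖ * ∏ j, R j ^ μ j) / ∏ j, R j ^ rootPartition q b j := by
        rw [Finset.sum_div]
        refine Finset.sum_congr rfl fun μ _ => ?_
        rw [hdiff, mul_div_assoc]
    _ ≤ ((∑ β ∈ rearrangements b, ∏ j, R j ^ β j) * ∏ j, ∏ i ∈ Iio j, (R j + R i) ^ q) /
          ∏ j, R j ^ rootPartition q b j :=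
        div_le_div_of_nonneg_right hmain
          (Finset.prod_nonneg fun j _ => pow_nonneg (hRpos j).le _)
    _ = (∑ β ∈ rearrangements b, Real.exp (-((4 * q + 1) *
          ∑ j, (rootPartition q b j : ℝ) * ((b j : ℝ) - β j)))) *
          ∏ j, ∏ i ∈ Iio j, (1 + R i / R j) ^ q := by
        rw [Finset.sum_congr rfl fun β _ => hdiff b β, ← Finset.sum_div, hroot, hfac]
        field_simp
    _ ≤ Real.exp (4 * M / 7) * Real.exp (q * M / 3) := by
        refine mul_le_mul (sum_rearrangements_le hq hb) (prod_one_add_rootWeight_le hq hb) ?_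
          (Real.exp_pos _).le
        refine Finset.prod_nonneg fun j _ => Finset.prod_nonneg fun i _ => pow_nonneg ?_ q
        exact add_nonneg zero_le_one (div_nonneg (hRpos i).le (hRpos j).le)
    _ = Real.exp (4 * M / 7 + q * M / 3) := (Real.exp_add _ _).symm

/-! ### The norm of the irreducible part -/

theorem partialSum_castSucc {α : Type*} [AddCommMonoid α] {M : ℕ} (x : Fin (M + 1) → α) {i : ℕ}
    (hi : i ≤ M) : partialSum (fun j : Fin M => x j.castSucc) i = partialSum x i := by
  unfold partialSum
  rw [Fin.sum_univ_castSucc, if_neg (by rw [Fin.val_last]; omega), add_zero]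
  rfl

/-- Summation by parts: if the interior partial sums of `x` are at most `-c`, then pairing `x` with
an increasing `y` gains at least `c` times the total increase of `y`. -/
theorem le_sum_mul_of_partialSum_le {M : ℕ} {x y : Fin (M + 1) → ℝ} {c : ℝ} (hy : Monotone y)
    (hx : ∀ i, 1 ≤ i → i ≤ M → partialSum x i ≤ -c) :
    (∑ j, x j) * y (Fin.last M) + c * (y (Fin.last M) - y 0) ≤ ∑ j, x j * y j := by
  induction M with
  | zero => simp
  | succ M ih =>
    have h1 := ih (x := fun j => x j.castSucc) (y := fun j => y j.castSucc)
      (fun _ _ h => hy h) fun i h1 h2 => by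
        rw [partialSum_castSucc x (by omega)]
        exact hx i h1 (by omega)
    have h2 := hx (M + 1) (by omega) le_rfl
    rw [← partialSum_castSucc x le_rfl, partialSum_of_le _ le_rfl] at h2
    have h3 : y (Fin.last M).castSucc ≤ y (Fin.last (M + 1)) := hy (Fin.le_last _)
    rw [Fin.sum_univ_castSucc, Fin.sum_univ_castSucc (f := fun j => x j * y j)]
    simp only [Fin.castSucc_zero] at h1
    nlinarith

theorem partialSum_sub_cast {N : ℕ} (lam μ : Fin N → ℕ) (i : ℕ) :
    partialSum (fun j => (lam j : ℝ) - μ j) i =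
      ((partialSum lam i : ℕ) : ℝ) - ((partialSum μ i : ℕ) : ℝ) := by
  unfold partialSum
  push_cast
  rw [← Finset.sum_sub_distrib]
  refine Finset.sum_congr rfl fun j _ => ?_
  split_ifs <;> simp

/-- The difference is `∑ (λ_j - μ_j) μ_j`, which is nonnegative by summation by parts. -/
theorem le_Delta {q : ℕ} {M : ℕ} {b μ : Fin (M + 1) → ℕ} (h : Dominated μ (rootPartition q b)) :
    ∑ j, (rootPartition q b j : ℝ) * ((rootPartition q b j : ℝ) - μ j) ≤ Delta q b μ := by
  obtain ⟨hμ, -, hsum, hpart⟩ := dominated_iff.1 h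
  have h1 := le_sum_mul_of_partialSum_le (x := fun j => (rootPartition q b j : ℝ) - μ j)
    (y := fun j => (μ j : ℝ)) (c := 0) (fun _ _ h => Nat.cast_le.2 (hμ h)) (fun i _ _ => by
      rw [partialSum_sub_cast, neg_zero, sub_nonpos]
      exact_mod_cast hpart i)
  have h2 : ∑ j, ((rootPartition q b j : ℝ) - μ j) = 0 := by
    rw [Finset.sum_sub_distrib, sub_eq_zero]
    exact_mod_cast hsum.symm
  rw [h2] at h1
  have h3 : Delta q b μ = ∑ j, (rootPartition q b j : ℝ) * ((rootPartition q b j : ℝ) - μ j) +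
      ∑ j, ((rootPartition q b j : ℝ) - μ j) * μ j := by
    unfold Delta
    rw [← Finset.sum_add_distrib]
    refine Finset.sum_congr rfl fun j _ => ?_
    ring
  linarith

/-- For an irreducible partition all interior partial sums are strictly larger than those of the root,
so summation by parts gains the full length of the root. -/
theorem length_le_of_irred {q : ℕ} {M : ℕ} {b μ : Fin (M + 1) → ℕ} (hb : Monotone b)
    (h : Dominated μ (rootPartition q b)) (hirr : Irred q b μ) :
    (rootPartition q b (Fin.last M) : ℝ) - rootPartition q b 0 ≤
      ∑ j, (rootPartition q b j : ℝ) * ((rootPartition q b j : ℝ) - μ j) := by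
  obtain ⟨-, hroot, hsum, hpart⟩ := dominated_iff.1 h
  have h1 := le_sum_mul_of_partialSum_le (x := fun j => (rootPartition q b j : ℝ) - μ j)
    (y := fun j => (rootPartition q b j : ℝ)) (c := 1)
    (fun _ _ h => Nat.cast_le.2 (hroot h)) (fun i hi hiM => by
      have hne : partialSum μ i ≠ partialSum (rootPartition q b) i := fun heq =>
        hirr i ((hasRenewalAt_iff hb h i).2 ⟨hi, by omega, heq⟩)
      have hlt : partialSum (rootPartition q b) i + 1 ≤ partialSum μ i :=
        lt_of_le_of_ne (hpart i) hne.symm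
      have : ((partialSum (rootPartition q b) i : ℕ) : ℝ) + 1 ≤ ((partialSum μ i : ℕ) : ℝ) := by
        exact_mod_cast hlt
      rw [partialSum_sub_cast]
      linarith)
  have h2 : ∑ j, ((rootPartition q b j : ℝ) - μ j) = 0 := by
    rw [Finset.sum_sub_distrib, sub_eq_zero]
    exact_mod_cast hsum.symm
  rw [h2] at h1
  simp only [mul_comm] at h1 ⊢
  linarith

theorem norm_hCoeff_sq_le (q : ℕ) (γ : ℝ) {N : ℕ} (b μ : Fin N → ℕ) :
    ‖hCoeff q γ b μ‖ ^ 2 ≤ Real.exp (-(γ ^ 2 * Delta q b μ)) * ‖wCoeff q b μ‖ ^ 2 := by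
  have hocc : (1 : ℝ) ≤ occFactorial μ := by exact_mod_cast occFactorial_pos μ
  unfold hCoeff
  rw [norm_div, norm_mul, Complex.norm_real, Complex.norm_real, Real.norm_of_nonneg
    (Real.exp_pos _).le, Real.norm_of_nonneg (Real.sqrt_nonneg _), div_pow, mul_pow,
    Real.sq_sqrt (zero_le_one.trans hocc), ← Real.exp_nat_mul]
  have he : ((2 : ℕ) : ℝ) * (-(γ ^ 2 / 2) * Delta q b μ) = -(γ ^ 2 * Delta q b μ) := by
    push_cast
    ring
  rw [he]
  exact div_le_self (by positivity) hocc

/-- The bound on the irreducible wavefunctions with an explicit constant. The exponential factor in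
`h_b(μ)²` is split: the part `2 (4 q + 1)` of `γ²` controls the coefficients `w_b(μ)`, the rest
yields the decay in the length. -/
theorem normSq_PsiHat_le {q : ℕ} (hq : 1 ≤ q) {γ : ℝ} (hγ : 0 < γ) {M : ℕ} {b : Fin (M + 1) → ℕ}
    (hb : Monotone b) (h : 2 * (4 * (q : ℝ) + 1) ≤ γ ^ 2) :
    normSq γ (PsiHat q γ b) ≤ Real.exp (-(((rootPartition q b (Fin.last M) : ℝ) -
      rootPartition q b 0) * (γ ^ 2 - 2 * (4 * q + 1) - 38 / 21))) := by
  set len : ℝ := (rootPartition q b (Fin.last M) : ℝ) - rootPartition q b 0 with hlen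
  set a : ℝ := 4 * q + 1 with ha
  have ha0 : 0 ≤ a := by positivity
  have hlenM : (q : ℝ) * M ≤ len := by
    have h0 : (b 0 : ℝ) ≤ b (Fin.last M) := by exact_mod_cast hb (Fin.zero_le _)
    simp only [hlen, rootPartition, Fin.val_last, Fin.val_zero]
    push_cast
    linarith
  have hM : (M : ℝ) ≤ q * M := by
    have : (1 : ℝ) ≤ q := by exact_mod_cast hq
    exact le_mul_of_one_le_left (Nat.cast_nonneg M) this
  set X : (Fin (M + 1) → ℕ) → ℝ := fun μ => ‖wCoeff q b μ‖ * Real.exp (-(a *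
    ∑ j, (rootPartition q b j : ℝ) * ((rootPartition q b j : ℝ) - μ j))) with hX
  have hX0 : ∀ μ, 0 ≤ X μ := fun μ => mul_nonneg (norm_nonneg _) (Real.exp_pos _).le
  have hmono : ∀ μ ∈ irredPartitions q b, Monotone μ := fun μ hμ =>
    ((mem_irredPartitions q b μ).1 hμ).1.1
  have hterm : ∀ μ ∈ irredPartitions q b,
      ‖hCoeff q γ b μ‖ ^ 2 ≤ Real.exp (-(len * (γ ^ 2 - 2 * a))) * X μ ^ 2 := by
    intro μ hμ
    obtain ⟨hdom, hirr⟩ := (mem_irredPartitions q b μ).1 hμ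
    have h1 := le_Delta hdom
    have h2 := length_le_of_irred hb hdom hirr
    refine (norm_hCoeff_sq_le q γ b μ).trans ?_
    simp only [hX]
    rw [mul_pow, ← Real.exp_nat_mul, mul_left_comm, ← Real.exp_add, mul_comm]
    refine mul_le_mul_of_nonneg_left (Real.exp_le_exp.2 ?_) (by positivity)
    set D : ℝ := ∑ j, (rootPartition q b j : ℝ) * ((rootPartition q b j : ℝ) - μ j) with hD
    push_cast
    -- beyond the minimal energy `len`, only the part `2 a` of `γ²` is spent
    nlinarith [mul_nonneg (sub_nonneg.2 h) (sub_nonneg.2 (h2.trans h1)),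
      mul_nonneg ha0 (sub_nonneg.2 h1)]
  have hsq : ∑ μ ∈ irredPartitions q b, X μ ^ 2 ≤ (∑ μ ∈ irredPartitions q b, X μ) ^ 2 :=
    Finset.sum_sq_le_sq_sum_of_nonneg fun μ _ => hX0 μ
  have hsum : ∑ μ ∈ irredPartitions q b, X μ ≤ Real.exp (19 / 21 * len) := by
    refine (sum_norm_wCoeff_exp_le hq hb _).trans (Real.exp_le_exp.2 ?_)
    linarith
  calc normSq γ (PsiHat q γ b) ≤ ∑ μ ∈ irredPartitions q b, ‖hCoeff q γ b μ‖ ^ 2 :=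
        normSq_partialWave_le q hγ b hmono
    _ ≤ ∑ μ ∈ irredPartitions q b, Real.exp (-(len * (γ ^ 2 - 2 * a))) * X μ ^ 2 :=
        Finset.sum_le_sum hterm
    _ ≤ Real.exp (-(len * (γ ^ 2 - 2 * a))) * Real.exp (19 / 21 * len) ^ 2 := by
        rw [← Finset.mul_sum]
        refine mul_le_mul_of_nonneg_left (hsq.trans ?_) (Real.exp_pos _).le
        exact pow_le_pow_left₀ (Finset.sum_nonneg fun μ _ => hX0 μ) hsum 2
    _ = Real.exp (-(len * (γ ^ 2 - 2 * a - 38 / 21))) := by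
        rw [← Real.exp_nat_mul, ← Real.exp_add]
        congr 1
        push_cast
        ring

/-! ### The decay rate -/

/-- The logarithm is at least `-1/7`, and `π √(2/3) ≥ 2.5`, which leaves room above `38/21`. -/
theorem decayRate_le {q : ℕ} (hq : 1 ≤ q) (γ : ℝ) :
    decayRate q γ ≤ γ ^ 2 - 2 * (4 * q + 1) - 38 / 21 := by
  have hq' : (1 : ℝ) ≤ q := by exact_mod_cast hq
  have he : Real.exp (-(4 * q + 1)) ≤ 1 / 8 :=
    (Real.exp_le_exp.2 (by linarith)).trans exp_neg_five_halves_le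
  have hlog : -(1 / 7) ≤ Real.log (1 - Real.exp (-(4 * q + 1))) := by
    have h7 : (7 / 8 : ℝ) ≤ 1 - Real.exp (-(4 * q + 1)) := by linarith
    have h1 := Real.one_sub_inv_le_log_of_pos (show (0 : ℝ) < 7 / 8 by norm_num)
    have h2 := Real.log_le_log (by norm_num) h7
    norm_num at h1
    linarith
  have hlog0 : Real.log (1 - Real.exp (-(4 * q + 1))) ≤ 0 :=
    Real.log_nonpos (by linarith) (by linarith [Real.exp_pos (-(4 * (q : ℝ) + 1))])
  have hinv : (q : ℝ)⁻¹ ≤ 1 := inv_le_one_of_one_le₀ hq'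
  have hinv0 : 0 ≤ (q : ℝ)⁻¹ := by positivity
  have hsqrt : (4 / 5 : ℝ) ≤ √(2 / 3) := Real.le_sqrt_of_sq_le (by norm_num)
  have hpi : 3.14 * (4 / 5 : ℝ) ≤ Real.pi * √(2 / 3) :=
    mul_le_mul Real.pi_gt_d2.le hsqrt (by norm_num) Real.pi_pos.le
  have hprod : (q : ℝ)⁻¹ * -Real.log (1 - Real.exp (-(4 * q + 1))) ≤ 1 * (1 / 7) :=
    mul_le_mul hinv (by linarith) (by linarith) zero_le_one
  unfold decayRate
  linarith

theorem eventually_decayRate_pos (q : ℕ) : ∀ᶠ γ : ℝ in Filter.atTop, 0 < decayRate q γ := by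
  have h : Filter.Tendsto (fun γ : ℝ => γ ^ 2) Filter.atTop Filter.atTop :=
    Filter.tendsto_pow_atTop two_ne_zero
  filter_upwards [h.eventually_gt_atTop (2 * (4 * q + 1) +
    2 * (q : ℝ)⁻¹ * Real.log (1 - Real.exp (-(4 * q + 1))) + Real.pi * √(2 / 3))] with γ hγ
  unfold decayRate
  linarith

/-- The bound on the irreducible wavefunctions, with the decay rate `decayRate q γ`. -/
theorem normSq_PsiHat_le_exp_decayRate {q : ℕ} (hq : 1 ≤ q) {γ : ℝ} (hγ : 0 < γ) {M : ℕ}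
    {b : Fin (M + 1) → ℕ} (hb : Monotone b) (h : 2 * (4 * (q : ℝ) + 1) ≤ γ ^ 2) :
    normSq γ (PsiHat q γ b) ≤
      Real.exp (-((q * (((M + 1 : ℕ) : ℝ) - 1) + (b (Fin.last M) : ℝ) - (b 0 : ℝ)) *
        decayRate q γ)) := by
  refine (normSq_PsiHat_le hq hγ hb h).trans (Real.exp_le_exp.2 (neg_le_neg ?_))
  have hlen : (rootPartition q b (Fin.last M) : ℝ) - rootPartition q b 0 =
      q * (((M + 1 : ℕ) : ℝ) - 1) + (b (Fin.last M) : ℝ) - (b 0 : ℝ) := by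
    simp only [rootPartition, Fin.val_last, Fin.val_zero]
    push_cast
    ring
  rw [← hlen]
  have hmono : (rootPartition q b 0 : ℝ) ≤ rootPartition q b (Fin.last M) := by
    exact_mod_cast monotone_rootPartition q hb (Fin.zero_le _)
  exact mul_le_mul_of_nonneg_left (decayRate_le hq γ) (sub_nonneg.2 hmono)

end QHall

end

theorem mainTheorem7 (q : ℕ) (hq : 1 ≤ q) :
    (∀ (γ : ℝ), 0 < γ → ∀ (N : ℕ) (hN : 1 ≤ N) (b : Fin N → ℕ), Monotone b →
      (∀ z : Fin N → ℂ, QHall.Psi q γ b z = ∑ c : Composition N, QHall.segmentTerm q γ b c z) ∧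
      (∀ c : Composition N, MeasureTheory.MemLp (QHall.segmentTerm q γ b c) 2 (QHall.cylMeasure γ N)) ∧
      (∀ c c' : Composition N, c ≠ c' →
        QHall.scalarProd γ (QHall.segmentTerm q γ b c) (QHall.segmentTerm q γ b c') = 0) ∧
      MeasureTheory.MemLp (QHall.PsiHat q γ b) 2 (QHall.cylMeasure γ N) ∧
      (2 * (4 * (q : ℝ) + 1) ≤ γ ^ 2 →
        QHall.normSq γ (QHall.PsiHat q γ b) ≤
          Real.exp (-((q * ((N : ℝ) - 1) + (b ⟨N - 1, by omega⟩ : ℝ) - (b ⟨0, by omega⟩ : ℝ)) *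
            QHall.decayRate q γ))) ∧
      (0 ≤ QHall.decayRate q γ →
        QHall.normSq γ (QHall.PsiHat q γ b) ≤
          Real.exp (-((q * ((N : ℝ) - 1) + (b ⟨N - 1, by omega⟩ : ℝ) - (b ⟨0, by omega⟩ : ℝ)) *
            QHall.decayRate q γ)) ∧
        Real.exp (-((q * ((N : ℝ) - 1) + (b ⟨N - 1, by omega⟩ : ℝ) - (b ⟨0, by omega⟩ : ℝ)) *
            QHall.decayRate q γ)) ≤
          Real.exp (-(q * ((N : ℝ) - 1) * QHall.decayRate q γ)))) ∧
    ∀ᶠ γ : ℝ in Filter.atTop, 0 < QHall.decayRate q γ := by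
  refine ⟨fun γ hγ N hN b hb => ?_, QHall.eventually_decayRate_pos q⟩
  obtain ⟨M, rfl⟩ := Nat.exists_eq_add_of_le' hN
  refine ⟨fun z => ?_, fun c => ?_, fun c c' hc => ?_, QHall.memLp_partialWave q hγ b _,
    QHall.normSq_PsiHat_le_exp_decayRate hq hγ hb,
    fun hC => ⟨QHall.normSq_PsiHat_le_exp_decayRate hq hγ hb ?_, ?_⟩⟩
  · simp only [QHall.segmentTerm_eq hq γ hN hb]
    rw [QHall.sum_partialWave_segmentPartitions, QHall.Psi_eq_partialWave q hγ hb]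
  · rw [QHall.segmentTerm_eq hq γ hN hb]
    exact QHall.memLp_partialWave q hγ b _
  · rw [QHall.segmentTerm_eq hq γ hN hb, QHall.segmentTerm_eq hq γ hN hb]
    exact QHall.scalarProd_partialWave_eq_zero q hγ b
      (fun μ hμ => (QHall.mem_segmentPartitions.1 hμ).1.1)
      (fun μ hμ => (QHall.mem_segmentPartitions.1 hμ).1.1)
      (QHall.disjoint_segmentPartitions q b hc)
  · linarith [QHall.decayRate_le hq γ]
  · refine Real.exp_le_exp.2 (neg_le_neg (mul_le_mul_of_nonneg_right ?_ hC))
    have : (b 0 : ℝ) ≤ b (Fin.last M) := by exact_mod_cast hb (Fin.zero_le _)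
    exact le_sub_iff_add_le.2 (add_le_add_right this _)
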